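/- Let $(M,g)$ be a compact smooth Riemannian manifold without boundary of dimension $n\ge 3$, with Riemannian volume $dx$, and let $V\in L^{n/2}(M)$ be real-valued. Let $-\Delta_g$ denote the nonnegative self-adjoint Laplace–Beltrami operator on the complex Hilbert space $L^2(M)$ (the Friedrichs extension of $-\Delta_g$ on $C^\infty(M)$), and let $\mathcal Q=\mathrm{Dom}(\sqrt{-\Delta_g+1})$. For $u,v\in\mathcal Q$ put $$q_V(u,v)=\int_M(-\Delta_g u)\,\overline v\,dx+\int_M V u\,\overline v\,dx,$$ where the first term stands for $\langle\sqrt{-\Delta_g+1}\,u,\sqrt{-\Delta_g+1}\,v\rangle_{L^2}-\langle u,v\rangle_{L^2}$. Then the following hold. (1) The second integral converges absolutely for all $u,v\in\mathcal Q$, and $q_V$ is symmetric, bounded from below (there is $c\in\mathbb R$ with $q_V(u,u)\ge c\|u\|_2^2$ for all $u\in\mathcal Q$) and closed. (2) $C^\infty(M)$ is a form core for $q_V$: $C^\infty(M)\subset\mathcal Q$, and for every $u\in\mathcal Q$ there are $u_m\in C^\infty(M)$ with $\|u-u_m\|_2^2\to0$ and $q_V(u-u_m,u-u_m)\to0$.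 (3) There is exactly one self-adjoint operator $H_V$ on $L^2(M)$ such that $\mathrm{Dom}(H_V)\subset\mathcal Q$ and $q_V(u,v)=\langle H_Vu,v\rangle_{L^2}$ for all $u\in\mathrm{Dom}(H_V)$, $v\in\mathcal Q$. The operator $H_V$ is bounded from below; $\mathrm{Dom}(H_V)$ consists of all $u\in\mathcal Q$ for which the distribution $-\Delta_gu+Vu$ belongs to $L^2(M)$, and $H_Vu=-\Delta_gu+Vu$ for such $u$. (4) $H_V$ has discrete spectrum: every point of its spectrum is an isolated point of the spectrum and an eigenvalue of finite multiplicity. (5) There are real constants $N_0$ and $C$ such that for all real $N\ge N_0$ the operator $H_V+N$ has a nonnegative self-adjoint square root, and $$\|u\|_{L^{2n/(n-2)}(M)}\le C\,\bigl\|\sqrt{H_V+N}\,u\bigr\|_{L^2(M)}\qquad\text{for all }u\in\mathrm{Dom}(H_V).$$ -/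

import Mathlib

open MeasureTheory Filter Topology
open scoped Manifold ContDiff ComplexConjugate InnerProductSpace ENNReal LinearPMap

noncomputable section

/-! ## Unbounded operators and quadratic forms on a complex Hilbert space -/

section HilbertSpace

variable {H : Type*} [NormedAddCommGroup H] [InnerProductSpace ℂ H] [CompleteSpace H]

/-- The operator `T + c` with domain `Dom T`. -/
def shiftOp (T : H →ₗ.[ℂ] H) (c : ℂ) : H →ₗ.[ℂ] H :=
  (c • (LinearMap.id : H →ₗ[ℂ] H)) +ᵥ T

/-- The operator `T` is bounded from below (semibounded):
`c ‖u‖² ≤ ⟨T u, u⟩` on `Dom T` for some real `c`. -/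
def OpBoundedBelow (T : H →ₗ.[ℂ] H) : Prop :=
  ∃ c : ℝ, ∀ u : T.domain, c * ‖(u : H)‖ ^ 2 ≤ (⟪(u : H), T u⟫_ℂ).re

/-- The closure, in `H`, of `Dom T` with respect to the form norm of a nonnegative symmetric
operator `T`: all limits in `H` of sequences of `Dom T` that are Cauchy for
`⟨T u, u⟩`. For a nonnegative symmetric `T` these limits already form a subspace, so that taking
the span adds nothing. -/
def formClosureDomain (T : H →ₗ.[ℂ] H) : Submodule ℂ H :=
  Submodule.span ℂ {u : H | ∃ s : ℕ → T.domain,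
    Tendsto (fun m => (s m : H)) atTop (𝓝 u) ∧
    Tendsto (fun p : ℕ × ℕ => ⟪((s p.1 - s p.2 : T.domain) : H), T (s p.1 - s p.2)⟫_ℂ)
      atTop (𝓝 0)}

/-- The Friedrichs extension of a densely defined nonnegative symmetric operator `T`: the
restriction of the adjoint `T†` to the vectors of `Dom T†` lying in the form closure of `Dom T`. -/
def friedrichs (T : H →ₗ.[ℂ] H) : H →ₗ.[ℂ] H :=
  T†.domRestrict (formClosureDomain T)

/-- `B` is a nonnegative self-adjoint square root of `T`: `B` is self-adjoint, `B ≥ 0`, and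
`B ∘ B = T`, including the domains: `Dom T = {u ∈ Dom B | B u ∈ Dom B}`. -/
def IsPosSqrt (B T : H →ₗ.[ℂ] H) : Prop :=
  IsSelfAdjoint B ∧
  (∀ u : B.domain, 0 ≤ (⟪(u : H), B u⟫_ℂ).re) ∧
  ∀ u f : H, (u, f) ∈ T.graph ↔ ∃ w : H, (u, w) ∈ B.graph ∧ (w, f) ∈ B.graph

open Classical in
/-- The square root of a nonnegative self-adjoint operator `T`, that is, its unique nonnegative
self-adjoint square root (`⊥`, the zero operator on the zero subspace, when there is none). -/
def opSqrt (T : H →ₗ.[ℂ] H) : H →ₗ.[ℂ] H :=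
  if h : ∃ B : H →ₗ.[ℂ] H, IsPosSqrt B T then h.choose else ⊥

/-- The spectrum of an unbounded operator: the complex numbers `z` for which `T - z` has no
everywhere defined bounded two-sided inverse. -/
def opSpectrum (T : H →ₗ.[ℂ] H) : Set ℂ :=
  {z : ℂ | ¬ ∃ R : H →L[ℂ] H,
    (∀ f : H, (R f, f) ∈ (shiftOp T (-z)).graph) ∧
    ∀ u f : H, (u, f) ∈ (shiftOp T (-z)).graph → R f = u}

/-- The eigenspace `{u ∈ Dom T | T u = z u}`. -/
def opEigenspace (T : H →ₗ.[ℂ] H) (z : ℂ) : Submodule ℂ H :=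
  T.graph.comap (LinearMap.prod LinearMap.id (z • LinearMap.id))

/-- The spectrum is discrete: each point of the spectrum is an isolated point of the spectrum and
an eigenvalue of finite multiplicity. -/
def HasDiscreteSpectrum (T : H →ₗ.[ℂ] H) : Prop :=
  ∀ z ∈ opSpectrum T,
    (∃ ε : ℝ, 0 < ε ∧ ∀ w ∈ opSpectrum T, w ≠ z → ε ≤ ‖w - z‖) ∧
    opEigenspace T z ≠ ⊥ ∧ FiniteDimensional ℂ (opEigenspace T z)

variable {D : Submodule ℂ H}

/-- The form `q` with domain `D` is bounded from below: `c ‖u‖² ≤ q(u,u)` for some real `c`. -/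
def FormBoundedBelow (q : D → D → ℂ) : Prop :=
  ∃ c : ℝ, ∀ u : D, c * ‖(u : H)‖ ^ 2 ≤ (q u u).re

/-- A form `q` that is bounded from below is closed: a sequence of `D` that converges in `H` and is
`q`-Cauchy has its limit in `D` and converges to it with respect to `q`. -/
def FormClosed (q : D → D → ℂ) : Prop :=
  ∀ (s : ℕ → D) (u : H), Tendsto (fun m => (s m : H)) atTop (𝓝 u) →
    Tendsto (fun p : ℕ × ℕ => q (s p.1 - s p.2) (s p.1 - s p.2)) atTop (𝓝 0) →
    ∃ hu : u ∈ D, Tendsto (fun m => q (s m - ⟨u, hu⟩) (s m - ⟨u, hu⟩)) atTop (𝓝 0)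

/-- `S` is a form core of `q`: `S ⊆ D`, and each `u ∈ D` is the limit of a sequence `w m` of `S`
with respect to the norm of `H` and to `q`. -/
def IsFormCore (q : D → D → ℂ) (S : Submodule ℂ H) : Prop :=
  S ≤ D ∧ ∀ u : D, ∃ w : ℕ → D, (∀ m, (w m : H) ∈ S) ∧
    Tendsto (fun m => ‖((u - w m : D) : H)‖ ^ 2) atTop (𝓝 0) ∧
    Tendsto (fun m => q (u - w m) (u - w m)) atTop (𝓝 0)

/-- The form `q` (linear in the first variable) represents the operator `T`: `Dom T ⊆ D` and
`q(u,v) = ⟨T u, v⟩` for `u ∈ Dom T`, `v ∈ D`, where `⟨f, v⟩ = ∫ f v̄` is linear in `f`. -/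
def FormRepresents (q : D → D → ℂ) (T : H →ₗ.[ℂ] H) : Prop :=
  ∀ u : T.domain, ∃ hu : (u : H) ∈ D, ∀ v : D, q ⟨u, hu⟩ v = ⟪(v : H), T u⟫_ℂ

end HilbertSpace

/-! ## Riemannian manifolds: volume measure and Laplace–Beltrami operator -/

section Manifold

variable {n : ℕ} {M : Type*} [TopologicalSpace M] [ChartedSpace (EuclideanSpace ℝ (Fin n)) M]
  [IsManifold (𝓡 n) ∞ M]

/-- The chart of the atlas around `x`, with values in `ℝⁿ`. -/
abbrev chartR (n : ℕ) {M : Type*} [TopologicalSpace M]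
    [ChartedSpace (EuclideanSpace ℝ (Fin n)) M] (x : M) :
    OpenPartialHomeomorph M (EuclideanSpace ℝ (Fin n)) :=
  chartAt (EuclideanSpace ℝ (Fin n)) x

/-- The `i`-th vector of the standard basis of `ℝⁿ`. -/
abbrev stdVec {n : ℕ} (i : Fin n) : EuclideanSpace ℝ (Fin n) := EuclideanSpace.single i 1

/-- Smooth Riemannian metrics on `M`. -/
abbrev SmoothMetric (n : ℕ) (M : Type*) [TopologicalSpace M]
    [ChartedSpace (EuclideanSpace ℝ (Fin n)) M] [IsManifold (𝓡 n) ∞ M] :=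
  Bundle.ContMDiffRiemannianMetric (𝓡 n) ∞ (EuclideanSpace ℝ (Fin n))
    (fun p : M => TangentSpace (𝓡 n) p)

/-- The coordinate vector field `∂_i` of the chart around `x`, at the point with coordinates `y`. -/
def coordVec (x : M) (y : EuclideanSpace ℝ (Fin n)) (i : Fin n) :
    TangentSpace (𝓡 n) ((chartR n x).symm y) :=
  mfderiv (𝓡 n) (𝓡 n) (chartR n x).symm y (stdVec i)

/-- The matrix `g_{ij} = g(∂_i, ∂_j)` of the metric in the chart around `x`, as a function of the
coordinates `y`. -/
def metricMatrix (g : SmoothMetric n M) (x : M) (y : EuclideanSpace ℝ (Fin n)) :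
    Matrix (Fin n) (Fin n) ℝ :=
  Matrix.of fun i j => g.inner ((chartR n x).symm y) (coordVec x y i) (coordVec x y j)

/-- The Riemannian density `√(det g_{ij})` in the chart around `x`. -/
def metricDensity (g : SmoothMetric n M) (x : M) (y : EuclideanSpace ℝ (Fin n)) : ℝ :=
  √(metricMatrix g x y).det

/-- The Riemannian volume on the domain of the chart around `x`, as a measure on `M`: the image
under the inverse of the chart of the measure `√(det g_{ij}) dy`. -/
def chartVolume [MeasurableSpace M] (g : SmoothMetric n M) (x : M) : Measure M :=
  ((volume.restrict (chartR n x).target).withDensity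
    fun y => ENNReal.ofReal (metricDensity g x y)).map (chartR n x).symm

/-- The Riemannian volume measure. The measures `chartVolume g x` agree on the overlaps
of the chart domains, so that their least upper bound is the measure that restricts to each of them
on the corresponding chart domain. -/
def riemannianVolume [MeasurableSpace M] (g : SmoothMetric n M) : Measure M :=
  ⨆ x : M, chartVolume g x

/-- The expression of the function `f` in the chart around `x`. -/
def inChart (x : M) (f : M → ℂ) : EuclideanSpace ℝ (Fin n) → ℂ :=
  fun y => f ((chartR n x).symm y)

/-- The Laplace–Beltrami operator on smooth functions, computed at `p` in the chart around `p`: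
`Δ_g f = ∑_{i,j} ( g^{ij} ∂_i ∂_j f + |g|^{-1/2} ∂_i(|g|^{1/2} g^{ij}) ∂_j f )`, where `|g|` is the
determinant of the matrix `(g_{ij})` and `(g^{ij})` is its inverse. -/
def laplaceBeltrami (g : SmoothMetric n M) (f : M → ℂ) (p : M) : ℂ :=
  let y := chartR n p p
  let F := inChart (n := n) p f
  ∑ i : Fin n, ∑ j : Fin n,
    (((metricMatrix g p y)⁻¹ i j : ℝ) * fderiv ℝ (fun z => fderiv ℝ F z (stdVec j)) y (stdVec i)
      + (((metricDensity g p y)⁻¹ *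
          fderiv ℝ (fun z => metricDensity g p z * (metricMatrix g p z)⁻¹ i j) y (stdVec i) : ℝ) : ℂ)
        * fderiv ℝ F y (stdVec j))

/-- Smooth complex-valued functions on `M`. -/
abbrev IsSmoothFun (n : ℕ) {M : Type*} [TopologicalSpace M]
    [ChartedSpace (EuclideanSpace ℝ (Fin n)) M] (f : M → ℂ) : Prop :=
  ContMDiff (𝓡 n) 𝓘(ℝ, ℂ) ∞ f

lemma contDiffAt_inChart (x : M) {f : M → ℂ} (hf : IsSmoothFun n f) :
    ContDiffAt ℝ ∞ (inChart (n := n) x f) (chartR n x x) := by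
  have hy : chartR n x x ∈ (chartR n x).target := mem_chart_target _ x
  have h : ContMDiffAt (𝓡 n) (𝓡 n) ∞ (chartR n x).symm (chartR n x x) :=
    (contMDiffOn_chart_symm (I := 𝓡 n) (n := ∞) (x := x)).contMDiffAt
      ((chartR n x).open_target.mem_nhds hy)
  exact (ContMDiffAt.comp (chartR n x x) hf.contMDiffAt h).contDiffAt

lemma differentiableAt_fderiv_inChart (x : M) {f : M → ℂ} (hf : IsSmoothFun n f)
    (v : EuclideanSpace ℝ (Fin n)) :
    DifferentiableAt ℝ (fun z => fderiv ℝ (inChart (n := n) x f) z v) (chartR n x x) := by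
  have h := (contDiffAt_inChart x hf).fderiv_right (m := 1) (by norm_cast)
  exact (h.differentiableAt one_ne_zero).clm_apply (differentiableAt_const v)

lemma laplaceBeltrami_add (g : SmoothMetric n M) {f h : M → ℂ} (hf : IsSmoothFun n f)
    (hh : IsSmoothFun n h) (p : M) :
    laplaceBeltrami g (f + h) p = laplaceBeltrami g f p + laplaceBeltrami g h p := by
  have e : inChart (n := n) p (f + h) = inChart p f + inChart p h := rfl
  have h1 : ∀ᶠ z in 𝓝 (chartR n p p), fderiv ℝ (inChart (n := n) p (f + h)) z =
      fderiv ℝ (inChart p f) z + fderiv ℝ (inChart p h) z := by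
    filter_upwards [((contDiffAt_inChart p hf).of_le (m := 1) (by norm_cast)).eventually (by simp),
      ((contDiffAt_inChart p hh).of_le (m := 1) (by norm_cast)).eventually (by simp)] with z h1 h2
    rw [e, fderiv_add (h1.differentiableAt one_ne_zero) (h2.differentiableAt one_ne_zero)]
  have h2 : ∀ v, fderiv ℝ (fun z => fderiv ℝ (inChart (n := n) p (f + h)) z v) (chartR n p p) =
      fderiv ℝ (fun z => fderiv ℝ (inChart p f) z v) (chartR n p p)
        + fderiv ℝ (fun z => fderiv ℝ (inChart p h) z v) (chartR n p p) := by
    intro v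
    rw [← fderiv_add (differentiableAt_fderiv_inChart p hf v)
      (differentiableAt_fderiv_inChart p hh v)]
    refine Filter.EventuallyEq.fderiv_eq (h1.mono fun z hz => ?_)
    simp [hz]
  simp only [laplaceBeltrami, h2, h1.self_of_nhds, ← Finset.sum_add_distrib]
  refine Finset.sum_congr rfl fun i _ => Finset.sum_congr rfl fun j _ => ?_
  simp only [add_apply]
  ring

lemma laplaceBeltrami_smul (g : SmoothMetric n M) (c : ℂ) {f : M → ℂ} (hf : IsSmoothFun n f)
    (p : M) : laplaceBeltrami g (c • f) p = c * laplaceBeltrami g f p := by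
  have e : inChart (n := n) p (c • f) = c • inChart p f := rfl
  have h1 : ∀ᶠ z in 𝓝 (chartR n p p), fderiv ℝ (inChart (n := n) p (c • f)) z =
      c • fderiv ℝ (inChart p f) z := by
    filter_upwards [((contDiffAt_inChart p hf).of_le (m := 1) (by norm_cast)).eventually (by simp)]
      with z h1
    rw [e, fderiv_const_smul (h1.differentiableAt one_ne_zero)]
  have h2 : ∀ v, fderiv ℝ (fun z => fderiv ℝ (inChart (n := n) p (c • f)) z v) (chartR n p p) =
      c • fderiv ℝ (fun z => fderiv ℝ (inChart p f) z v) (chartR n p p) := by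
    intro v
    rw [← fderiv_const_smul (differentiableAt_fderiv_inChart p hf v)]
    refine Filter.EventuallyEq.fderiv_eq (h1.mono fun z hz => ?_)
    simp [hz]
  simp only [laplaceBeltrami, h2, h1.self_of_nhds, Finset.mul_sum]
  refine Finset.sum_congr rfl fun i _ => Finset.sum_congr rfl fun j _ => ?_
  simp only [smul_apply, smul_eq_mul]
  ring

lemma isSmoothFun_smul {M : Type*} [TopologicalSpace M]
    [ChartedSpace (EuclideanSpace ℝ (Fin n)) M] (c : ℂ) {f : M → ℂ} (hf : IsSmoothFun n f) :
    IsSmoothFun n (c • f) :=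
  ((c • ContinuousLinearMap.id ℝ ℂ).contDiff.contMDiff).comp hf

variable [MeasurableSpace M]

/-- The complex Hilbert space `L²(M)` with respect to the Riemannian volume. -/
abbrev L2 (g : SmoothMetric n M) : Type _ := Lp ℂ 2 (riemannianVolume g)

/-- The subspace `C^∞(M)` of `L²(M)`. -/
def smoothL2 (g : SmoothMetric n M) : Submodule ℂ (L2 g) where
  carrier := {u | ∃ φ : M → ℂ, IsSmoothFun n φ ∧ u =ᵐ[riemannianVolume g] φ}
  zero_mem' := ⟨0, contMDiff_const, Lp.coeFn_zero _ _ _⟩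
  add_mem' := by
    rintro u v ⟨φ, hφ, hu⟩ ⟨ψ, hψ, hv⟩
    exact ⟨φ + ψ, hφ.add hψ, (Lp.coeFn_add u v).trans (hu.add hv)⟩
  smul_mem' := by
    rintro c u ⟨φ, hφ, hu⟩
    exact ⟨c • φ, isSmoothFun_smul c hφ, (Lp.coeFn_smul c u).trans (hu.const_smul c)⟩

/-- The graph of `-Δ_g` on `C^∞(M)`, in `L²(M) × L²(M)`. -/
def smoothLaplacianGraph (g : SmoothMetric n M) : Submodule ℂ (L2 g × L2 g) where
  carrier := {u | ∃ φ : M → ℂ, IsSmoothFun n φ ∧ u.1 =ᵐ[riemannianVolume g] φ ∧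
    u.2 =ᵐ[riemannianVolume g] fun p => -laplaceBeltrami g φ p}
  zero_mem' := by
    refine ⟨0, contMDiff_const, Lp.coeFn_zero _ _ _, (Lp.coeFn_zero _ _ _).trans ?_⟩
    refine Filter.Eventually.of_forall fun p => ?_
    have h := laplaceBeltrami_smul g 0 (f := 0) contMDiff_const p
    rw [smul_zero, zero_mul] at h
    simp [h]
  add_mem' := by
    rintro u v ⟨φ, hφ, hu, hu'⟩ ⟨ψ, hψ, hv, hv'⟩
    refine ⟨φ + ψ, hφ.add hψ, (Lp.coeFn_add u.1 v.1).trans (hu.add hv),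
      (Lp.coeFn_add u.2 v.2).trans ((hu'.add hv').trans ?_)⟩
    refine Filter.Eventually.of_forall fun p => ?_
    simp only [Pi.add_apply, laplaceBeltrami_add g hφ hψ p]
    ring
  smul_mem' := by
    rintro c u ⟨φ, hφ, hu, hu'⟩
    refine ⟨c • φ, isSmoothFun_smul c hφ, (Lp.coeFn_smul c u.1).trans (hu.const_smul c),
      (Lp.coeFn_smul c u.2).trans ((hu'.const_smul c).trans ?_)⟩
    refine Filter.Eventually.of_forall fun p => ?_
    simp [laplaceBeltrami_smul g c hφ p]

/-- The operator `-Δ_g` in `L²(M)` with domain `C^∞(M)`. -/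
def smoothLaplacian (g : SmoothMetric n M) : L2 g →ₗ.[ℂ] L2 g :=
  (smoothLaplacianGraph g).toLinearPMap

/-- The self-adjoint operator `-Δ_g` in `L²(M)`: the Friedrichs extension of `-Δ_g` on
`C^∞(M)`. -/
def laplacian (g : SmoothMetric n M) : L2 g →ₗ.[ℂ] L2 g :=
  friedrichs (smoothLaplacian g)

/-- The operator `√(-Δ_g + 1)` in `L²(M)`. -/
def sqrtLaplacian (g : SmoothMetric n M) : L2 g →ₗ.[ℂ] L2 g :=
  opSqrt (shiftOp (laplacian g) 1)

/-- The quadratic form `q_V(u,v) = ∫ (-Δ_g u) v̄ + ∫ V u v̄` of `-Δ_g + V` on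
`Dom √(-Δ_g + 1)`, where `∫ (-Δ_g u) v̄` stands for the form
`⟨√(-Δ_g + 1) u, √(-Δ_g + 1) v⟩ - ⟨u, v⟩` of `-Δ_g`. -/
def schrodingerForm (g : SmoothMetric n M) (V : M → ℝ) (u v : (sqrtLaplacian g).domain) : ℂ :=
  (⟪sqrtLaplacian g v, sqrtLaplacian g u⟫_ℂ - ⟪(v : L2 g), (u : L2 g)⟫_ℂ)
    + ∫ p, (V p : ℂ) * (u : L2 g) p * conj ((v : L2 g) p) ∂riemannianVolume g

end Manifold

end

noncomputable section

set_option linter.unusedSectionVars false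

/-! ### Graphs, adjoints, and inverses of bounded injective operators -/

section AbstractForms

variable {H : Type*} [NormedAddCommGroup H] [InnerProductSpace ℂ H] [CompleteSpace H]

/-! Everything is transferred to bounded operators on the form space. Let `Q` be the completion of
the smooth functions for the inner product `⟨(-Δ_g + 1)u, v⟩`, and `ι : Q → L²(M)` the inclusion,
which is injective with dense range. A bounded self-adjoint `S` on `Q` gives the form `⟪y, S x⟫` and
the operator `formOp ι S`, in which `ι x ↦ f` exactly when `S x = ι* f`. If `S` is coercive, this
operator is the inverse of the bounded nonnegative injective operator `ι S⁻¹ ι*`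
(`formOp_eq_inverseOp`). Its self-adjointness and the existence of its square root then need only
bounded functional calculus, and when `ι` is compact the discreteness of its spectrum is the theory
of compact self-adjoint operators. Moreover any nonnegative self-adjoint square root `B` of it has
domain `ι(Q)` and satisfies `⟪B ι y, B ι x⟫ = ⟪y, S x⟫` (`IsPosSqrt.domain_and_inner`). With `S = 1`
and `shiftOp_friedrichs` this identifies the domain of `√(-Δ_g + 1)` with `ι(Q)`.

Two analytic facts about `ι` are needed: the Sobolev embedding into `L^{2n/(n-2)}`
(`exists_eLpNorm_le_norm`) and the compactness into `L²` (`isCompactOperator_sobolevIncl`). Both are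
localized by a partition of unity. In a chart, the first is the Gagliardo–Nirenberg–Sobolev
inequality and the second comes from mollification. To compare the form norm with Euclidean `H¹`
norms one needs Green's formula (`integral_laplaceBeltrami_mul`), and hence the independence of the
Laplacian of the chart (`localLaplacian_transition`).

The potential is a simple function plus a part that is small in `L^{n/2}`. Hölder's inequality and
the Sobolev embedding therefore bound `∫ |V||u|²` by `ε‖u‖_Q² + K‖u‖₂²` for every `ε > 0`. So the
form of `V` is given by a bounded self-adjoint `W` on `Q`, `q_V` is the form of `S = 1 - ι*ι + W`,
and `S + N ι*ι` is coercive with constant `1/2` for all large `N`. The claims about `H_V = formOp ι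
S` follow from the abstract part; its distributional description holds because smooth functions are
dense in `Q`. -/

lemma mem_graph_shiftOp (T : H →ₗ.[ℂ] H) (c : ℂ) (u f : H) :
    (u, f) ∈ (shiftOp T c).graph ↔ (u, f - c • u) ∈ T.graph := by
  simp only [LinearPMap.mem_graph_iff]
  constructor
  · rintro ⟨y, hy, h⟩
    refine ⟨y, hy, ?_⟩
    have h2 : c • (y : H) + T y = f := h
    have h3 : (y : H) = u := hy
    change T y = f - c • u
    rw [← h2, ← h3, add_sub_cancel_left]
  · rintro ⟨y, hy, h⟩
    refine ⟨y, hy, ?_⟩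
    have h2 : T y = f - c • u := h
    have h3 : (y : H) = u := hy
    change c • (y : H) + T y = f
    rw [h2, h3, add_sub_cancel]

lemma mem_graph_adjoint {T : H →ₗ.[ℂ] H} (hT : Dense (T.domain : Set H)) (u f : H) :
    (u, f) ∈ T†.graph ↔ ∀ a b, (a, b) ∈ T.graph → ⟪b, u⟫_ℂ = ⟪a, f⟫_ℂ := by
  rw [LinearPMap.adjoint_graph_eq_graph_adjoint hT, Submodule.mem_adjoint_iff]
  simp [sub_eq_zero]

lemma mem_domain_iff_exists_graph (T : H →ₗ.[ℂ] H) (u : H) :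
    u ∈ T.domain ↔ ∃ f, (u, f) ∈ T.graph := T.mem_domain_iff

lemma isSelfAdjoint_of_mem_graph_iff {T : H →ₗ.[ℂ] H} (hT : Dense (T.domain : Set H))
    (h : ∀ u f, (u, f) ∈ T.graph ↔ ∀ a b, (a, b) ∈ T.graph → ⟪b, u⟫_ℂ = ⟪a, f⟫_ℂ) :
    IsSelfAdjoint T := by
  rw [LinearPMap.isSelfAdjoint_def]
  refine LinearPMap.eq_of_eq_graph ?_
  ext ⟨u, f⟩
  rw [mem_graph_adjoint hT, h]

lemma inner_graph_of_isSelfAdjoint {T : H →ₗ.[ℂ] H} (hT : IsSelfAdjoint T) {u f a b : H}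
    (h : (u, f) ∈ T.graph) (h' : (a, b) ∈ T.graph) : ⟪b, u⟫_ℂ = ⟪a, f⟫_ℂ := by
  rw [← LinearPMap.isSelfAdjoint_def.mp hT] at h
  exact (mem_graph_adjoint hT.dense_domain u f).1 h a b h'

/-- Self-adjoint operators have no proper self-adjoint extensions: taking adjoints reverses the
inclusion. -/
lemma eq_of_graph_le_of_isSelfAdjoint {T T' : H →ₗ.[ℂ] H} (hT : IsSelfAdjoint T)
    (hT' : IsSelfAdjoint T') (h : ∀ u f, (u, f) ∈ T'.graph → (u, f) ∈ T.graph) : T' = T := by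
  refine LinearPMap.eq_of_eq_graph ?_
  ext ⟨u, f⟩
  refine ⟨h u f, fun huf => ?_⟩
  rw [← LinearPMap.isSelfAdjoint_def.mp hT', mem_graph_adjoint hT'.dense_domain]
  exact fun a b hab => inner_graph_of_isSelfAdjoint hT huf (h a b hab)

/-- The inverse of an injective bounded operator. -/
def inverseOp (P : H →L[ℂ] H) : H →ₗ.[ℂ] H :=
  (P.toLinearMap.graph.map (LinearEquiv.prodComm ℂ H H).toLinearMap).toLinearPMap

lemma mem_graph_inverseOp {P : H →L[ℂ] H} (hP : Function.Injective P) (u f : H) :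
    (u, f) ∈ (inverseOp P).graph ↔ u = P f := by
  rw [inverseOp, Submodule.toLinearPMap_graph_eq]
  · simp [LinearMap.mem_graph_iff]
  · rintro ⟨a, b⟩ h (rfl : a = 0)
    have : 0 = P b := by simpa [LinearMap.mem_graph_iff] using h
    exact hP (by simp [← this])

lemma dense_range_of_injective {P : H →L[ℂ] H} (hP : Function.Injective P)
    (hs : IsSelfAdjoint P) : DenseRange P := by
  have h : P.rangeᗮ = ⊥ := by
    rw [ContinuousLinearMap.orthogonal_range, ← ContinuousLinearMap.star_eq_adjoint, hs.star_eq]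
    exact LinearMap.ker_eq_bot.2 hP
  have h2 := Submodule.topologicalClosure_eq_top_iff.2 h
  exact Submodule.dense_iff_topologicalClosure_eq_top.2 h2

lemma isSelfAdjoint_inverseOp {P : H →L[ℂ] H} (hP : Function.Injective P)
    (hs : IsSelfAdjoint P) : IsSelfAdjoint (inverseOp P) := by
  have hd : Dense ((inverseOp P).domain : Set H) := by
    refine (dense_range_of_injective hP hs).mono ?_
    rintro _ ⟨f, rfl⟩
    exact ((inverseOp P).mem_domain_iff).2 ⟨f, (mem_graph_inverseOp hP _ _).2 rfl⟩
  have hs' : ∀ x y, ⟪P x, y⟫_ℂ = ⟪x, P y⟫_ℂ := fun x y => hs.isSymmetric x y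
  refine isSelfAdjoint_of_mem_graph_iff hd fun u f => ?_
  simp only [mem_graph_inverseOp hP]
  constructor
  · rintro rfl a b rfl
    exact (hs' b f).symm
  · intro h
    refine ext_inner_left ℂ fun b => ?_
    rw [h _ b rfl, hs']

/-- With `K = √P` from the continuous functional calculus, `K` is injective because `K² = P` is, and
`K⁻¹` composed with itself is `P⁻¹`, domains included. -/
lemma exists_isPosSqrt_inverseOp {P : H →L[ℂ] H} (hP : Function.Injective P) (h0 : 0 ≤ P) :
    ∃ B, IsPosSqrt B (inverseOp P) := by
  set K := CFC.sqrt P with hK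
  have hKK : K * K = P := CFC.sqrt_mul_sqrt_self P h0
  have hK0 : 0 ≤ K := CFC.sqrt_nonneg P
  have hKP : K.IsPositive := (ContinuousLinearMap.nonneg_iff_isPositive K).1 hK0
  have hKi : Function.Injective K := by
    refine Function.Injective.of_comp (f := K) ?_
    convert hP
    rw [← hKK]; rfl
  refine ⟨inverseOp K, isSelfAdjoint_inverseOp hKi hKP.isSelfAdjoint, fun u => ?_, fun u f => ?_⟩
  · have h1 : ((u : H), inverseOp K u) ∈ (inverseOp K).graph := (inverseOp K).mem_graph u
    rw [mem_graph_inverseOp hKi] at h1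
    rw [h1]
    have := hKP.re_inner_nonneg_left (inverseOp K u)
    simpa using this
  · simp only [mem_graph_inverseOp hP, mem_graph_inverseOp hKi]
    constructor
    · rintro rfl
      exact ⟨K f, by rw [← hKK]; rfl, rfl⟩
    · rintro ⟨w, rfl, rfl⟩
      rw [← hKK]; rfl

end AbstractForms

/-! ### Representation theorems for closed forms, in terms of bounded operators on the form space -/

section FormOperators

variable {H : Type*} [NormedAddCommGroup H] [InnerProductSpace ℂ H] [CompleteSpace H]
  {Q : Type*} [NormedAddCommGroup Q] [InnerProductSpace ℂ Q] [CompleteSpace Q]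

/-- A bounded operator `S` on `Q` with `c ‖x‖² ≤ Re ⟪x, S x⟫`. -/
def IsCoerciveOp (c : ℝ) (S : Q →L[ℂ] Q) : Prop :=
  0 < c ∧ ∀ x, c * ‖x‖ ^ 2 ≤ (⟪x, S x⟫_ℂ).re

/-- Lax–Milgram. The inverse is nonnegative because `⟪x, S⁻¹ x⟫` becomes `⟪S y, y⟫` with `y = S⁻¹
x`. -/
lemma IsCoerciveOp.exists_inverse {c : ℝ} {S : Q →L[ℂ] Q} (h : IsCoerciveOp c S)
    (hs : IsSelfAdjoint S) :
    ∃ S' : Q →L[ℂ] Q, (∀ x, S (S' x) = x) ∧ (∀ x, S' (S x) = x) ∧ IsSelfAdjoint S' ∧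
      0 ≤ S' := by
  have hu : IsUnit S := by
    refine ContinuousLinearMap.isUnit_of_forall_le_norm_inner_map S (c := ⟨c, h.1.le⟩) h.1
      fun x => ?_
    have h1 := h.2 x
    have h2 : (⟪x, S x⟫_ℂ).re ≤ ‖⟪S x, x⟫_ℂ‖ := by
      rw [norm_inner_symm]; exact Complex.re_le_norm _
    change ‖x‖ ^ 2 * c ≤ _
    linarith
  obtain ⟨U, rfl⟩ := hu
  have e1 : ∀ x, (U : Q →L[ℂ] Q) ((↑U⁻¹ : Q →L[ℂ] Q) x) = x := fun x => by
    change ((U : Q →L[ℂ] Q) * (↑U⁻¹ : Q →L[ℂ] Q)) x = x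
    simp
  have e2 : ∀ x, (↑U⁻¹ : Q →L[ℂ] Q) ((U : Q →L[ℂ] Q) x) = x := fun x => by
    change ((↑U⁻¹ : Q →L[ℂ] Q) * (U : Q →L[ℂ] Q)) x = x
    simp
  have hsym : ∀ x y, ⟪(U : Q →L[ℂ] Q) x, y⟫_ℂ = ⟪x, (U : Q →L[ℂ] Q) y⟫_ℂ :=
    fun x y => hs.isSymmetric x y
  have hsa : IsSelfAdjoint (↑U⁻¹ : Q →L[ℂ] Q) := by
    rw [ContinuousLinearMap.isSelfAdjoint_iff_isSymmetric]
    intro x y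
    have := hsym ((↑U⁻¹ : Q →L[ℂ] Q) x) ((↑U⁻¹ : Q →L[ℂ] Q) y)
    rw [e1, e1] at this
    exact this.symm
  refine ⟨↑U⁻¹, e1, e2, hsa, ?_⟩
  rw [ContinuousLinearMap.nonneg_iff_isPositive, ContinuousLinearMap.isPositive_def']
  refine ⟨hsa, fun x => ?_⟩
  have h1 := h.2 ((↑U⁻¹ : Q →L[ℂ] Q) x)
  rw [e1] at h1
  have h2 : 0 ≤ c * ‖(↑U⁻¹ : Q →L[ℂ] Q) x‖ ^ 2 := by have := h.1; positivity
  exact h2.trans h1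

variable (ι : Q →L[ℂ] H)

/-- The operator in `H` of the form `(x, y) ↦ ⟪y, S x⟫` with domain `Q ⊆ H`. -/
def formOp (S : Q →L[ℂ] Q) : H →ₗ.[ℂ] H :=
  Submodule.toLinearPMap
    ((LinearMap.eqLocus (S.toLinearMap ∘ₗ LinearMap.fst ℂ Q H)
      ((ι.adjoint).toLinearMap ∘ₗ LinearMap.snd ℂ Q H)).map
      (LinearMap.prodMap ι.toLinearMap LinearMap.id))

variable {ι}

/-- Density of the range of `ι` is what makes `formOp` single-valued: `ι* f = 0` must force `f = 0`.
-/
lemma injective_adjoint (hd : DenseRange ι) : Function.Injective ι.adjoint := by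
  have h : ι.rangeᗮ = ⊥ := by
    rw [← Submodule.topologicalClosure_eq_top_iff, ← Submodule.dense_iff_topologicalClosure_eq_top]
    exact hd
  rw [ContinuousLinearMap.orthogonal_range] at h
  exact LinearMap.ker_eq_bot.1 h

lemma denseRange_adjoint (hi : Function.Injective ι) : DenseRange ι.adjoint := by
  have h : ι.adjoint.rangeᗮ = ⊥ := by
    rw [ContinuousLinearMap.orthogonal_range, ContinuousLinearMap.adjoint_adjoint]
    exact LinearMap.ker_eq_bot.2 hi
  have h2 := Submodule.topologicalClosure_eq_top_iff.2 h
  exact Submodule.dense_iff_topologicalClosure_eq_top.2 h2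

lemma mem_graph_formOp (hi : Function.Injective ι) (hd : DenseRange ι) (S : Q →L[ℂ] Q)
    (u f : H) : (u, f) ∈ (formOp ι S).graph ↔ ∃ x, ι x = u ∧ S x = ι.adjoint f := by
  rw [formOp, Submodule.toLinearPMap_graph_eq]
  · simp only [Submodule.mem_map, LinearMap.mem_eqLocus, Prod.exists]
    constructor
    · rintro ⟨x, f', h, e⟩
      simp only [LinearMap.prodMap_apply, Prod.mk.injEq] at e
      obtain ⟨rfl, rfl⟩ := e
      exact ⟨x, rfl, h⟩
    · rintro ⟨x, rfl, h⟩
      exact ⟨x, f, h, rfl⟩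
  · rintro ⟨a, b⟩ h (rfl : a = 0)
    simp only [Submodule.mem_map, LinearMap.mem_eqLocus, Prod.exists] at h
    obtain ⟨x, f', h, e⟩ := h
    simp only [LinearMap.prodMap_apply, Prod.mk.injEq] at e
    obtain ⟨e1, rfl⟩ := e
    have hx : x = 0 := hi (by simpa using e1)
    subst hx
    exact injective_adjoint hd (by simpa using h.symm)

/-- The equation `S x = ι* f` tested against `Q`; this is the weak formulation used to compare with
other operators. -/
lemma mem_graph_formOp_iff_inner (hi : Function.Injective ι) (hd : DenseRange ι) (S : Q →L[ℂ] Q)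
    (x : Q) (f : H) : (ι x, f) ∈ (formOp ι S).graph ↔ ∀ y, ⟪y, S x⟫_ℂ = ⟪ι y, f⟫_ℂ := by
  rw [mem_graph_formOp hi hd]
  constructor
  · rintro ⟨x', hx, h⟩ y
    rw [← hi hx, h, ContinuousLinearMap.adjoint_inner_right]
  · intro h
    refine ⟨x, rfl, ext_inner_left ℂ fun y => ?_⟩
    rw [h, ContinuousLinearMap.adjoint_inner_right]

lemma shiftOp_formOp (hi : Function.Injective ι) (hd : DenseRange ι) (S : Q →L[ℂ] Q) (c : ℂ) :
    shiftOp (formOp ι S) c = formOp ι (S + c • (ι.adjoint ∘L ι)) := by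
  refine LinearPMap.eq_of_eq_graph ?_
  ext ⟨u, f⟩
  rw [mem_graph_shiftOp, mem_graph_formOp hi hd, mem_graph_formOp hi hd]
  refine exists_congr fun x => and_congr_right fun hx => ?_
  subst hx
  simp [eq_sub_iff_add_eq]

/-- Solving `S x = ι* f` gives `x = S⁻¹ ι* f`, hence `u = ι S⁻¹ ι* f`. This replaces the unbounded
operator by a bounded resolvent. -/
lemma formOp_eq_inverseOp (hi : Function.Injective ι) (hd : DenseRange ι) {S S' : Q →L[ℂ] Q}
    (h1 : ∀ x, S (S' x) = x) (h2 : ∀ x, S' (S x) = x) :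
    Function.Injective (ι ∘L S' ∘L ι.adjoint) ∧
      formOp ι S = inverseOp (ι ∘L S' ∘L ι.adjoint) := by
  have hinj : Function.Injective (ι ∘L S' ∘L ι.adjoint) := by
    have : Function.Injective S' := Function.LeftInverse.injective h1
    exact hi.comp (this.comp (injective_adjoint hd))
  refine ⟨hinj, LinearPMap.eq_of_eq_graph ?_⟩
  ext ⟨u, f⟩
  rw [mem_graph_formOp hi hd, mem_graph_inverseOp hinj]
  constructor
  · rintro ⟨x, rfl, h⟩
    simp [← h, h2]
  · rintro rfl
    exact ⟨S' (ι.adjoint f), rfl, h1 _⟩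

lemma nonneg_conj_adjoint {S' : Q →L[ℂ] Q} (h : 0 ≤ S') : 0 ≤ ι ∘L S' ∘L ι.adjoint := by
  rw [ContinuousLinearMap.nonneg_iff_isPositive] at h ⊢
  exact h.conj_adjoint ι

lemma isSelfAdjoint_formOp_of_coercive (hi : Function.Injective ι) (hd : DenseRange ι)
    {S : Q →L[ℂ] Q} {c : ℝ} (hc : IsCoerciveOp c S) (hS : IsSelfAdjoint S) :
    IsSelfAdjoint (formOp ι S) := by
  obtain ⟨S', h1, h2, h3, h4⟩ := hc.exists_inverse hS
  obtain ⟨hinj, e⟩ := formOp_eq_inverseOp hi hd h1 h2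
  rw [e]
  refine isSelfAdjoint_inverseOp hinj ?_
  exact ((ContinuousLinearMap.nonneg_iff_isPositive _).1 (nonneg_conj_adjoint h4)).isSelfAdjoint

lemma exists_isPosSqrt_formOp (hi : Function.Injective ι) (hd : DenseRange ι)
    {S : Q →L[ℂ] Q} {c : ℝ} (hc : IsCoerciveOp c S) (hS : IsSelfAdjoint S) :
    ∃ B, IsPosSqrt B (formOp ι S) := by
  obtain ⟨S', h1, h2, h3, h4⟩ := hc.exists_inverse hS
  obtain ⟨hinj, e⟩ := formOp_eq_inverseOp hi hd h1 h2
  rw [e]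
  exact exists_isPosSqrt_inverseOp hinj (nonneg_conj_adjoint h4)

lemma isPosSqrt_opSqrt {T : H →ₗ.[ℂ] H} (h : ∃ B, IsPosSqrt B T) : IsPosSqrt (opSqrt T) T := by
  rw [opSqrt, dif_pos h]
  exact h.choose_spec

/-- The shift is real, so the extra terms `N⟪a, u⟫` on the two sides of the adjoint relation cancel.
-/
lemma isSelfAdjoint_of_shiftOp {T : H →ₗ.[ℂ] H} {N : ℝ} (h : IsSelfAdjoint (shiftOp T N)) :
    IsSelfAdjoint T := by
  have hd : Dense (T.domain : Set H) := h.dense_domain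
  refine isSelfAdjoint_of_mem_graph_iff hd fun u f => ?_
  have key : (u, f) ∈ T.graph ↔ (u, f + (N : ℂ) • u) ∈ (shiftOp T N).graph := by
    rw [mem_graph_shiftOp]; simp
  rw [key, ← LinearPMap.isSelfAdjoint_def.mp h, mem_graph_adjoint h.dense_domain]
  constructor
  · intro H1 a b hab
    have := H1 a (b + (N : ℂ) • a) (by rw [mem_graph_shiftOp]; simpa using hab)
    simpa [inner_add_left, inner_add_right, inner_smul_left, inner_smul_right] using this
  · intro H1 a b hab
    rw [mem_graph_shiftOp] at hab
    have := H1 a _ hab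
    simp only [inner_sub_left, inner_smul_left, Complex.conj_ofReal] at this
    simp only [inner_add_right, inner_smul_right, ← this]
    ring

/-- The second representation theorem, for an arbitrary square root `B`, so that uniqueness of
square roots is never needed. On the vectors `J f = S⁻¹ ι* f`, dense in `Q`, the identity follows
from `B² = formOp ι S`. It shows that `J f ↦ B ι (J f)` is Lipschitz for the norm of `Q`, and
closedness of `B` extends it to all of `Q`. The converse inclusion of domains is a duality argument.
-/
lemma IsPosSqrt.domain_and_inner (hi : Function.Injective ι) (hd : DenseRange ι)
    {S : Q →L[ℂ] Q} {c : ℝ} (hc : IsCoerciveOp c S) (hS : IsSelfAdjoint S)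
    {B : H →ₗ.[ℂ] H} (hB : IsPosSqrt B (formOp ι S)) :
    (∀ u, u ∈ B.domain ↔ ∃ x, ι x = u) ∧
    ∀ x y u v, (ι x, u) ∈ B.graph → (ι y, v) ∈ B.graph → ⟪v, u⟫_ℂ = ⟪y, S x⟫_ℂ := by
  obtain ⟨S', h1, h2, h3, h4⟩ := hc.exists_inverse hS
  obtain ⟨hBs, hB0, hBB⟩ := hB
  have hcl : IsClosed (B.graph : Set (H × H)) := hBs.isClosed
  have hSs : ∀ x y, ⟪S x, y⟫_ℂ = ⟪x, S y⟫_ℂ := fun x y => hS.isSymmetric x y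
  -- the dense subspace of `Q` mapped to the operator domain
  let J : H → Q := fun f => S' (ι.adjoint f)
  have hJ : ∀ f, ∃ w, (ι (J f), w) ∈ B.graph ∧ (w, f) ∈ B.graph := fun f =>
    (hBB _ _).1 ((mem_graph_formOp hi hd S _ _).2 ⟨J f, rfl, h1 _⟩)
  have hS'd : DenseRange S' := Function.Surjective.denseRange fun x => ⟨S x, h2 x⟩
  have hJd : DenseRange J := hS'd.comp (denseRange_adjoint hi) S'.continuous
  -- Here `w f = B ι (J f)` and `B (w f) = f`.
  choose w hw1 hw2 using hJ
  have hww : ∀ f f', ⟪w f', w f⟫_ℂ = ⟪J f', S (J f)⟫_ℂ := fun f f' => by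
    rw [inner_graph_of_isSelfAdjoint hBs (hw2 f) (hw1 f'), h1,
      ContinuousLinearMap.adjoint_inner_right]
  have hdist : ∀ f f', ‖w f - w f'‖ ≤ (‖S‖ + 1) * ‖J f - J f'‖ := fun f f' => by
    have e : ⟪w f - w f', w f - w f'⟫_ℂ = ⟪J f - J f', S (J f - J f')⟫_ℂ := by
      simp only [inner_sub_left, inner_sub_right, hww, map_sub]
    have e2 : ‖w f - w f'‖ ^ 2 ≤ ‖J f - J f'‖ * (‖S‖ * ‖J f - J f'‖) := by
      have h : ‖⟪w f - w f', w f - w f'⟫_ℂ‖ = ‖w f - w f'‖ ^ 2 := by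
        rw [inner_self_eq_norm_sq_to_K]; simp
      rw [← h, e]
      exact (norm_inner_le_norm _ _).trans (by gcongr; exact S.le_opNorm _)
    -- The constant `‖S‖ + 1` avoids a square root: `‖S‖ ≤ (‖S‖ + 1)²`.
    refine abs_le_of_sq_le_sq' (a := ‖w f - w f'‖) ?_ (by positivity) |>.2
    nlinarith [norm_nonneg S, sq_nonneg ‖J f - J f'‖,
      mul_nonneg (norm_nonneg S) (sq_nonneg ‖J f - J f'‖),
      mul_nonneg (sq_nonneg ‖S‖) (sq_nonneg ‖J f - J f'‖)]
  -- Approximating `x` by vectors `J (f k)` makes `w (f k)` Cauchy, and the closed graph of `B`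
  -- contains the limit.
  have hlim : ∀ x, ∃ v, (ι x, v) ∈ B.graph ∧ ∃ f : ℕ → H,
      Tendsto (fun k => J (f k)) atTop (𝓝 x) ∧ Tendsto (fun k => w (f k)) atTop (𝓝 v) := by
    intro x
    obtain ⟨z, hz, hzx⟩ := mem_closure_iff_seq_limit.1 (hJd x)
    choose f hf using hz
    have hJf : Tendsto (fun k => J (f k)) atTop (𝓝 x) := by simpa [hf] using hzx
    have hc : CauchySeq fun k => w (f k) := by
      have h := hJf.cauchySeq
      rw [Metric.cauchySeq_iff] at h ⊢
      intro ε hε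
      obtain ⟨N, hN⟩ := h (ε / (‖S‖ + 1)) (by positivity)
      refine ⟨N, fun m hm k hk => ?_⟩
      have := hN m hm k hk
      rw [dist_eq_norm] at this ⊢
      refine (hdist _ _).trans_lt ?_
      rwa [lt_div_iff₀' (by positivity)] at this
    obtain ⟨v, hv⟩ := cauchySeq_tendsto_of_complete hc
    refine ⟨v, ?_, f, hJf, hv⟩
    exact hcl.mem_of_tendsto (((ι.continuous.tendsto x).comp hJf).prodMk_nhds hv)
      (Eventually.of_forall fun k => hw1 (f k))
  choose v hv f hf hfv using hlim
  have hvv : ∀ x y, ⟪v y, v x⟫_ℂ = ⟪y, S x⟫_ℂ := fun x y => by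
    have t1 : Tendsto (fun k => ⟪w (f y k), w (f x k)⟫_ℂ) atTop (𝓝 ⟪v y, v x⟫_ℂ) :=
      (hfv y).inner (hfv x)
    have t2 : Tendsto (fun k => ⟪J (f y k), S (J (f x k))⟫_ℂ) atTop (𝓝 ⟪y, S x⟫_ℂ) :=
      (hf y).inner ((S.continuous.tendsto x).comp (hf x))
    simp only [hww] at t1
    exact tendsto_nhds_unique t1 t2
  have huniq : ∀ {a b b' : H}, (a, b) ∈ B.graph → (a, b') ∈ B.graph → b = b' :=
    fun h h' => B.mem_graph_snd_inj h h' rfl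
  have hwv : ∀ g, w g = v (J g) := fun g => huniq (hw1 g) (hv _)
  let Vl : Q →ₗ[ℂ] H :=
    { toFun := v
      map_add' := fun x y => huniq (hv _) (by
        simpa using B.graph.add_mem (hv x) (hv y))
      map_smul' := fun a x => huniq (hv _) (by
        simpa using B.graph.smul_mem a (hv x)) }
  have hVb : ∀ x, ‖Vl x‖ ≤ (‖S‖ + 1) * ‖x‖ := fun x => by
    have e2 : ‖v x‖ ^ 2 ≤ ‖x‖ * (‖S‖ * ‖x‖) := by
      have h : ‖⟪v x, v x⟫_ℂ‖ = ‖v x‖ ^ 2 := by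
        rw [inner_self_eq_norm_sq_to_K]; simp
      rw [← h, hvv]
      exact (norm_inner_le_norm _ _).trans (by gcongr; exact S.le_opNorm _)
    refine abs_le_of_sq_le_sq' (a := ‖v x‖) ?_ (by positivity) |>.2
    nlinarith [norm_nonneg S, sq_nonneg ‖x‖,
      mul_nonneg (norm_nonneg S) (sq_nonneg ‖x‖),
      mul_nonneg (sq_nonneg ‖S‖) (sq_nonneg ‖x‖)]
  let V : Q →L[ℂ] H := Vl.mkContinuous _ hVb
  have hV : ∀ x, V x = v x := fun x => rfl
  refine ⟨fun u => ⟨fun hu => ?_, ?_⟩, fun x y a b ha hb => ?_⟩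
  · obtain ⟨b, hb⟩ := (mem_domain_iff_exists_graph B u).1 hu
    -- With `V x = B ι x` and `b = B u`, any `g = B (w g)` gives `⟪g, u⟫ = ⟪w g, b⟫ = ⟪V S⁻¹ ι* g,
    -- b⟫`. Moving the operators to the right shows `u = ι S⁻¹ V* b`.
    refine ⟨S' (V.adjoint b), ext_inner_left ℂ fun g => ?_⟩
    have e : ⟪g, u⟫_ℂ = ⟪w g, b⟫_ℂ := inner_graph_of_isSelfAdjoint hBs hb (hw2 g)
    rw [e, hwv, ← hV, ← ContinuousLinearMap.adjoint_inner_right V,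
      ← ContinuousLinearMap.adjoint_inner_left ι]
    exact (h3.isSymmetric _ _).symm
  · rintro ⟨x, rfl⟩
    exact (mem_domain_iff_exists_graph B _).2 ⟨_, hv x⟩
  · rw [huniq ha (hv x), huniq hb (hv y), hvv]

end FormOperators

/-! ### The form space of a nonnegative symmetric operator and its Friedrichs extension -/

section Friedrichs

variable {H : Type*} [NormedAddCommGroup H] [InnerProductSpace ℂ H] [CompleteSpace H]

/-- Symmetric nonnegative operators. -/
structure IsNonnegSymm (T : H →ₗ.[ℂ] H) : Prop where
  symm : ∀ u v : T.domain, ⟪T u, (v : H)⟫_ℂ = ⟪(u : H), T v⟫_ℂ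
  nonneg : ∀ u : T.domain, 0 ≤ (⟪(u : H), T u⟫_ℂ).re

/-- The domain of `T`, as an inner product space with respect to the form of `T + 1`. -/
def PreFormSpace (T : H →ₗ.[ℂ] H) (_ : IsNonnegSymm T) : Type _ := T.domain

variable {T : H →ₗ.[ℂ] H} {hT : IsNonnegSymm T}

instance : AddCommGroup (PreFormSpace T hT) := inferInstanceAs (AddCommGroup T.domain)
instance : Module ℂ (PreFormSpace T hT) := inferInstanceAs (Module ℂ T.domain)

/-- The form of `T + 1` on the domain of `T`. -/
def shiftedForm (T : H →ₗ.[ℂ] H) (u v : T.domain) : ℂ := ⟪(u : H), T v⟫_ℂ + ⟪(u : H), (v : H)⟫_ℂ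

lemma re_shiftedForm_self (T : H →ₗ.[ℂ] H) (u : T.domain) :
    (shiftedForm T u u).re = (⟪(u : H), T u⟫_ℂ).re + ‖(u : H)‖ ^ 2 := by
  rw [shiftedForm, norm_sq_eq_re_inner (𝕜 := ℂ) (u : H)]
  simp

/-- The form of `T + 1` is an inner product on the domain of `T`. -/
@[reducible]
def preFormCore (T : H →ₗ.[ℂ] H) (hT : IsNonnegSymm T) :
    InnerProductSpace.Core ℂ (PreFormSpace T hT) where
  inner := shiftedForm T
  conj_inner_symm (u v : T.domain) := by
    change conj (shiftedForm T v u) = shiftedForm T u v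
    simp only [shiftedForm, map_add, inner_conj_symm, hT.symm]
  re_inner_nonneg (u : T.domain) := by
    change 0 ≤ (shiftedForm T u u).re
    rw [re_shiftedForm_self]
    have h1 := hT.nonneg u
    positivity
  add_left (u v w : T.domain) := by
    change shiftedForm T (u + v) w = shiftedForm T u w + shiftedForm T v w
    simp only [shiftedForm, Submodule.coe_add, inner_add_left]; ring
  smul_left (u v : T.domain) c := by
    change shiftedForm T (c • u) v = conj c * shiftedForm T u v
    simp only [shiftedForm, Submodule.coe_smul, inner_smul_left]; ring
  definite (u : T.domain) h := by
    have h1 := hT.nonneg u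
    have h2 : (shiftedForm T u u).re = 0 := by
      have h3 : shiftedForm T u u = 0 := h
      rw [h3, Complex.zero_re]
    rw [re_shiftedForm_self] at h2
    have h4 : ‖(u : H)‖ ^ 2 = 0 := le_antisymm (by linarith) (sq_nonneg _)
    have h5 : (u : H) = 0 := by simpa using h4
    exact (Subtype.ext h5 : u = 0)

instance : NormedAddCommGroup (PreFormSpace T hT) := (preFormCore T hT).toNormedAddCommGroup
instance : InnerProductSpace ℂ (PreFormSpace T hT) :=
  InnerProductSpace.ofCore (preFormCore T hT).toCore

/-- The form domain of `T`: the completion of the domain of `T` in the form norm. -/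
def FormSpace (T : H →ₗ.[ℂ] H) (hT : IsNonnegSymm T) : Type _ :=
  UniformSpace.Completion (PreFormSpace T hT)

instance : NormedAddCommGroup (FormSpace T hT) :=
  inferInstanceAs (NormedAddCommGroup (UniformSpace.Completion (PreFormSpace T hT)))
instance : InnerProductSpace ℂ (FormSpace T hT) :=
  inferInstanceAs (InnerProductSpace ℂ (UniformSpace.Completion (PreFormSpace T hT)))
instance : CompleteSpace (FormSpace T hT) :=
  inferInstanceAs (CompleteSpace (UniformSpace.Completion (PreFormSpace T hT)))

/-- The inclusion of the domain of `T` in the form domain. -/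
def toFormSpace (T : H →ₗ.[ℂ] H) (hT : IsNonnegSymm T) : T.domain →ₗ[ℂ] FormSpace T hT :=
  (UniformSpace.Completion.toComplL (𝕜 := ℂ) (E := PreFormSpace T hT)).toLinearMap

lemma denseRange_toFormSpace : DenseRange (toFormSpace T hT) :=
  UniformSpace.Completion.denseRange_coe (α := PreFormSpace T hT)

lemma inner_toFormSpace (u v : T.domain) :
    ⟪toFormSpace T hT u, toFormSpace T hT v⟫_ℂ = ⟪(u : H), T v⟫_ℂ + ⟪(u : H), (v : H)⟫_ℂ :=
  UniformSpace.Completion.inner_coe (E := PreFormSpace T hT) u v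

lemma norm_sq_toFormSpace (u : T.domain) :
    ‖toFormSpace T hT u‖ ^ 2 = (⟪(u : H), T u⟫_ℂ).re + ‖(u : H)‖ ^ 2 := by
  rw [norm_sq_eq_re_inner (𝕜 := ℂ), inner_toFormSpace, norm_sq_eq_re_inner (𝕜 := ℂ) (u : H)]
  simp

lemma norm_le_norm_toFormSpace (u : T.domain) : ‖(u : H)‖ ≤ 1 * ‖toFormSpace T hT u‖ := by
  rw [one_mul]
  refine abs_le_of_sq_le_sq' ?_ (norm_nonneg _) |>.2
  rw [norm_sq_toFormSpace]
  linarith [hT.nonneg u]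

/-- The continuous inclusion of the form domain in `H`. -/
def formIncl (T : H →ₗ.[ℂ] H) (hT : IsNonnegSymm T) : FormSpace T hT →L[ℂ] H :=
  T.domain.subtype.extendOfNorm (toFormSpace T hT)

@[simp]
lemma formIncl_toFormSpace (u : T.domain) : formIncl T hT (toFormSpace T hT u) = u :=
  LinearMap.extendOfNorm_eq denseRange_toFormSpace ⟨1, norm_le_norm_toFormSpace⟩ u

/-- When one argument lies in `Dom T`, the form inner product is continuous in the other for the
norm of `H` alone, so the identity passes to the completion. -/
lemma inner_toFormSpace_right (x : FormSpace T hT) (v : T.domain) :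
    ⟪x, toFormSpace T hT v⟫_ℂ = ⟪formIncl T hT x, T v + v⟫_ℂ := by
  refine denseRange_toFormSpace.induction_on
    (p := fun x => ⟪x, toFormSpace T hT v⟫_ℂ = ⟪formIncl T hT x, T v + v⟫_ℂ) x ?_ fun u => ?_
  · exact isClosed_eq (by fun_prop) (by fun_prop)
  · rw [inner_toFormSpace, formIncl_toFormSpace, inner_add_right]

/-- This is closability of the form: if `ι x = 0`, then `⟪x, v⟫ = ⟪ι x, (T + 1) v⟫ = 0` for all `v`
in the dense subspace `Dom T`. -/
lemma injective_formIncl : Function.Injective (formIncl T hT) := by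
  refine (injective_iff_map_eq_zero _).2 fun x hx => ?_
  refine denseRange_toFormSpace.eq_zero_of_inner_left ℂ ?_
  intro v
  rw [inner_toFormSpace_right, hx, inner_zero_left]

lemma denseRange_formIncl (hd : Dense (T.domain : Set H)) : DenseRange (formIncl T hT) := by
  refine Dense.mono ?_ hd
  intro u hu
  exact ⟨toFormSpace T hT ⟨u, hu⟩, formIncl_toFormSpace _⟩

/-- The squared norm of the completion is `⟨T u, u⟩ + ‖u‖²`, so convergence in `H` together with
being Cauchy for `T` is being Cauchy in the completion. In particular the limits already form a
subspace. -/
lemma formClosureDomain_eq_range : formClosureDomain T = (formIncl T hT).range := by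
  refine le_antisymm (Submodule.span_le.2 ?_) ?_
  · rintro u ⟨s, hs, hs'⟩
    have hc : CauchySeq fun m => toFormSpace T hT (s m) := by
      rw [cauchySeq_iff_tendsto_dist_atTop_0]
      have h1 : Tendsto (fun p : ℕ × ℕ => ‖(s p.1 : H) - s p.2‖ ^ 2) atTop (𝓝 0) := by
        have := (cauchySeq_iff_tendsto_dist_atTop_0.1 hs.cauchySeq).pow 2
        simpa [dist_eq_norm] using this
      have h2 := ((Complex.continuous_re.tendsto _).comp hs').add h1
      have h3 : Tendsto (fun p : ℕ × ℕ => ‖toFormSpace T hT (s p.1 - s p.2)‖ ^ 2) atTop (𝓝 0) := by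
        simpa only [norm_sq_toFormSpace, Function.comp_def, Complex.zero_re, add_zero,
          Submodule.coe_sub] using h2
      have h4 := (Real.continuous_sqrt.tendsto _).comp h3
      simpa [Function.comp_def, dist_eq_norm, Real.sqrt_sq, map_sub] using h4
    obtain ⟨x, hx⟩ := cauchySeq_tendsto_of_complete hc
    refine ⟨x, tendsto_nhds_unique ?_ hs⟩
    simpa [Function.comp_def] using ((formIncl T hT).continuous.tendsto x).comp hx
  · rintro _ ⟨x, rfl⟩
    obtain ⟨z, hz, hzx⟩ := mem_closure_iff_seq_limit.1 (denseRange_toFormSpace (hT := hT) x)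
    choose s hs using hz
    have hsx : Tendsto (fun k => toFormSpace T hT (s k)) atTop (𝓝 x) := by simpa [hs] using hzx
    refine Submodule.subset_span ⟨s, ?_, ?_⟩
    · simpa [Function.comp_def] using ((formIncl T hT).continuous.tendsto x).comp hsx
    · have h0 : Tendsto (fun p : ℕ × ℕ => toFormSpace T hT (s p.1 - s p.2)) atTop (𝓝 0) := by
        have h1 : Tendsto (fun p : ℕ × ℕ => toFormSpace T hT (s p.1)) atTop (𝓝 x) :=
          hsx.comp (prod_atTop_atTop_eq (α := ℕ) (β := ℕ) ▸ tendsto_fst)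
        have h2 : Tendsto (fun p : ℕ × ℕ => toFormSpace T hT (s p.2)) atTop (𝓝 x) :=
          hsx.comp (prod_atTop_atTop_eq (α := ℕ) (β := ℕ) ▸ tendsto_snd)
        simpa [map_sub] using h1.sub h2
      have h3 : Tendsto (fun p : ℕ × ℕ => ‖toFormSpace T hT (s p.1 - s p.2)‖ ^ 2) atTop (𝓝 0) := by
        simpa using (h0.norm).pow 2
      refine squeeze_zero_norm (fun p => ?_) h3
      -- By symmetry the form values are real; being nonnegative as well, they are dominated by the
      -- squared form norm.
      have hre : ⟪((s p.1 - s p.2 : T.domain) : H), T (s p.1 - s p.2)⟫_ℂ =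
          ((⟪((s p.1 - s p.2 : T.domain) : H), T (s p.1 - s p.2)⟫_ℂ).re : ℂ) := by
        refine (Complex.conj_eq_iff_re.1 ?_).symm
        rw [inner_conj_symm, hT.symm]
      rw [hre, Complex.norm_real, Real.norm_of_nonneg (hT.nonneg _), norm_sq_toFormSpace]
      nlinarith [sq_nonneg ‖((s p.1 - s p.2 : T.domain) : H)‖]

/-- For `u = ι x`, membership of `(u, f - u)` in the graph of `T†` says `⟪v, x⟫ = ⟪v, f⟫` (form
product on the left) for `v ∈ Dom T`. By density this extends to the whole form space, where it is
the defining relation of the operator of the inner product. -/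
lemma shiftOp_friedrichs (hd : Dense (T.domain : Set H)) (hT : IsNonnegSymm T) :
    shiftOp (friedrichs T) 1 = formOp (formIncl T hT) 1 := by
  refine LinearPMap.eq_of_eq_graph ?_
  ext ⟨u, f⟩
  have hres : ∀ g, (u, g) ∈ (friedrichs T).graph ↔
      u ∈ formClosureDomain T ∧ (u, g) ∈ T†.graph := by
    intro g
    simp only [friedrichs, LinearPMap.mem_graph_iff]
    constructor
    · rintro ⟨y, hy, h⟩
      have hy' : (y : H) = u := hy
      have h1 : (y : H) ∈ formClosureDomain T := y.2.1
      exact ⟨hy' ▸ h1, ⟨y, y.2.2⟩, hy, h⟩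
    · rintro ⟨hu, y, hy, h⟩
      have hy' : (y : H) = u := hy
      exact ⟨⟨y, hy' ▸ hu, y.2⟩, hy, h⟩
  rw [mem_graph_shiftOp, hres, formClosureDomain_eq_range (hT := hT), mem_graph_adjoint hd]
  have hi := injective_formIncl (hT := hT)
  have hdι := denseRange_formIncl (hT := hT) hd
  have key : ∀ x : FormSpace T hT, (∀ a b, (a, b) ∈ T.graph →
      ⟪b, formIncl T hT x⟫_ℂ = ⟪a, f - (1 : ℂ) • formIncl T hT x⟫_ℂ) ↔
      (formIncl T hT x, f) ∈ (formOp (formIncl T hT) 1).graph := by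
    intro x
    rw [mem_graph_formOp_iff_inner hi hdι]
    have e1 : ∀ v : T.domain, (⟪T v, formIncl T hT x⟫_ℂ =
        ⟪(v : H), f - (1 : ℂ) • formIncl T hT x⟫_ℂ ↔
        ⟪toFormSpace T hT v, x⟫_ℂ = ⟪(v : H), f⟫_ℂ) := by
      intro v
      rw [← inner_conj_symm (toFormSpace T hT v), inner_toFormSpace_right, inner_conj_symm,
        inner_add_left, one_smul, inner_sub_right, eq_sub_iff_add_eq]
    constructor
    · intro h y
      simp only [one_apply_eq_self]
      refine denseRange_toFormSpace.induction_on
        (p := fun y => ⟪y, x⟫_ℂ = ⟪formIncl T hT y, f⟫_ℂ) y ?_ fun v => ?_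
      · exact isClosed_eq (by fun_prop) (by fun_prop)
      · rw [formIncl_toFormSpace]
        exact (e1 v).1 (h _ _ (T.mem_graph v))
    · intro h a b hab
      obtain ⟨v, rfl, rfl⟩ := (T.mem_graph_iff).1 hab
      refine (e1 v).2 ?_
      have := h (toFormSpace T hT v)
      simpa using this
  constructor
  · rintro ⟨⟨x, rfl⟩, h⟩
    exact (key x).1 h
  · intro h
    obtain ⟨x, rfl, -⟩ := (mem_graph_formOp hi hdι 1 u f).1 h
    exact ⟨⟨x, rfl⟩, (key x).2 h⟩

end Friedrichs

/-! ### Properties of a semibounded form and of its operator, read off from a model on the form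
space -/

section FormProperties

variable {H : Type*} [NormedAddCommGroup H] [InnerProductSpace ℂ H] [CompleteSpace H]
  {Q : Type*} [NormedAddCommGroup Q] [InnerProductSpace ℂ Q] [CompleteSpace Q]
  {ι : Q →L[ℂ] H} {D : Submodule ℂ H} {q : D → D → ℂ} {S : Q →L[ℂ] Q}

/-- The form `q` with domain `D` is the form `(x, y) ↦ ⟪y, S x⟫`, where `Q` is identified with `D`
through `ι`. -/
structure IsModelOf (ι : Q →L[ℂ] H) (S : Q →L[ℂ] Q) (q : D → D → ℂ) : Prop where
  injective : Function.Injective ι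
  dense : DenseRange ι
  mem_iff : ∀ u, u ∈ D ↔ ∃ x, ι x = u
  selfAdjoint : IsSelfAdjoint S
  form_eq : ∀ (u v : D) (x y : Q), ι x = u → ι y = v → q u v = ⟪y, S x⟫_ℂ

lemma IsModelOf.form_symm (h : IsModelOf ι S q) (u v : D) : q v u = conj (q u v) := by
  obtain ⟨x, hx⟩ := (h.mem_iff u).1 u.2
  obtain ⟨y, hy⟩ := (h.mem_iff v).1 v.2
  rw [h.form_eq v u y x hy hx, h.form_eq u v x y hx hy, inner_conj_symm]
  exact (h.selfAdjoint.isSymmetric x y).symm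

lemma tendsto_inner_self_zero (S : Q →L[ℂ] Q) {z : ℕ → Q} (hz : Tendsto z atTop (𝓝 0)) :
    Tendsto (fun m => ⟪z m, S (z m)⟫_ℂ) atTop (𝓝 0) := by
  have h := hz.inner (𝕜 := ℂ) ((S.continuous.tendsto 0).comp hz)
  rwa [map_zero, inner_zero_left] at h

lemma coercive_lower_bound {c N : ℝ}
    (hc : IsCoerciveOp c (S + (N : ℂ) • (ι.adjoint ∘L ι))) (x : Q) :
    c * ‖x‖ ^ 2 ≤ (⟪x, S x⟫_ℂ).re + N * ‖ι x‖ ^ 2 := by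
  have := hc.2 x
  simp only [add_apply, smul_apply, inner_add_right, inner_smul_right, Complex.add_re,
    ContinuousLinearMap.comp_apply, ContinuousLinearMap.adjoint_inner_right,
    Complex.re_ofReal_mul] at this
  rwa [norm_sq_eq_re_inner (𝕜 := ℂ) (ι x)]

lemma IsModelOf.formBoundedBelow (h : IsModelOf ι S q) {c N : ℝ}
    (hc : IsCoerciveOp c (S + (N : ℂ) • (ι.adjoint ∘L ι))) : FormBoundedBelow q := by
  refine ⟨-N, fun u => ?_⟩
  obtain ⟨x, hx⟩ := (h.mem_iff u).1 u.2
  rw [h.form_eq u u x x hx hx, ← hx]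
  have h1 := coercive_lower_bound hc x
  have h2 : 0 ≤ c * ‖x‖ ^ 2 := by have := hc.1; positivity
  linarith

/-- Coercivity of the shifted form bounds distances in `Q` by `q` and the norm of `H`, so a
`q`-Cauchy sequence converging in `H` is Cauchy in the complete space `Q`. -/
lemma IsModelOf.formClosed (h : IsModelOf ι S q) {c N : ℝ}
    (hc : IsCoerciveOp c (S + (N : ℂ) • (ι.adjoint ∘L ι))) : FormClosed q := by
  intro s u hs hs'
  have hx : ∀ m, ∃ x, ι x = s m := fun m => (h.mem_iff _).1 (s m).2
  choose x hx using hx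
  have hq : ∀ p : ℕ × ℕ, q (s p.1 - s p.2) (s p.1 - s p.2) =
      ⟪x p.1 - x p.2, S (x p.1 - x p.2)⟫_ℂ := fun p =>
    h.form_eq _ _ _ _ (by simp [hx]) (by simp [hx])
  have hcau : CauchySeq x := by
    rw [cauchySeq_iff_tendsto_dist_atTop_0]
    have h1 : Tendsto (fun p : ℕ × ℕ => ‖(s p.1 : H) - s p.2‖ ^ 2) atTop (𝓝 0) := by
      have := (cauchySeq_iff_tendsto_dist_atTop_0.1 hs.cauchySeq).pow 2
      simpa [dist_eq_norm] using this
    have h2 : Tendsto (fun p : ℕ × ℕ => (q (s p.1 - s p.2) (s p.1 - s p.2)).re +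
        N * ‖(s p.1 : H) - s p.2‖ ^ 2) atTop (𝓝 0) := by
      simpa using ((Complex.continuous_re.tendsto _).comp hs').add (h1.const_mul N)
    have h3 : Tendsto (fun p : ℕ × ℕ => c⁻¹ * ((q (s p.1 - s p.2) (s p.1 - s p.2)).re +
        N * ‖(s p.1 : H) - s p.2‖ ^ 2)) atTop (𝓝 0) := by simpa using h2.const_mul c⁻¹
    have h4 : Tendsto (fun p : ℕ × ℕ => ‖x p.1 - x p.2‖ ^ 2) atTop (𝓝 0) := by
      refine squeeze_zero (fun p => by positivity) (fun p => ?_) h3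
      have := coercive_lower_bound hc (x p.1 - x p.2)
      rw [map_sub ι, hx, hx] at this
      rw [hq, inv_mul_eq_div, le_div_iff₀ hc.1]
      linarith
    have h5 := (Real.continuous_sqrt.tendsto _).comp h4
    simpa [Function.comp_def, dist_eq_norm, Real.sqrt_sq] using h5
  obtain ⟨x', hx'⟩ := cauchySeq_tendsto_of_complete hcau
  have hu : ι x' = u := by
    refine tendsto_nhds_unique ?_ hs
    simpa only [Function.comp_def, hx] using (ι.continuous.tendsto x').comp hx'
  refine ⟨(h.mem_iff u).2 ⟨x', hu⟩, ?_⟩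
  have e : ∀ m, q (s m - ⟨u, (h.mem_iff u).2 ⟨x', hu⟩⟩) (s m - ⟨u, (h.mem_iff u).2 ⟨x', hu⟩⟩) =
      ⟪x m - x', S (x m - x')⟫_ℂ := fun m =>
    h.form_eq _ _ _ _ (by simp [hx, hu]) (by simp [hx, hu])
  simp only [e]
  have h0 : Tendsto (fun m => x m - x') atTop (𝓝 0) := by
    simpa using hx'.sub_const x'
  exact tendsto_inner_self_zero S h0

lemma IsModelOf.isFormCore (h : IsModelOf ι S q) {Sm : Submodule ℂ H} (hle : Sm ≤ D)
    (hd : Dense {x | ι x ∈ Sm}) : IsFormCore q Sm := by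
  refine ⟨hle, fun u => ?_⟩
  obtain ⟨x, hx⟩ := (h.mem_iff u).1 u.2
  obtain ⟨z, hz, hzx⟩ := mem_closure_iff_seq_limit.1 (hd x)
  have h0 : Tendsto (fun m => x - z m) atTop (𝓝 0) := by
    simpa using hzx.const_sub x
  refine ⟨fun m => ⟨ι (z m), hle (hz m)⟩, hz, ?_, ?_⟩
  · have := (((ι.continuous.tendsto 0).comp h0).norm).pow 2
    simpa [Function.comp_def, hx] using this
  · have e : ∀ m, q (u - ⟨ι (z m), hle (hz m)⟩) (u - ⟨ι (z m), hle (hz m)⟩) =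
        ⟪x - z m, S (x - z m)⟫_ℂ := fun m =>
      h.form_eq _ _ _ _ (by simp [hx]) (by simp [hx])
    simp only [e]
    exact tendsto_inner_self_zero S h0

lemma IsModelOf.formRepresents (h : IsModelOf ι S q) : FormRepresents q (formOp ι S) := by
  intro u
  obtain ⟨x, hx, h2⟩ := (mem_graph_formOp h.injective h.dense S _ _).1 ((formOp ι S).mem_graph u)
  refine ⟨(h.mem_iff _).2 ⟨x, hx⟩, fun v => ?_⟩
  obtain ⟨y, hy⟩ := (h.mem_iff v).1 v.2
  rw [h.form_eq _ v x y hx hy, h2, ContinuousLinearMap.adjoint_inner_right, hy]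

/-- An operator represented by `q` satisfies the weak equation, so it is contained in `formOp ι S`;
two self-adjoint operators, one contained in the other, agree. -/
lemma IsModelOf.eq_formOp (h : IsModelOf ι S q) (hs : IsSelfAdjoint (formOp ι S))
    {T : H →ₗ.[ℂ] H} (hT : IsSelfAdjoint T) (hr : FormRepresents q T) : T = formOp ι S := by
  refine eq_of_graph_le_of_isSelfAdjoint hs hT fun u f huf => ?_
  obtain ⟨w, rfl, rfl⟩ := (T.mem_graph_iff).1 huf
  obtain ⟨hu, hv⟩ := hr w
  obtain ⟨x, hx⟩ := (h.mem_iff _).1 hu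
  rw [← hx, mem_graph_formOp_iff_inner h.injective h.dense]
  intro y
  rw [← hv ⟨ι y, (h.mem_iff _).2 ⟨y, rfl⟩⟩]
  exact (h.form_eq _ _ x y hx rfl).symm

lemma opBoundedBelow_formOp (hi : Function.Injective ι) (hd : DenseRange ι) {c N : ℝ}
    (hc : IsCoerciveOp c (S + (N : ℂ) • (ι.adjoint ∘L ι))) : OpBoundedBelow (formOp ι S) := by
  refine ⟨-N, fun u => ?_⟩
  obtain ⟨x, hx, h2⟩ := (mem_graph_formOp hi hd S _ _).1 ((formOp ι S).mem_graph u)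
  have h1 := coercive_lower_bound hc x
  have h3 : 0 ≤ c * ‖x‖ ^ 2 := by have := hc.1; positivity
  have hx' : ι x = u := hx
  rw [← hx', ← ContinuousLinearMap.adjoint_inner_right]
  rw [show ι.adjoint (formOp ι S u) = S x from h2.symm]
  linarith

end FormProperties

/-! ### A compactness criterion, and discreteness of the spectrum from a compact resolvent -/

section Compactness

variable {H : Type*} [NormedAddCommGroup H] [InnerProductSpace ℂ H] [CompleteSpace H]
  {Q : Type*} [NormedAddCommGroup Q] [InnerProductSpace ℂ Q] [CompleteSpace Q]

/-- Finitely many functionals map the unit ball to a bounded set of a finite-dimensional space,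
which has finite nets. Two points close under these functionals have close images under `ι`, so the
image of the ball is totally bounded. -/
lemma isCompactOperator_of_finite_functionals {ι : Q →L[ℂ] H}
    (h : ∀ ε : ℝ, 0 < ε → ∃ (J : Type*) (_ : Fintype J) (m : J → H), ∀ x,
      ‖ι x‖ ^ 2 ≤ ε * ‖x‖ ^ 2 + ∑ j, ‖⟪m j, ι x⟫_ℂ‖ ^ 2) : IsCompactOperator ι := by
  have htb : TotallyBounded (ι '' Metric.closedBall 0 1) := by
    rw [Metric.totallyBounded_iff]
    intro δ hδ
    -- Differences of points of the unit ball have squared norm at most `4`, so this term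
    -- contributes at most `δ² / 4`.
    obtain ⟨J, _, m, hs⟩ := h (δ ^ 2 / 16) (by positivity)
    let L : Q →L[ℂ] (J → ℂ) := ContinuousLinearMap.pi fun j => (innerSL ℂ (m j)) ∘L ι
    have hL : TotallyBounded (L '' Metric.closedBall 0 1) := by
      have hb : Bornology.IsBounded (L '' Metric.closedBall 0 1) :=
        L.lipschitz.isBounded_image Metric.isBounded_closedBall
      exact hb.isCompact_closure.totallyBounded.subset subset_closure
    -- Then `card J * η² ≤ δ² / 4`; the `+ 1` covers an empty family. The total is at most `δ² / 2 <
    -- δ²`.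
    set η : ℝ := δ / (2 * (Fintype.card J + 1)) with hη
    have hη0 : 0 < η := by positivity
    obtain ⟨t, ht, htf, htc⟩ := totallyBounded_iff_subset.1 hL _ (Metric.dist_mem_uniformity hη0)
    have ht' : ∀ y ∈ t, ∃ x, x ∈ Metric.closedBall (0 : Q) 1 ∧ L x = y := ht
    choose! g hg hgt using ht'
    refine ⟨(fun y => ι (g y)) '' t, htf.image _, ?_⟩
    rintro _ ⟨x, hx, rfl⟩
    obtain ⟨y, hy, hxy⟩ := Set.mem_iUnion₂.1 (htc ⟨x, hx, rfl⟩)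
    refine Set.mem_iUnion₂.2 ⟨_, ⟨y, hy, rfl⟩, ?_⟩
    rw [Metric.mem_ball, dist_eq_norm, ← map_sub]
    have hxy' : dist (L x) (L (g y)) < η := by rw [hgt y hy]; exact hxy
    have h1 : ‖x - g y‖ ≤ 2 := by
      have h2 := mem_closedBall_zero_iff.1 hx
      have h3 := mem_closedBall_zero_iff.1 (hg y hy)
      linarith [norm_sub_le x (g y)]
    have h2 : ∑ j, ‖⟪m j, ι (x - g y)⟫_ℂ‖ ^ 2 ≤ Fintype.card J * η ^ 2 := by
      rw [← nsmul_eq_mul]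
      refine Finset.sum_le_card_nsmul _ _ _ fun j _ => ?_
      have h4 : ‖(L x - L (g y)) j‖ ≤ η :=
        (norm_le_pi_norm _ _).trans (by rw [← dist_eq_norm]; exact hxy'.le)
      rw [← map_sub] at h4
      have h5 : L (x - g y) j = ⟪m j, ι (x - g y)⟫_ℂ := rfl
      rw [h5] at h4
      gcongr
    have h3 := hs (x - g y)
    have h4 : Fintype.card J * η ^ 2 ≤ δ ^ 2 / 4 := by
      rw [hη, div_pow, ← mul_div_assoc, div_le_div_iff₀ (by positivity) (by positivity)]
      have : (0 : ℝ) ≤ Fintype.card J := by positivity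
      nlinarith [sq_nonneg δ, mul_nonneg this (sq_nonneg δ),
        mul_nonneg (mul_nonneg this this) (sq_nonneg δ)]
    have h5 : ‖x - g y‖ ^ 2 ≤ 4 := by nlinarith [norm_nonneg (x - g y)]
    refine lt_of_pow_lt_pow_left₀ 2 hδ.le ?_
    nlinarith [sq_pos_of_pos hδ]
  refine ⟨closure (ι '' Metric.closedBall 0 1), ?_, ?_⟩
  · exact htb.closure.isCompact_of_isClosed isClosed_closure
  · refine mem_of_superset (Metric.closedBall_mem_nhds 0 one_pos) fun x hx => ?_
    exact subset_closure ⟨x, hx, rfl⟩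

/-- If eigenvalues `ν k ≠ μ` tended to `μ`, unit eigenvectors `e k = (ν k)⁻¹ R (e k)` would, by
compactness, have a subsequence converging to a unit eigenvector for `μ`. But that vector is
orthogonal to every `e k`. -/
lemma exists_isolated_eigenvalue {R : H →L[ℂ] H} (hR : IsCompactOperator R)
    (hs : IsSelfAdjoint R) {μ : ℂ} (hμ : μ ≠ 0) :
    ∃ δ : ℝ, 0 < δ ∧ ∀ ν, ν ≠ μ → ‖ν - μ‖ < δ → ¬ Module.End.HasEigenvalue (R : H →ₗ[ℂ] H) ν := by
  by_contra! hcon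
  choose! ν hν1 hν2 hν3 using fun k : ℕ => hcon (1 / (k + 1)) (by positivity)
  have hvec : ∀ k, ∃ e : H, ‖e‖ = 1 ∧ R e = ν k • e := fun k => by
    obtain ⟨v, hv⟩ := (hν3 k).exists_hasEigenvector
    have hv0 := hv.2
    have hv1 : R v = ν k • v := hv.apply_eq_smul
    refine ⟨((‖v‖ : ℂ)⁻¹) • v, ?_, ?_⟩
    · rw [norm_smul, norm_inv, Complex.norm_real, norm_norm, inv_mul_cancel₀ (norm_ne_zero_iff.2 hv0)]
    · rw [map_smul, hv1, smul_comm]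
  choose e he1 he2 using hvec
  have hνlim : Tendsto ν atTop (𝓝 μ) := by
    rw [tendsto_iff_norm_sub_tendsto_zero]
    exact squeeze_zero (fun _ => norm_nonneg _) (fun k => (hν2 k).le)
      tendsto_one_div_add_atTop_nhds_zero_nat
  have hcpt := hR.isCompact_closure_image_closedBall 1
  obtain ⟨v, -, φ, hφ, hv⟩ := hcpt.tendsto_subseq (x := fun k => R (e k)) fun k =>
    subset_closure ⟨e k, by simp [he1], rfl⟩
  have hνφ : Tendsto (fun k => ν (φ k)) atTop (𝓝 μ) := hνlim.comp hφ.tendsto_atTop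
  have hne : ∀ᶠ k in atTop, ν (φ k) ≠ 0 := hνφ.eventually_ne hμ
  have hlim : Tendsto (fun k => e (φ k)) atTop (𝓝 (μ⁻¹ • v)) := by
    refine ((hνφ.inv₀ hμ).smul hv).congr' ?_
    filter_upwards [hne] with k hk
    simp [he2, smul_smul, hk]
  set w := μ⁻¹ • v with hw
  have hw1 : ‖w‖ = 1 := tendsto_nhds_unique hlim.norm (by simp [he1])
  have hRw : R w = μ • w := by
    refine tendsto_nhds_unique ((R.continuous.tendsto w).comp hlim) ?_
    simpa [Function.comp_def, he2] using hνφ.smul hlim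
  have hsym := hs.isSymmetric
  have horth : ∀ k, ⟪e k, w⟫_ℂ = 0 := fun k => by
    have hv2 : Module.End.HasEigenvector (R : H →ₗ[ℂ] H) μ w :=
      ⟨Module.End.mem_eigenspace_iff.2 hRw, fun h0 => by simp [h0] at hw1⟩
    have he3 : e k ∈ Module.End.eigenspace (R : H →ₗ[ℂ] H) (ν k) :=
      Module.End.mem_eigenspace_iff.2 (he2 k)
    exact hsym.orthogonalFamily_eigenspaces (hν1 k) ⟨e k, he3⟩ ⟨w, hv2.1⟩
  have h0 : ⟪w, w⟫_ℂ = 0 := tendsto_nhds_unique (hlim.inner tendsto_const_nhds) (by simp [horth])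
  rw [inner_self_eq_zero] at h0
  simp [h0] at hw1

/-- The hypothesis says `R = (T + N)⁻¹`. Under `z ↦ (z + N)⁻¹`, points of the spectrum of `T` go to
nonzero eigenvalues of `R`, with the same eigenspaces, by the Fredholm alternative. Isolation and
finite multiplicity are then those of `R`. -/
lemma hasDiscreteSpectrum_of_compact_resolvent {T : H →ₗ.[ℂ] H} {R : H →L[ℂ] H}
    (hR : IsCompactOperator R) (hs : IsSelfAdjoint R) {N : ℂ}
    (hT : ∀ u f, (u, f) ∈ T.graph ↔ u = R (f + N • u)) : HasDiscreteSpectrum T := by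
  have hgr : ∀ z u f, (u, f) ∈ (shiftOp T (-z)).graph ↔ u = R f + (z + N) • R u := by
    intro z u f
    rw [mem_graph_shiftOp, hT, neg_smul, sub_neg_eq_add, add_assoc, ← add_smul, map_add, map_smul]
  have hspec : ∀ z ∈ opSpectrum T, z + N ≠ 0 ∧
      Module.End.HasEigenvalue (R : H →ₗ[ℂ] H) (z + N)⁻¹ := by
    intro z hz
    by_contra hcon
    refine hz ?_
    simp only [hgr]
    -- At `z = -N` the resolvent is `R` itself.
    by_cases h0 : z + N = 0
    · exact ⟨R, fun f => by simp [h0], fun u f h => by rw [h]; simp [h0]⟩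
    · have hne : (z + N)⁻¹ ≠ 0 := inv_ne_zero h0
      have hres : (z + N)⁻¹ ∈ resolventSet ℂ R :=
        (hR.hasEigenvalue_or_mem_resolventSet hne).resolve_left fun h => hcon ⟨h0, h⟩
      rw [spectrum.mem_resolventSet_iff] at hres
      obtain ⟨U, hU⟩ := hres
      have hUa : ∀ x, (U : H →L[ℂ] H) x = (z + N)⁻¹ • x - R x := fun x => by
        rw [hU]; simp [Algebra.algebraMap_eq_smul_one]
      have e1 : ∀ x, (U : H →L[ℂ] H) ((↑U⁻¹ : H →L[ℂ] H) x) = x := fun x => by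
        change ((U : H →L[ℂ] H) * (↑U⁻¹ : H →L[ℂ] H)) x = x
        simp
      have e2 : ∀ x, (↑U⁻¹ : H →L[ℂ] H) ((U : H →L[ℂ] H) x) = x := fun x => by
        change ((↑U⁻¹ : H →L[ℂ] H) * (U : H →L[ℂ] H)) x = x
        simp
      have key : ∀ u f, u = R f + (z + N) • R u ↔ (U : H →L[ℂ] H) u = (z + N)⁻¹ • R f := by
        intro u f
        rw [hUa, sub_eq_iff_eq_add, inv_smul_eq_iff₀ h0, smul_add, smul_smul,
          mul_inv_cancel₀ h0, one_smul]
      -- Since `(T - z)u = f` means `((z + N)⁻¹ - R)u = (z + N)⁻¹ R f`, the resolvent is `(z + N)⁻¹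
      -- U⁻¹ R` with `U = (z + N)⁻¹ - R`.
      refine ⟨(z + N)⁻¹ • ((↑U⁻¹ : H →L[ℂ] H) ∘L R), fun f => (key _ _).2 ?_, fun u f h => ?_⟩
      · simp [e1]
      · have := (key _ _).1 h
        have h2 := congrArg (↑U⁻¹ : H →L[ℂ] H) this
        rw [e2, map_smul] at h2
        simp [h2]
  have heig : ∀ z, z + N ≠ 0 → opEigenspace T z =
      Module.End.eigenspace (R : H →ₗ[ℂ] H) (z + N)⁻¹ := by
    intro z hz
    ext u
    rw [Module.End.mem_eigenspace_iff]
    change (u, z • u) ∈ T.graph ↔ R u = _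
    rw [hT, ← add_smul, map_smul, eq_comm, eq_inv_smul_iff₀ hz]
  intro z hz
  obtain ⟨h0, hev⟩ := hspec z hz
  have hne : (z + N)⁻¹ ≠ 0 := inv_ne_zero h0
  refine ⟨?_, ?_, ?_⟩
  · obtain ⟨δ, hδ, h⟩ := exists_isolated_eigenvalue hR hs hne
    have hc : Tendsto (fun w : ℂ => (w + N)⁻¹) (𝓝 z) (𝓝 (z + N)⁻¹) :=
      (tendsto_id.add_const N).inv₀ h0
    obtain ⟨ε, hε, hεδ⟩ := Metric.tendsto_nhds_nhds.1 hc δ hδ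
    refine ⟨ε, hε, fun w hw hwz => ?_⟩
    by_contra! hlt
    have h1 := hεδ (x := w) (by rwa [dist_eq_norm])
    rw [dist_eq_norm] at h1
    refine h _ (fun he => hwz ?_) h1 (hspec w hw).2
    exact add_right_cancel (inv_injective he)
  · rw [heig z h0]
    exact hev
  · rw [heig z h0]
    exact ContinuousLinearMap.finite_dimensional_eigenspace hR _ hne

lemma hasDiscreteSpectrum_formOp {ι : Q →L[ℂ] H} {S : Q →L[ℂ] Q} (hi : Function.Injective ι)
    (hd : DenseRange ι) (hcpt : IsCompactOperator ι) {c N : ℝ}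
    (hc : IsCoerciveOp c (S + (N : ℂ) • (ι.adjoint ∘L ι)))
    (hSN : IsSelfAdjoint (S + (N : ℂ) • (ι.adjoint ∘L ι))) :
    HasDiscreteSpectrum (formOp ι S) := by
  obtain ⟨S', h1, h2, h3, h4⟩ := hc.exists_inverse hSN
  obtain ⟨hinj, e⟩ := formOp_eq_inverseOp hi hd h1 h2
  refine hasDiscreteSpectrum_of_compact_resolvent (R := ι ∘L S' ∘L ι.adjoint) (N := N) ?_
    ((ContinuousLinearMap.nonneg_iff_isPositive _).1 (nonneg_conj_adjoint h4)).isSelfAdjoint ?_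
  · exact hcpt.comp_clm (S' ∘L ι.adjoint)
  · intro u f
    rw [← mem_graph_inverseOp hinj, ← e, ← shiftOp_formOp hi hd, mem_graph_shiftOp]
    simp

end Compactness

/-! ### Local Rellich compactness in Euclidean space by mollification -/

section EuclideanAnalysis

lemma sq_lintegral_mul_le {α : Type*} [MeasurableSpace α] (μ : Measure α) {f g : α → ℝ≥0∞}
    (hf : AEMeasurable f μ) (hg : AEMeasurable g μ) :
    (∫⁻ x, f x * g x ∂μ) ^ 2 ≤ (∫⁻ x, f x ^ 2 ∂μ) * ∫⁻ x, g x ^ 2 ∂μ := by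
  have h := ENNReal.lintegral_mul_le_Lp_mul_Lq μ Real.HolderConjugate.two_two hf hg
  have e : ∀ a : ℝ≥0∞, (a ^ (1 / 2 : ℝ)) ^ 2 = a := fun a => by
    rw [← ENNReal.rpow_natCast, ← ENNReal.rpow_mul]; norm_num
  calc (∫⁻ x, f x * g x ∂μ) ^ 2 ≤ _ := pow_le_pow_left' h 2
    _ = _ := by
      rw [mul_pow, e, e]; simp

lemma sq_lintegral_le {α : Type*} [MeasurableSpace α] (μ : Measure α) {f : α → ℝ≥0∞}
    (hf : AEMeasurable f μ) : (∫⁻ x, f x ∂μ) ^ 2 ≤ μ Set.univ * ∫⁻ x, f x ^ 2 ∂μ := by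
  simpa using sq_lintegral_mul_le μ (f := fun _ => 1) aemeasurable_const hf

variable {E : Type*} [NormedAddCommGroup E] [NormedSpace ℝ E] [FiniteDimensional ℝ E]
  [MeasurableSpace E] [BorelSpace E] (μ : Measure E) [μ.IsAddHaarMeasure]

/-- The fundamental theorem of calculus along the segment from `x` to `x - h`, then Cauchy–Schwarz
in `t`. -/
lemma enorm_sub_translate_sq_le {w : E → ℂ} (hw : ContDiff ℝ 1 w) (x h : E) :
    ‖w x - w (x - h)‖ₑ ^ 2 ≤
      ‖h‖ₑ ^ 2 * ∫⁻ t in Set.Ioc (0 : ℝ) 1, ‖fderiv ℝ w (x - t • h)‖ₑ ^ 2 := by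
  have hc : Continuous fun t : ℝ => fderiv ℝ w (x - t • h) :=
    (hw.continuous_fderiv one_ne_zero).comp (by fun_prop)
  have hd : ∀ t : ℝ, HasDerivAt (fun t : ℝ => w (x - t • h)) (fderiv ℝ w (x - t • h) (-h)) t := by
    intro t
    have h1 : HasDerivAt (fun t : ℝ => x - t • h) (-h) t := by
      simpa using ((hasDerivAt_id t).smul_const h).const_sub x
    exact ((hw.differentiable one_ne_zero _).hasFDerivAt).comp_hasDerivAt t h1
  have hint := intervalIntegral.integral_eq_sub_of_hasDerivAt (a := 0) (b := 1)
    (fun t _ => hd t) ((hc.clm_apply continuous_const).intervalIntegrable _ _)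
  simp only [one_smul, zero_smul, sub_zero] at hint
  have h1 : ‖w x - w (x - h)‖ₑ ≤ ∫⁻ t in Set.Ioc (0 : ℝ) 1, ‖fderiv ℝ w (x - t • h)‖ₑ * ‖h‖ₑ := by
    rw [← enorm_neg, neg_sub, ← hint, intervalIntegral.integral_of_le zero_le_one]
    refine (enorm_integral_le_lintegral_enorm _).trans (lintegral_mono fun t => ?_)
    refine (ContinuousLinearMap.le_opENorm _ _).trans ?_
    rw [enorm_neg]
  rw [lintegral_mul_const'' _ hc.enorm.aemeasurable] at h1
  calc ‖w x - w (x - h)‖ₑ ^ 2 ≤ _ := pow_le_pow_left' h1 2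
    _ ≤ _ := by
      rw [mul_pow, mul_comm]
      gcongr
      refine (sq_lintegral_le _ hc.enorm.aemeasurable).trans ?_
      simp

lemma lintegral_sub_translate_sq_le {w : E → ℂ} (hw : ContDiff ℝ 1 w) (h : E) :
    ∫⁻ x, ‖w x - w (x - h)‖ₑ ^ 2 ∂μ ≤ ‖h‖ₑ ^ 2 * ∫⁻ x, ‖fderiv ℝ w x‖ₑ ^ 2 ∂μ := by
  have hc : Continuous (fderiv ℝ w) := hw.continuous_fderiv one_ne_zero
  have hm : Measurable (Function.uncurry fun (x : E) (t : ℝ) => ‖fderiv ℝ w (x - t • h)‖ₑ ^ 2) := by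
    refine Continuous.measurable ?_
    exact (ENNReal.continuous_pow 2).comp (hc.comp (by fun_prop)).enorm
  refine (lintegral_mono fun x => enorm_sub_translate_sq_le hw x h).trans ?_
  have hm' : Measurable fun x : E => ∫⁻ t in Set.Ioc (0 : ℝ) 1, ‖fderiv ℝ w (x - t • h)‖ₑ ^ 2 :=
    hm.lintegral_prod_right'
  rw [lintegral_const_mul _ hm', lintegral_lintegral_swap hm.aemeasurable]
  gcongr
  have e : ∀ t : ℝ, ∫⁻ x, ‖fderiv ℝ w (x - t • h)‖ₑ ^ 2 ∂μ = ∫⁻ x, ‖fderiv ℝ w x‖ₑ ^ 2 ∂μ :=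
    fun t => lintegral_sub_right_eq_self (fun x => ‖fderiv ℝ w x‖ₑ ^ 2) (t • h)
  simp [e]

lemma add_sq_le_two_mul (a b : ℝ≥0∞) : (a + b) ^ 2 ≤ 2 * a ^ 2 + 2 * b ^ 2 := by
  have := ENNReal.rpow_add_le_mul_rpow_add_rpow a b (p := 2) one_le_two
  norm_num at this
  rwa [← mul_add]

/-- The mollification error is an average of the differences `w x - w (x - h)` over `‖h‖ ≤ r`, each
controlled in `L²` by `‖h‖` times the gradient. -/
lemma lintegral_sub_mollify_sq_le {w ρ : E → _} (hw : ContDiff ℝ 1 w)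
    (hρ : Continuous ρ) (hρ0 : ∀ x, 0 ≤ ρ x) (hρ1 : ∫ x, ρ x ∂μ = 1) {r : ℝ}
    (hρr : Function.support ρ ⊆ Metric.closedBall 0 r) :
    ∫⁻ x, ‖(w x : ℂ) - ∫ y, (ρ (x - y) : ℝ) • w y ∂μ‖ₑ ^ 2 ∂μ ≤
      ENNReal.ofReal r ^ 2 * ∫⁻ x, ‖fderiv ℝ w x‖ₑ ^ 2 ∂μ := by
  have hρc : HasCompactSupport ρ :=
    HasCompactSupport.of_support_subset_isCompact (isCompact_closedBall 0 r) hρr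
  have hρi : Integrable ρ μ := hρ.integrable_of_hasCompactSupport hρc
  have hρl : ∫⁻ h, ‖ρ h‖ₑ ∂μ = 1 := by
    have := ofReal_integral_norm_eq_lintegral_enorm hρi
    rw [← this]
    simp [Real.norm_of_nonneg (hρ0 _), hρ1]
  have hpt : ∀ x, ‖(w x : ℂ) - ∫ y, (ρ (x - y) : ℝ) • w y ∂μ‖ₑ ^ 2 ≤
      ∫⁻ h, ‖ρ h‖ₑ * ‖w x - w (x - h)‖ₑ ^ 2 ∂μ := by
    intro x
    have hcont : Continuous fun h => w (x - h) := hw.continuous.comp (by fun_prop)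
    have e1 : ∫ y, ρ (x - y) • w y ∂μ = ∫ h, ρ h • w (x - h) ∂μ := by
      rw [← integral_sub_left_eq_self (fun h => ρ h • w (x - h)) μ x]
      simp
    have e2 : w x = ∫ h, ρ h • w x ∂μ := by
      rw [integral_smul_const, hρ1, one_smul]
    have e3 : w x - ∫ y, ρ (x - y) • w y ∂μ = ∫ h, ρ h • (w x - w (x - h)) ∂μ := by
      simp only [smul_sub]
      rw [integral_sub, ← e2, e1]
      · exact hρi.smul_const _
      · exact (hρ.smul hcont).integrable_of_hasCompactSupport hρc.smul_right
    rw [e3]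
    have hm1 : AEMeasurable (fun h => ‖ρ h‖ₑ) μ := hρ.enorm.aemeasurable
    have hm2 : Measurable (fun h => ‖w x - w (x - h)‖ₑ) := (continuous_const.sub hcont).enorm.measurable
    -- Jensen's inequality for the square, with the probability measure `ρ dμ`.
    calc _ ≤ (∫⁻ h, ‖ρ h‖ₑ * ‖w x - w (x - h)‖ₑ ∂μ) ^ 2 := by
          gcongr
          refine (enorm_integral_le_lintegral_enorm _).trans (le_of_eq ?_)
          simp only [enorm_smul]
      _ = (∫⁻ h, ‖w x - w (x - h)‖ₑ ∂(μ.withDensity fun h => ‖ρ h‖ₑ)) ^ 2 := by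
          rw [lintegral_withDensity_eq_lintegral_mul₀ hm1 hm2.aemeasurable]; rfl
      _ ≤ _ := by
          refine (sq_lintegral_le _ hm2.aemeasurable).trans ?_
          rw [lintegral_withDensity_eq_lintegral_mul₀ hm1 (hm2.pow_const 2).aemeasurable,
            withDensity_apply _ MeasurableSet.univ, Measure.restrict_univ, hρl, one_mul]
          rfl
  have hm : Measurable (Function.uncurry fun (x h : E) => ‖ρ h‖ₑ * ‖w x - w (x - h)‖ₑ ^ 2) := by
    have hwc := hw.continuous
    have : Continuous fun p : E × E => w p.1 - w (p.1 - p.2) := by fun_prop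
    have h2 : Continuous fun p : E × E => ρ p.2 := by fun_prop
    exact h2.enorm.measurable.mul (this.enorm.measurable.pow_const 2)
  refine (lintegral_mono hpt).trans ?_
  rw [lintegral_lintegral_swap hm.aemeasurable]
  calc _ ≤ ∫⁻ h, ‖ρ h‖ₑ * (ENNReal.ofReal r ^ 2 * ∫⁻ x, ‖fderiv ℝ w x‖ₑ ^ 2 ∂μ) ∂μ := by
        refine lintegral_mono fun h => ?_
        have hwc := hw.continuous
        have hc : Continuous fun x => w x - w (x - h) := by fun_prop
        dsimp only
        rw [lintegral_const_mul _ (hc.enorm.measurable.pow_const 2)]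
        by_cases hh : ρ h = 0
        · simp [hh]
        · gcongr
          refine (lintegral_sub_translate_sq_le μ hw h).trans ?_
          gcongr
          rw [← ofReal_norm]
          exact ENNReal.ofReal_le_ofReal (by simpa using hρr hh)
    _ = _ := by
        rw [lintegral_mul_const'' _ hρ.enorm.aemeasurable, hρl, one_mul]

/-- Compactness of the embedding of `C¹` functions with support in `K`, with the `H¹` norm, in
`L²`: up to a small multiple of the `H¹` norm, the `L²` norm is controlled by finitely many
functionals. -/
lemma exists_finite_functionals_of_support_subset {K : Set E} (hK : IsCompact K) {ε : ℝ}
    (hε : 0 < ε) : ∃ (s : Finset E) (m : E → E → ℝ), (∀ a, Continuous (m a)) ∧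
      ∀ w : E → ℂ, ContDiff ℝ 1 w → Function.support w ⊆ K →
        ∫⁻ x, ‖w x‖ₑ ^ 2 ∂μ ≤ ENNReal.ofReal ε * (∫⁻ x, ‖fderiv ℝ w x‖ₑ ^ 2 ∂μ +
          ∫⁻ x, ‖w x‖ₑ ^ 2 ∂μ) + ∑ a ∈ s, ‖∫ y, m a y • w y ∂μ‖ₑ ^ 2 := by
  -- From `‖w‖² ≤ 2‖w - v‖² + 2‖v‖²`, where `v` is the mollification of `w` at scale `r`, the first
  -- term costs `2 r²` times the squared `L²` norm of the gradient.
  obtain ⟨r, hr, hrε⟩ : ∃ r : ℝ, 0 < r ∧ 2 * r ^ 2 ≤ ε :=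
    ⟨√(ε / 2), by positivity, by rw [Real.sq_sqrt (by positivity)]; linarith⟩
  set k := (μ K).toReal with hk
  have hkμ : ENNReal.ofReal k = μ K := ENNReal.ofReal_toReal hK.measure_lt_top.ne
  have hk0 : 0 ≤ k := ENNReal.toReal_nonneg
  -- On `K`, `v` differs from its value at the nearest net point by at most `η ‖w‖₁`, and `‖w‖₁² ≤ k
  -- ‖w‖₂²`. Integrating over `K` gives a further `k`, and the two splittings of a square give the
  -- `4`.
  obtain ⟨η, hη, hηε⟩ : ∃ η : ℝ, 0 < η ∧ 4 * η ^ 2 * k ^ 2 ≤ ε := by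
    refine ⟨√(ε / (4 * (k ^ 2 + 1))), by positivity, ?_⟩
    rw [Real.sq_sqrt (by positivity), mul_div_assoc', div_mul_eq_mul_div, div_le_iff₀ (by positivity)]
    nlinarith
  let b : ContDiffBump (0 : E) := ⟨r / 2, r, by positivity, by linarith⟩
  set ρ : E → ℝ := b.normed μ with hρdef
  have hρ : Continuous ρ := b.continuous_normed
  have hρ0 : ∀ x, 0 ≤ ρ x := b.nonneg_normed
  have hρ1 : ∫ x, ρ x ∂μ = 1 := b.integral_normed
  have hρr : Function.support ρ ⊆ Metric.closedBall 0 r := by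
    rw [hρdef, b.support_normed_eq]; exact Metric.ball_subset_closedBall
  have hρc : HasCompactSupport ρ := b.hasCompactSupport_normed
  -- Uniform continuity of `ρ` makes the mollifications equicontinuous, so finitely many of their
  -- values suffice.
  obtain ⟨δ, hδ, hunif⟩ := Metric.uniformContinuous_iff.1
    (hρc.uniformContinuous_of_continuous hρ) η hη
  obtain ⟨s, hsK, hs⟩ := hK.finite_cover_balls hδ
  obtain ⟨hsf, hs⟩ := hs
  -- The functionals are the values `v a` at the net points; `√(4k)` absorbs the factor `4k = 2 · 2
  -- · μ(K)` in front of `‖v a‖²`.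
  refine ⟨hsf.toFinset, fun a y => √(4 * k) * ρ (a - y), fun a => by fun_prop, fun w hw hwK => ?_⟩
  have hwc : HasCompactSupport w := HasCompactSupport.of_support_subset_isCompact hK hwK
  have hwi : Integrable w μ := hw.continuous.integrable_of_hasCompactSupport hwc
  set v : E → ℂ := fun x => ∫ y, ρ (x - y) • w y ∂μ with hv
  set A := ∫⁻ x, ‖w x‖ₑ ^ 2 ∂μ with hA
  set B := ∫⁻ x, ‖fderiv ℝ w x‖ₑ ^ 2 ∂μ with hB
  have hint : ∀ x, Integrable (fun y => ρ (x - y) • w y) μ := fun x =>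
    ((by fun_prop : Continuous fun y => ρ (x - y)).smul
      hw.continuous).integrable_of_hasCompactSupport hwc.smul_left
  have hmoll : ∫⁻ x, ‖w x - v x‖ₑ ^ 2 ∂μ ≤ ENNReal.ofReal r ^ 2 * B :=
    lintegral_sub_mollify_sq_le μ hw hρ hρ0 hρ1 hρr
  have hsuppK : ∀ f : ℝ≥0∞ → ℝ≥0∞, f 0 = 0 → ∫⁻ x, f ‖w x‖ₑ ∂μ = ∫⁻ x in K, f ‖w x‖ₑ ∂μ := by
    intro f hf
    rw [setLIntegral_eq_of_support_subset]
    intro x hx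
    refine hwK fun h0 => hx ?_
    simp [h0, hf]
  have hL1 : (∫⁻ x, ‖w x‖ₑ ∂μ) ^ 2 ≤ ENNReal.ofReal k * A := by
    rw [hA, hsuppK (fun a => a) rfl, hsuppK (fun a => a ^ 2) (by simp), hkμ]
    refine (sq_lintegral_le _ hw.continuous.enorm.aemeasurable).trans ?_
    simp
  have hvx : ∀ x ∈ K, ‖v x‖ₑ ^ 2 ≤ 2 * ∑ a ∈ hsf.toFinset, ‖v a‖ₑ ^ 2 +
      2 * (ENNReal.ofReal η ^ 2 * (ENNReal.ofReal k * A)) := by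
    intro x hx
    obtain ⟨a, ha, hxa⟩ := Set.mem_iUnion₂.1 (hs hx)
    have h1 : ‖v x - v a‖ₑ ≤ ENNReal.ofReal η * ∫⁻ y, ‖w y‖ₑ ∂μ := by
      rw [hv]
      dsimp only
      rw [← integral_sub (hint x) (hint a), ← lintegral_const_mul _ hw.continuous.enorm.measurable]
      refine (enorm_integral_le_lintegral_enorm _).trans (lintegral_mono fun y => ?_)
      rw [← sub_smul, enorm_smul]
      gcongr
      rw [← ofReal_norm]
      refine ENNReal.ofReal_le_ofReal ?_
      rw [← dist_eq_norm]
      exact (hunif (by simpa using hxa)).le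
    have h2 : ‖v x‖ₑ ≤ ‖v a‖ₑ + ‖v x - v a‖ₑ := by
      have := enorm_add_le (v a) (v x - v a)
      simpa using this
    calc ‖v x‖ₑ ^ 2 ≤ (‖v a‖ₑ + ‖v x - v a‖ₑ) ^ 2 := by gcongr
      _ ≤ _ := add_sq_le_two_mul _ _
      _ ≤ _ := by
        gcongr
        · exact Finset.single_le_sum (f := fun a => ‖v a‖ₑ ^ 2) (fun _ _ => zero_le)
            (hsf.mem_toFinset.2 ha)
        · calc ‖v x - v a‖ₑ ^ 2 ≤ (ENNReal.ofReal η * ∫⁻ y, ‖w y‖ₑ ∂μ) ^ 2 := by gcongr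
            _ ≤ _ := by rw [mul_pow]; gcongr
  have hvm : Continuous v := by
    have hwcont := hw.continuous
    have e : v = fun x => ∫ y in K, ρ (x - y) • w y ∂μ := by
      ext x
      refine (setIntegral_eq_integral_of_forall_compl_eq_zero fun y hy => ?_).symm
      rw [Function.notMem_support.1 fun h => hy (hwK h), smul_zero]
    rw [e]
    exact continuous_parametric_integral_of_continuous (by fun_prop) hK
  have hfin : ∀ a, ‖∫ y, (√(4 * k) * ρ (a - y)) • w y ∂μ‖ₑ ^ 2 =
      ENNReal.ofReal (4 * k) * ‖v a‖ₑ ^ 2 := by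
    intro a
    simp only [mul_smul]
    rw [integral_smul, enorm_smul, mul_pow, Real.enorm_of_nonneg (Real.sqrt_nonneg _),
      ← ENNReal.ofReal_pow (Real.sqrt_nonneg _), Real.sq_sqrt (by positivity)]
  simp only [hfin, ← Finset.mul_sum]
  calc A = ∫⁻ x in K, ‖w x‖ₑ ^ 2 ∂μ := hsuppK (fun a => a ^ 2) (by simp)
    _ ≤ ∫⁻ x in K, (2 * ‖w x - v x‖ₑ ^ 2 + 2 * ‖v x‖ₑ ^ 2) ∂μ := by
        refine lintegral_mono fun x => ?_
        refine le_trans ?_ (add_sq_le_two_mul _ _)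
        have := enorm_add_le (w x - v x) (v x)
        simp only [sub_add_cancel] at this
        gcongr
    _ ≤ 2 * (ENNReal.ofReal r ^ 2 * B) + 2 * (ENNReal.ofReal k * (2 * ∑ a ∈ hsf.toFinset, ‖v a‖ₑ ^ 2 +
          2 * (ENNReal.ofReal η ^ 2 * (ENNReal.ofReal k * A)))) := by
        have hm1 : Measurable fun x => ‖w x - v x‖ₑ := (hw.continuous.sub hvm).enorm.measurable
        rw [lintegral_add_left (by fun_prop), lintegral_const_mul _ (by fun_prop),
          lintegral_const_mul _ (hvm.enorm.measurable.pow_const 2)]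
        gcongr
        · exact (setLIntegral_le_lintegral _ _).trans hmoll
        · rw [mul_comm (ENNReal.ofReal k) (2 * _ + _), hkμ, ← setLIntegral_const, ← hkμ]
          exact setLIntegral_mono_ae measurable_const.aemeasurable (ae_of_all _ hvx)
    _ = ENNReal.ofReal (2 * r ^ 2) * B + ENNReal.ofReal (4 * η ^ 2 * k ^ 2) * A +
          ENNReal.ofReal (4 * k) * ∑ a ∈ hsf.toFinset, ‖v a‖ₑ ^ 2 := by
        have e4 : ENNReal.ofReal 4 = 4 := by norm_num
        have e2 : ENNReal.ofReal 2 = 2 := by norm_num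
        rw [ENNReal.ofReal_mul (by positivity), ENNReal.ofReal_mul (by positivity),
          ENNReal.ofReal_mul (by positivity), ENNReal.ofReal_mul (by positivity),
          ENNReal.ofReal_pow hr.le, ENNReal.ofReal_pow hη.le, ENNReal.ofReal_pow hk0, e4, e2]
        ring
    _ ≤ _ := by
        rw [mul_add]
        gcongr

end EuclideanAnalysis

/-! ### The metric, its density and its inverse in charts, and their transformation rules -/

section LocalGeometry

variable {n : ℕ} {M : Type*} [TopologicalSpace M] [ChartedSpace (EuclideanSpace ℝ (Fin n)) M]
  [IsManifold (𝓡 n) ∞ M]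

/-- The metric at a point, as a bilinear form on the model space. -/
def metricForm (g : SmoothMetric n M) (p : M) :
    EuclideanSpace ℝ (Fin n) →L[ℝ] EuclideanSpace ℝ (Fin n) →L[ℝ] ℝ := g.inner p

/-- The derivative of the inverse of the chart around `x`. -/
def chartFrame (x : M) (y : EuclideanSpace ℝ (Fin n)) :
    EuclideanSpace ℝ (Fin n) →L[ℝ] EuclideanSpace ℝ (Fin n) :=
  mfderiv (𝓡 n) (𝓡 n) (chartR n x).symm y

lemma metricMatrix_apply (g : SmoothMetric n M) (x : M) (y : EuclideanSpace ℝ (Fin n))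
    (i j : Fin n) : metricMatrix g x y i j =
      metricForm g ((chartR n x).symm y) (chartFrame x y (stdVec i)) (chartFrame x y (stdVec j)) :=
  rfl

/-- The coordinate fields are the tangent map of the inverse chart applied to constant fields, hence
smooth along it, and the metric is a smooth section of the bundle of bilinear forms. -/
lemma contDiffOn_metricMatrix (g : SmoothMetric n M) (x : M) (i j : Fin n) :
    ContDiffOn ℝ ∞ (fun y => metricMatrix g x y i j) (chartR n x).target := by
  have hs : ContMDiffOn (𝓡 n) (𝓡 n) ∞ (chartR n x).symm (chartR n x).target :=
    contMDiffOn_chart_symm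
  have hT := hs.contMDiffOn_tangentMapWithin (m := ∞) (by simp)
    (chartR n x).open_target.uniqueMDiffOn
  have hv : ∀ i, ContMDiffOn (𝓡 n) (𝓡 n).tangent ∞
      (fun y => (⟨(chartR n x).symm y, coordVec x y i⟩ : TangentBundle (𝓡 n) M))
      (chartR n x).target := by
    intro i
    have hc : ContMDiffOn (𝓡 n) (𝓡 n).tangent ∞
        (fun y : EuclideanSpace ℝ (Fin n) =>
          (⟨y, stdVec i⟩ : TangentBundle (𝓡 n) (EuclideanSpace ℝ (Fin n))))
        (chartR n x).target := by
      exact contMDiffOn_vectorSpace_iff_contDiffOn.2 contDiffOn_const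
    refine (hT.comp hc fun y hy => hy).congr fun y hy => ?_
    simp only [tangentMapWithin, coordVec, Function.comp_apply]
    rw [mfderivWithin_of_isOpen (chartR n x).open_target hy]
  have h : ContMDiffOn (𝓡 n) ((𝓡 n).prod 𝓘(ℝ)) ∞
      (fun y => Bundle.TotalSpace.mk' ℝ (E := Bundle.Trivial M ℝ) ((chartR n x).symm y)
        (g.inner _ (coordVec x y i) (coordVec x y j))) (chartR n x).target :=
    ContMDiffOn.clm_bundle_apply₂ (F₁ := EuclideanSpace ℝ (Fin n))
      (F₂ := EuclideanSpace ℝ (Fin n)) (g.contMDiff.comp_contMDiffOn hs) (hv i) (hv j)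
  have h2 : ContMDiffOn (𝓡 n) 𝓘(ℝ) ∞ (fun y => metricMatrix g x y i j) (chartR n x).target :=
    fun y hy => (Bundle.contMDiffWithinAt_totalSpace.1 (h y hy)).2
  exact h2.contDiffOn

lemma chartFrame_injective (x : M) {y : EuclideanSpace ℝ (Fin n)} (hy : y ∈ (chartR n x).target) :
    Function.Injective (chartFrame x y) :=
  ((mdifferentiable_chart (I := 𝓡 n) (H := EuclideanSpace ℝ (Fin n)) x).symm).mfderiv_injective hy

/-- The change of coordinates from the chart around `x` to the chart around `x'`. -/
def transition (x x' : M) (y : EuclideanSpace ℝ (Fin n)) : EuclideanSpace ℝ (Fin n) :=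
  chartR n x' ((chartR n x).symm y)

/-- The coordinates, in the chart around `x`, of the points in the domain of the chart around `x'`. -/
def overlap (x x' : M) : Set (EuclideanSpace ℝ (Fin n)) :=
  (chartR n x).target ∩ (chartR n x).symm ⁻¹' (chartR n x').source

lemma isOpen_overlap (x x' : M) : IsOpen (overlap (n := n) x x') :=
  (chartR n x).isOpen_inter_preimage_symm (chartR n x').open_source

lemma contDiffOn_transition (x x' : M) : ContDiffOn ℝ ∞ (transition (n := n) x x') (overlap x x') := by
  have h1 : ContMDiffOn (𝓡 n) (𝓡 n) ∞ (chartR n x).symm (chartR n x).target :=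
    contMDiffOn_chart_symm
  have h2 : ContMDiffOn (𝓡 n) (𝓡 n) ∞ (chartR n x') (chartR n x').source := contMDiffOn_chart
  exact ((h2.comp (h1.mono Set.inter_subset_left) fun y hy => hy.2)).contDiffOn

lemma transition_mem_target {x x' : M} {y : EuclideanSpace ℝ (Fin n)} (hy : y ∈ overlap x x') :
    transition x x' y ∈ (chartR n x').target := (chartR n x').map_source hy.2

lemma symm_transition {x x' : M} {y : EuclideanSpace ℝ (Fin n)} (hy : y ∈ overlap x x') :
    (chartR n x').symm (transition x x' y) = (chartR n x).symm y := (chartR n x').left_inv hy.2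

lemma transition_mem_overlap {x x' : M} {y : EuclideanSpace ℝ (Fin n)} (hy : y ∈ overlap x x') :
    transition x x' y ∈ overlap x' x :=
  ⟨transition_mem_target hy, by
    rw [Set.mem_preimage, symm_transition hy]; exact (chartR n x).map_target hy.1⟩

lemma transition_transition {x x' : M} {y : EuclideanSpace ℝ (Fin n)} (hy : y ∈ overlap x x') :
    transition x' x (transition x x' y) = y := by
  rw [transition, symm_transition hy]; exact (chartR n x).right_inv hy.1

lemma image_transition_overlap (x x' : M) :
    transition (n := n) x x' '' overlap x x' = overlap x' x := by
  refine Set.Subset.antisymm ?_ fun y hy => ?_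
  · rintro _ ⟨y, hy, rfl⟩
    exact transition_mem_overlap hy
  · exact ⟨_, transition_mem_overlap hy, transition_transition hy⟩

lemma differentiableAt_transition {x x' : M} {y : EuclideanSpace ℝ (Fin n)}
    (hy : y ∈ overlap x x') : DifferentiableAt ℝ (transition (n := n) x x') y :=
  ((contDiffOn_transition x x').contDiffAt ((isOpen_overlap x x').mem_nhds hy)).differentiableAt
    (by simp)

lemma chartFrame_eq_comp {x x' : M} {y : EuclideanSpace ℝ (Fin n)} (hy : y ∈ overlap x x')
    (v : EuclideanSpace ℝ (Fin n)) :
    chartFrame x y v = chartFrame x' (transition x x' y) (fderiv ℝ (transition x x') y v) := by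
  have h1 : MDifferentiableAt (𝓡 n) (𝓡 n) (chartR n x').symm (transition x x' y) :=
    mdifferentiableAt_atlas_symm (chart_mem_atlas _ x') (transition_mem_target hy)
  have h2 : MDifferentiableAt (𝓡 n) (𝓡 n) (transition (n := n) x x') y :=
    (differentiableAt_transition hy).mdifferentiableAt
  have e : (chartR n x).symm =ᶠ[𝓝 y] (chartR n x').symm ∘ transition x x' := by
    filter_upwards [(isOpen_overlap x x').mem_nhds hy] with z hz
    exact (symm_transition hz).symm
  have h3 := mfderiv_comp y h1 h2
  have h4 : (mfderiv (𝓡 n) (𝓡 n) (chartR n x).symm y : EuclideanSpace ℝ (Fin n) →L[ℝ] EuclideanSpace ℝ (Fin n)) =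
    mfderiv (𝓡 n) (𝓡 n) ((chartR n x').symm ∘ transition x x') y := e.mfderiv_eq
  rw [mfderiv_eq_fderiv] at h3
  rw [chartFrame, h4]
  exact congrArg (fun L : EuclideanSpace ℝ (Fin n) →L[ℝ] EuclideanSpace ℝ (Fin n) => L v) h3

lemma inChart_eq_comp {x x' : M} {y : EuclideanSpace ℝ (Fin n)} (hy : y ∈ overlap x x')
    (f : M → ℂ) : inChart (n := n) x f =ᶠ[𝓝 y] inChart x' f ∘ transition x x' := by
  filter_upwards [(isOpen_overlap x x').mem_nhds hy] with z hz
  simp [inChart, symm_transition hz]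

/-- The Jacobian matrix of the change of coordinates. -/
def jacobian (x x' : M) (y : EuclideanSpace ℝ (Fin n)) : Matrix (Fin n) (Fin n) ℝ :=
  Matrix.of fun k i => fderiv ℝ (transition x x') y (stdVec i) k

lemma eq_sum_stdVec (v : EuclideanSpace ℝ (Fin n)) : v = ∑ k, v k • (stdVec k) := by
  ext i
  simp [stdVec, Finset.sum_apply, Pi.single_apply]

lemma fderiv_transition_stdVec (x x' : M) (y : EuclideanSpace ℝ (Fin n)) (i : Fin n) :
    fderiv ℝ (transition x x') y (stdVec i) = ∑ k, jacobian x x' y k i • stdVec k :=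
  eq_sum_stdVec _

lemma det_jacobian (x x' : M) (y : EuclideanSpace ℝ (Fin n)) :
    (jacobian x x' y).det = (fderiv ℝ (transition (n := n) x x') y).det := by
  rw [ContinuousLinearMap.det, ← LinearMap.det_toMatrix (EuclideanSpace.basisFun (Fin n) ℝ).toBasis]
  congr 1

lemma metricMatrix_eq_transition (g : SmoothMetric n M) {x x' : M} {y : EuclideanSpace ℝ (Fin n)}
    (hy : y ∈ overlap x x') : metricMatrix g x y =
      (jacobian x x' y).transpose * metricMatrix g x' (transition x x' y) * jacobian x x' y := by
  ext i j
  rw [metricMatrix_apply, chartFrame_eq_comp hy, chartFrame_eq_comp hy, fderiv_transition_stdVec,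
    fderiv_transition_stdVec, ← symm_transition hy]
  simp only [map_sum, map_smul, sum_apply, smul_apply, Matrix.mul_apply, Matrix.transpose_apply,
    metricMatrix_apply, smul_eq_mul, Finset.sum_mul, Finset.mul_sum]
  refine Finset.sum_congr rfl fun k _ => Finset.sum_congr rfl fun l _ => ?_
  ring

lemma posDef_metricMatrix (g : SmoothMetric n M) {x : M} {y : EuclideanSpace ℝ (Fin n)}
    (hy : y ∈ (chartR n x).target) : (metricMatrix g x y).PosDef := by
  refine Matrix.PosDef.of_dotProduct_mulVec_pos ?_ ?_
  · ext i j
    simp only [Matrix.conjTranspose_apply, star_trivial, metricMatrix_apply]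
    exact g.symm _ _ _
  · intro v hv
    have e : star v ⬝ᵥ (metricMatrix g x y).mulVec v = metricForm g ((chartR n x).symm y)
        (chartFrame x y (∑ i, v i • stdVec i)) (chartFrame x y (∑ i, v i • stdVec i)) := by
      simp only [map_sum, map_smul, sum_apply, smul_apply, dotProduct, Matrix.mulVec,
        metricMatrix_apply, smul_eq_mul, Finset.mul_sum, star_trivial, Pi.star_apply]
      rw [Finset.sum_comm]
      refine Finset.sum_congr rfl fun k _ => Finset.sum_congr rfl fun l _ => ?_
      ring
    rw [e]
    refine g.pos _ _ ?_
    intro h0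
    refine hv ?_
    have h1 := chartFrame_injective x hy (h0.trans (map_zero (chartFrame x y)).symm)
    ext i
    have := congrArg (fun w : EuclideanSpace ℝ (Fin n) => w i) h1
    simpa [stdVec, Finset.sum_apply, Pi.single_apply] using this

lemma det_metricMatrix_pos (g : SmoothMetric n M) {x : M} {y : EuclideanSpace ℝ (Fin n)}
    (hy : y ∈ (chartR n x).target) : 0 < (metricMatrix g x y).det :=
  (posDef_metricMatrix g hy).det_pos

lemma metricDensity_pos (g : SmoothMetric n M) {x : M} {y : EuclideanSpace ℝ (Fin n)}
    (hy : y ∈ (chartR n x).target) : 0 < metricDensity g x y :=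
  Real.sqrt_pos.2 (det_metricMatrix_pos g hy)

lemma ContDiffOn.matrix_det {E : Type*} [NormedAddCommGroup E] [NormedSpace ℝ E] {s : Set E}
    {m : Type*} [Fintype m] [DecidableEq m] {A : E → Matrix m m ℝ}
    (h : ∀ i j, ContDiffOn ℝ ∞ (fun y => A y i j) s) : ContDiffOn ℝ ∞ (fun y => (A y).det) s := by
  simp only [Matrix.det_apply]
  refine ContDiffOn.sum fun σ _ => ContDiffOn.const_smul _ ?_
  exact contDiffOn_prod fun i _ => h _ _

lemma contDiffOn_det_metricMatrix (g : SmoothMetric n M) (x : M) :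
    ContDiffOn ℝ ∞ (fun y => (metricMatrix g x y).det) (chartR n x).target :=
  ContDiffOn.matrix_det fun i j => contDiffOn_metricMatrix g x i j

lemma contDiffOn_metricDensity (g : SmoothMetric n M) (x : M) :
    ContDiffOn ℝ ∞ (metricDensity g x) (chartR n x).target :=
  (contDiffOn_det_metricMatrix g x).sqrt fun _ hy => (det_metricMatrix_pos g hy).ne'

/-- Cramer's rule: the entries are quotients of determinants with smooth entries by the positive
determinant of the metric. -/
lemma contDiffOn_metricMatrix_inv (g : SmoothMetric n M) (x : M) (i j : Fin n) :
    ContDiffOn ℝ ∞ (fun y => (metricMatrix g x y)⁻¹ i j) (chartR n x).target := by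
  simp only [Matrix.inv_def, Matrix.smul_apply, Ring.inverse_eq_inv', smul_eq_mul,
    Matrix.adjugate_apply]
  refine ((contDiffOn_det_metricMatrix g x).inv fun _ hy => (det_metricMatrix_pos g hy).ne').mul ?_
  refine ContDiffOn.matrix_det fun k l => ?_
  by_cases hk : k = j
  · subst hk
    simpa using contDiffOn_const
  · simpa [Matrix.updateRow_apply, hk] using contDiffOn_metricMatrix g x k l

lemma det_metricMatrix_eq_transition (g : SmoothMetric n M) {x x' : M}
    {y : EuclideanSpace ℝ (Fin n)} (hy : y ∈ overlap x x') : (metricMatrix g x y).det =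
      (jacobian x x' y).det ^ 2 * (metricMatrix g x' (transition x x' y)).det := by
  rw [metricMatrix_eq_transition g hy, Matrix.det_mul, Matrix.det_mul, Matrix.det_transpose]
  ring

lemma metricDensity_eq_transition (g : SmoothMetric n M) {x x' : M}
    {y : EuclideanSpace ℝ (Fin n)} (hy : y ∈ overlap x x') : metricDensity g x y =
      |(fderiv ℝ (transition (n := n) x x') y).det| * metricDensity g x' (transition x x' y) := by
  rw [metricDensity, det_metricMatrix_eq_transition g hy, Real.sqrt_mul (sq_nonneg _),
    Real.sqrt_sq_eq_abs, det_jacobian, metricDensity]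

lemma metricMatrix_inv_eq_transition (g : SmoothMetric n M) {x x' : M}
    {y : EuclideanSpace ℝ (Fin n)} (hy : y ∈ overlap x x') :
    (metricMatrix g x' (transition x x' y))⁻¹ =
      jacobian x x' y * (metricMatrix g x y)⁻¹ * (jacobian x x' y).transpose := by
  have hJ : (jacobian x x' y).det ≠ 0 := by
    intro h0
    have h1 := det_metricMatrix_pos g hy.1
    rw [det_metricMatrix_eq_transition g hy, h0] at h1
    simp at h1
  have hu : IsUnit (jacobian x x' y).det := isUnit_iff_ne_zero.2 hJ
  have hu' : IsUnit (jacobian x x' y).transpose.det := by rwa [Matrix.det_transpose]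
  rw [metricMatrix_eq_transition g hy, Matrix.mul_inv_rev, Matrix.mul_inv_rev,
    ← Matrix.mul_assoc, ← Matrix.mul_assoc, Matrix.mul_nonsing_inv _ hu, Matrix.one_mul,
    Matrix.mul_assoc, Matrix.nonsing_inv_mul _ hu', Matrix.mul_one]

/-- The expression `g^{ij} ∂_i F ∂_j X` in the chart around `x`. -/
def gradForm (g : SmoothMetric n M) (x : M) (F X : EuclideanSpace ℝ (Fin n) → ℂ)
    (y : EuclideanSpace ℝ (Fin n)) : ℂ :=
  ∑ i, ∑ j, ((metricMatrix g x y)⁻¹ i j : ℂ) * fderiv ℝ F y (stdVec i) * fderiv ℝ X y (stdVec j)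

lemma gradForm_eq_dotProduct (g : SmoothMetric n M) (x : M) (F X : EuclideanSpace ℝ (Fin n) → ℂ)
    (y : EuclideanSpace ℝ (Fin n)) : gradForm g x F X y =
      (fun i => fderiv ℝ F y (stdVec i)) ⬝ᵥ
        ((metricMatrix g x y)⁻¹.map Complex.ofReal).mulVec fun j => fderiv ℝ X y (stdVec j) := by
  simp only [gradForm, dotProduct, Matrix.mulVec, Matrix.map_apply, Finset.mul_sum]
  refine Finset.sum_congr rfl fun i _ => Finset.sum_congr rfl fun j _ => ?_
  ring

lemma gradForm_congr (g : SmoothMetric n M) (x : M) {F F' X X' : EuclideanSpace ℝ (Fin n) → ℂ}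
    {y : EuclideanSpace ℝ (Fin n)} (hF : F =ᶠ[𝓝 y] F') (hX : X =ᶠ[𝓝 y] X') :
    gradForm g x F X y = gradForm g x F' X' y := by
  simp only [gradForm, hF.fderiv_eq, hX.fderiv_eq]

/-- Differentials transform by `Jᵀ` and the inverse metric by `J g⁻¹ Jᵀ`, so the Jacobians cancel.
Only first derivatives enter here; invariance of the Laplacian is deduced from this. -/
lemma gradForm_comp_transition (g : SmoothMetric n M) {x x' : M} {y : EuclideanSpace ℝ (Fin n)}
    (hy : y ∈ overlap x x') {F X : EuclideanSpace ℝ (Fin n) → ℂ}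
    (hF : DifferentiableAt ℝ F (transition x x' y)) (hX : DifferentiableAt ℝ X (transition x x' y)) :
    gradForm g x (F ∘ transition x x') (X ∘ transition x x') y =
      gradForm g x' F X (transition x x' y) := by
  have e : ∀ {F : EuclideanSpace ℝ (Fin n) → ℂ}, DifferentiableAt ℝ F (transition x x' y) →
      (fun i => fderiv ℝ (F ∘ transition x x') y (stdVec i)) =
        ((jacobian x x' y).map Complex.ofReal).transpose.mulVec
          fun k => fderiv ℝ F (transition x x' y) (stdVec k) := by
    intro F hF
    ext i
    rw [fderiv_comp _ hF (differentiableAt_transition hy), ContinuousLinearMap.comp_apply,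
      fderiv_transition_stdVec, map_sum]
    simp [Matrix.mulVec, dotProduct]
  have hmap : ∀ A B : Matrix (Fin n) (Fin n) ℝ,
      (A * B).map Complex.ofReal = A.map Complex.ofReal * B.map Complex.ofReal := fun A B =>
    Matrix.map_mul (f := Complex.ofRealHom)
  rw [gradForm_eq_dotProduct, gradForm_eq_dotProduct, e hF, e hX,
    metricMatrix_inv_eq_transition g hy, hmap, hmap, Matrix.mulVec_transpose,
    ← Matrix.dotProduct_mulVec, Matrix.mulVec_mulVec, Matrix.mulVec_mulVec, Matrix.transpose_map]

end LocalGeometry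

/-! ### Gluing compatible measures -/

section GluedMeasures

/-- Compatible measures `μ i` on the sets of a countably covered family `S i` are the restrictions of
their supremum. -/
lemma restrict_iSup_of_compatible {α ι : Type*} [MeasurableSpace α] (μ : ι → Measure α)
    (S : ι → Set α) (hS : ∀ i, MeasurableSet (S i)) (h0 : ∀ i, μ i (S i)ᶜ = 0)
    (hc : ∀ i j, (μ i).restrict (S j) = (μ j).restrict (S i)) (f : ℕ → ι)
    (hf : ⋃ k, S (f k) = Set.univ) (i : ι) : (⨆ i, μ i).restrict (S i) = μ i := by
  -- Cutting a countable cover into disjoint pieces lets one define the glued measure `ν` as a sum;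
  -- compatibility shows that `ν` restricts to each `μ i`.
  set D : ℕ → Set α := disjointed fun k => S (f k) with hD
  have hDm : ∀ k, MeasurableSet (D k) := fun k => MeasurableSet.disjointed (fun k => hS _) k
  have hDS : ∀ k, D k ⊆ S (f k) := fun k => disjointed_subset _ k
  have hDd : Pairwise (Function.onFun Disjoint D) := disjoint_disjointed _
  have hDu : ⋃ k, D k = Set.univ := by rw [hD, iUnion_disjointed, hf]
  have hself : ∀ i, (μ i).restrict (S i) = μ i := fun i =>
    Measure.restrict_eq_self_of_ae_mem (by rw [ae_iff]; exact h0 i)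
  set ν : Measure α := Measure.sum fun k => (μ (f k)).restrict (D k) with hν
  have hsum : ∀ (lam : Measure α) s, MeasurableSet s → ∑' k, lam (s ∩ D k) = lam s := by
    intro lam s hs
    rw [← measure_iUnion (fun a b hab => (hDd hab).mono Set.inter_subset_right
      Set.inter_subset_right) fun k => hs.inter (hDm k), ← Set.inter_iUnion, hDu, Set.inter_univ]
  have hνs : ∀ s, MeasurableSet s → ν s = ∑' k, μ (f k) (s ∩ D k) := by
    intro s hs
    rw [hν, Measure.sum_apply _ hs]
    exact tsum_congr fun k => Measure.restrict_apply hs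
  have hνi : ∀ i, ν.restrict (S i) = μ i := by
    intro i
    ext s hs
    rw [Measure.restrict_apply hs, hνs _ (hs.inter (hS i)), ← hsum (μ i) s hs]
    refine tsum_congr fun k => ?_
    have e1 : μ (f k) (s ∩ S i ∩ D k) = ((μ (f k)).restrict (S i)) (s ∩ D k) := by
      rw [Measure.restrict_apply (hs.inter (hDm k)), Set.inter_right_comm]
    have e2 : s ∩ D k ∩ S (f k) = s ∩ D k :=
      Set.inter_eq_left.2 (Set.inter_subset_right.trans (hDS k))
    rw [e1, hc, Measure.restrict_apply (hs.inter (hDm k)), e2]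
  -- Each `μ i` is a restriction of `ν`. Conversely, on the piece `D k` the measure `ν` is `μ (f
  -- k)`, which is below the supremum.
  have hsup : ⨆ i, μ i = ν := by
    refine le_antisymm (iSup_le fun i => ?_) ?_
    · rw [← hνi i]; exact Measure.restrict_le_self
    · refine Measure.le_iff.2 fun s hs => ?_
      rw [hνs s hs, ← hsum _ s hs]
      exact ENNReal.tsum_le_tsum fun k => le_iSup μ (f k) _
  rw [hsup, hνi]

end GluedMeasures

/-! ### The Riemannian volume: expression in charts, finiteness, positivity on open sets -/

section Volume

variable {n : ℕ} {M : Type*} [TopologicalSpace M] [ChartedSpace (EuclideanSpace ℝ (Fin n)) M]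
  [IsManifold (𝓡 n) ∞ M] [MeasurableSpace M] [BorelSpace M]

lemma aemeasurable_chart_symm (x : M) :
    AEMeasurable (chartR n x).symm (volume.restrict (chartR n x).target) :=
  (chartR n x).continuousOn_symm.aemeasurable (chartR n x).open_target.measurableSet

lemma aemeasurable_metricDensity (g : SmoothMetric n M) (x : M) :
    AEMeasurable (fun y => ENNReal.ofReal (metricDensity g x y))
      (volume.restrict (chartR n x).target) :=
  ((contDiffOn_metricDensity g x).continuousOn.aemeasurable
    (chartR n x).open_target.measurableSet).ennreal_ofReal

lemma aemeasurable_chart_symm_density (g : SmoothMetric n M) (x : M) :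
    AEMeasurable (chartR n x).symm ((volume.restrict (chartR n x).target).withDensity
      fun y => ENNReal.ofReal (metricDensity g x y)) :=
  (aemeasurable_chart_symm x).mono_ac (withDensity_absolutelyContinuous _ _)

lemma lintegral_chartVolume (g : SmoothMetric n M) (x : M) {f : M → ℝ≥0∞} (hf : Measurable f) :
    ∫⁻ p, f p ∂chartVolume g x = ∫⁻ y in (chartR n x).target,
      ENNReal.ofReal (metricDensity g x y) * f ((chartR n x).symm y) := by
  rw [chartVolume, lintegral_map' hf.aemeasurable (aemeasurable_chart_symm_density g x),
    lintegral_withDensity_eq_lintegral_mul₀ (g := fun y => f ((chartR n x).symm y))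
      (aemeasurable_metricDensity g x) (hf.comp_aemeasurable (aemeasurable_chart_symm x))]
  rfl

lemma chartVolume_source_compl (g : SmoothMetric n M) (x : M) :
    chartVolume g x (chartR n x).sourceᶜ = 0 := by
  have hm : MeasurableSet ((chartR n x).sourceᶜ) := (chartR n x).open_source.measurableSet.compl
  rw [← lintegral_indicator_one hm, lintegral_chartVolume g x (measurable_one.indicator hm),
    setLIntegral_congr_fun (g := 0) (chartR n x).open_target.measurableSet]
  · simp
  · intro y hy
    have : (chartR n x).symm y ∈ (chartR n x).source := (chartR n x).map_target hy
    simp [this]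

/-- Change of variables: the Jacobian determinant is exactly the ratio of the densities. This is the
compatibility of the chart volumes. -/
lemma setLIntegral_overlap (g : SmoothMetric n M) (x x' : M) (f : M → ℝ≥0∞) :
    ∫⁻ y in overlap x x', ENNReal.ofReal (metricDensity g x y) * f ((chartR n x).symm y) =
      ∫⁻ y in overlap x' x, ENNReal.ofReal (metricDensity g x' y) * f ((chartR n x').symm y) := by
  have hm : MeasurableSet (overlap (n := n) x x') := (isOpen_overlap x x').measurableSet
  rw [← image_transition_overlap x x',
    lintegral_image_eq_lintegral_abs_det_fderiv_mul (μ := volume) hm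
      (fun y hy => (differentiableAt_transition hy).hasFDerivAt.hasFDerivWithinAt)]
  · refine setLIntegral_congr_fun hm fun y hy => ?_
    rw [symm_transition hy, metricDensity_eq_transition g hy, ENNReal.ofReal_mul (abs_nonneg _),
      mul_assoc]
  · intro y hy z hz h
    rw [← transition_transition hy, h, transition_transition hz]

lemma chartVolume_restrict_source (g : SmoothMetric n M) (x x' : M) :
    (chartVolume g x).restrict (chartR n x').source =
      (chartVolume g x').restrict (chartR n x).source := by
  have key : ∀ (x x' : M) (s : Set M), MeasurableSet s →
      (chartVolume g x).restrict (chartR n x').source s =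
        ∫⁻ y in overlap x x', ENNReal.ofReal (metricDensity g x y) *
          s.indicator 1 ((chartR n x).symm y) := by
    intro x x' s hs
    have hm' : MeasurableSet (chartR n x').source := (chartR n x').open_source.measurableSet
    have hm := hs.inter hm'
    rw [Measure.restrict_apply hs, ← lintegral_indicator_one hm,
      lintegral_chartVolume g x (measurable_one.indicator hm),
      ← lintegral_indicator (chartR n x).open_target.measurableSet,
      ← lintegral_indicator (isOpen_overlap x x').measurableSet]
    congr 1
    ext y
    by_cases h1 : y ∈ (chartR n x).target
    · by_cases h2 : (chartR n x).symm y ∈ (chartR n x').source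
      · have h3 : y ∈ overlap x x' := ⟨h1, h2⟩
        by_cases h4 : (chartR n x).symm y ∈ s <;> simp [h1, h2, h3, h4]
      · have h3 : y ∉ overlap x x' := fun h => h2 h.2
        simp [h1, h2, h3]
    · have h3 : y ∉ overlap x x' := fun h => h1 h.1
      simp [h1, h3]
  ext s hs
  rw [key x x' s hs, key x' x s hs, setLIntegral_overlap]

lemma riemannianVolume_restrict_source [CompactSpace M] (g : SmoothMetric n M) (x : M) :
    (riemannianVolume g).restrict (chartR n x).source = chartVolume g x := by
  obtain ⟨s, hs, hsu⟩ := countable_cover_nhds fun x : M => chart_source_mem_nhds (EuclideanSpace ℝ (Fin n)) x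
  have hne : s.Nonempty := by
    obtain ⟨y, hy, -⟩ := Set.mem_iUnion₂.1 (hsu.symm ▸ Set.mem_univ x : x ∈ ⋃ x ∈ s, _)
    exact ⟨y, hy⟩
  obtain ⟨f, rfl⟩ := hs.exists_eq_range hne
  refine restrict_iSup_of_compatible (chartVolume g) (fun x => (chartR n x).source)
    (fun x => (chartR n x).open_source.measurableSet) (chartVolume_source_compl g)
    (chartVolume_restrict_source g) f ?_ x
  simpa using hsu

lemma setLIntegral_source [CompactSpace M] (g : SmoothMetric n M) (x : M) {f : M → ℝ≥0∞}
    (hf : Measurable f) : ∫⁻ p in (chartR n x).source, f p ∂riemannianVolume g =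
      ∫⁻ y in (chartR n x).target,
        ENNReal.ofReal (metricDensity g x y) * f ((chartR n x).symm y) := by
  rw [riemannianVolume_restrict_source, lintegral_chartVolume g x hf]

lemma setIntegral_source [CompactSpace M] (g : SmoothMetric n M) (x : M) {f : M → ℂ}
    (hf : Measurable f) : ∫ p in (chartR n x).source, f p ∂riemannianVolume g =
      ∫ y in (chartR n x).target, (metricDensity g x y : ℂ) * f ((chartR n x).symm y) := by
  rw [riemannianVolume_restrict_source, chartVolume,
    integral_map (aemeasurable_chart_symm_density g x) hf.aestronglyMeasurable,
    integral_withDensity_eq_integral_toReal_smul₀ (aemeasurable_metricDensity g x)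
      (by simp)]
  refine setIntegral_congr_fun (chartR n x).open_target.measurableSet fun y hy => ?_
  rw [ENNReal.toReal_ofReal (metricDensity_pos g hy).le, Complex.real_smul]

instance [CompactSpace M] (g : SmoothMetric n M) : IsFiniteMeasure (riemannianVolume g) := by
  have : IsLocallyFiniteMeasure (riemannianVolume g) := by
    refine ⟨fun x => ?_⟩
    have hc : (chartR n x) x ∈ (chartR n x).target := mem_chart_target _ x
    obtain ⟨K, hK, hKt, hKc⟩ := local_compact_nhds ((chartR n x).open_target.mem_nhds hc)
    refine ⟨(chartR n x).source ∩ (chartR n x) ⁻¹' (interior K), ?_, ?_⟩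
    · refine IsOpen.mem_nhds ?_ ⟨mem_chart_source _ x, mem_interior_iff_mem_nhds.2 hK⟩
      exact (chartR n x).isOpen_inter_preimage isOpen_interior
    · set s := (chartR n x).source ∩ (chartR n x) ⁻¹' (interior K) with hs
      have hsm : MeasurableSet s :=
        ((chartR n x).isOpen_inter_preimage isOpen_interior).measurableSet
      have e1 : riemannianVolume g s = chartVolume g x s := by
        rw [← riemannianVolume_restrict_source, Measure.restrict_apply hsm,
          Set.inter_eq_left.2 Set.inter_subset_left]
      rw [e1, ← lintegral_indicator_one hsm,
        lintegral_chartVolume g x (measurable_one.indicator hsm)]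
      have hcont : ContinuousOn (metricDensity g x) K :=
        (contDiffOn_metricDensity g x).continuousOn.mono hKt
      have hfin : ∫⁻ y in K, ENNReal.ofReal (metricDensity g x y) < ⊤ :=
        (hcont.integrableOn_compact hKc).lintegral_lt_top
      refine lt_of_le_of_lt ?_ hfin
      rw [← lintegral_indicator (chartR n x).open_target.measurableSet,
        ← lintegral_indicator hKc.measurableSet]
      refine lintegral_mono fun y => ?_
      by_cases h1 : y ∈ (chartR n x).target
      · by_cases h2 : (chartR n x).symm y ∈ s
        · have h3 : y ∈ K := by
            have := interior_subset h2.2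
            rwa [(chartR n x).right_inv h1] at this
          simp [h1, h2, h3]
        · simp [h1, h2]
      · simp [h1]
  exact ⟨isCompact_univ.measure_lt_top⟩

/-- Needed so that a smooth function is determined by its class in `L²(M)`, which makes the
Laplacian on such classes single-valued. -/
instance [CompactSpace M] (g : SmoothMetric n M) : (riemannianVolume g).IsOpenPosMeasure := by
  refine ⟨fun U hU hne h0 => ?_⟩
  obtain ⟨x, hx⟩ := hne
  set O := (chartR n x).target ∩ (chartR n x).symm ⁻¹' U with hO
  have hOo : IsOpen O := (chartR n x).isOpen_inter_preimage_symm hU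
  have hOx : (chartR n x) x ∈ O := ⟨mem_chart_target _ x, by simpa using hx⟩
  have h1 : chartVolume g x U = 0 := by
    rw [← riemannianVolume_restrict_source]
    exact le_antisymm ((Measure.restrict_le_self U).trans h0.le) zero_le
  rw [← lintegral_indicator_one hU.measurableSet,
    lintegral_chartVolume g x (measurable_one.indicator hU.measurableSet)] at h1
  have hm : AEMeasurable (fun y => ENNReal.ofReal (metricDensity g x y) *
      U.indicator (1 : M → ℝ≥0∞) ((chartR n x).symm y)) (volume.restrict (chartR n x).target) :=
    (aemeasurable_metricDensity g x).mul
      ((measurable_one.indicator hU.measurableSet).comp_aemeasurable (aemeasurable_chart_symm x))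
  rw [lintegral_eq_zero_iff' hm, Filter.EventuallyEq,
    ae_restrict_iff' (chartR n x).open_target.measurableSet] at h1
  have h2 : ∀ᵐ y ∂(volume : Measure (EuclideanSpace ℝ (Fin n))), y ∉ O := by
    filter_upwards [h1] with y h hy
    have h3 := h hy.1
    have h4 : (chartR n x).symm y ∈ U := hy.2
    simp only [Pi.zero_apply, mul_eq_zero, ENNReal.ofReal_eq_zero, Set.indicator_of_mem h4,
      Pi.one_apply, one_ne_zero, or_false] at h3
    exact h3.not_gt (metricDensity_pos g hy.1)
  exact (hOo.measure_pos volume ⟨_, hOx⟩).ne' (measure_eq_zero_iff_ae_notMem.2 h2)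

end Volume

/-! ### Extension by zero and integration by parts with a compactly supported factor -/

section CompactlySupported

variable {E : Type*} [NormedAddCommGroup E] [NormedSpace ℝ E]

lemma contDiff_indicator_of_eq_zero {U K : Set E} (hU : IsOpen U) (hK : IsCompact K)
    (hKU : K ⊆ U) {h : E → ℂ} (hh : ContDiffOn ℝ ∞ h U) (h0 : ∀ y ∈ U, y ∉ K → h y = 0) :
    ContDiff ℝ ∞ (U.indicator h) ∧ tsupport (U.indicator h) ⊆ K ∧
      HasCompactSupport (U.indicator h) := by
  have hz : ∀ y ∉ K, U.indicator h y = 0 := fun y hy => by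
    by_cases hyU : y ∈ U
    · rw [Set.indicator_of_mem hyU, h0 y hyU hy]
    · rw [Set.indicator_of_notMem hyU]
  have hs : tsupport (U.indicator h) ⊆ K :=
    closure_minimal (fun y hy => by by_contra hyK; exact hy (hz y hyK)) hK.isClosed
  refine ⟨contDiff_iff_contDiffAt.2 fun y => ?_, hs, hK.of_isClosed_subset (isClosed_tsupport _) hs⟩
  by_cases hy : y ∈ U
  · refine (hh.contDiffAt (hU.mem_nhds hy)).congr_of_eventuallyEq ?_
    filter_upwards [hU.mem_nhds hy] with z hz
    exact Set.indicator_of_mem hz _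
  · refine (contDiffAt_const (c := (0 : ℂ))).congr_of_eventuallyEq ?_
    filter_upwards [hK.isClosed.isOpen_compl.mem_nhds fun h => hy (hKU h)] with z hzK
    exact hz z hzK

lemma continuous_mul_of_tsupport_subset {α : Type*} [TopologicalSpace α] {U : Set α}
    (hU : IsOpen U) {X h : α → ℂ} (hX : Continuous X) (hXU : tsupport X ⊆ U) (hh : ContinuousOn h U) :
    Continuous fun y => X y * h y := by
  refine continuous_of_tsupport fun y hy => ?_
  have hyU : y ∈ U := hXU (closure_mono (fun z hz => left_ne_zero_of_mul hz) hy)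
  exact hX.continuousAt.mul (hh.continuousAt (hU.mem_nhds hyU))

variable [MeasurableSpace E] [BorelSpace E] [FiniteDimensional ℝ E] (μ : Measure E)
  [μ.IsAddHaarMeasure]

lemma integrable_mul_of_tsupport_subset {U : Set E} (hU : IsOpen U) {X h : E → ℂ}
    (hX : Continuous X) (hXc : HasCompactSupport X) (hXU : tsupport X ⊆ U)
    (hh : ContinuousOn h U) : Integrable (fun y => X y * h y) μ :=
  (continuous_mul_of_tsupport_subset hU hX hXU hh).integrable_of_hasCompactSupport hXc.mul_right

/-- Only `X` has compact support; `G` may be arbitrary outside `U`, because every product vanishes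
there. -/
lemma integral_mul_fderiv_eq_neg_of_tsupport_subset {U : Set E} (hU : IsOpen U) {X G : E → ℂ}
    (hX : ContDiff ℝ ∞ X) (hXc : HasCompactSupport X) (hXU : tsupport X ⊆ U)
    (hG : ContDiffOn ℝ ∞ G U) (v : E) :
    ∫ y, X y * fderiv ℝ G y v ∂μ = -∫ y, fderiv ℝ X y v * G y ∂μ := by
  have hG' : ContinuousOn (fun y => fderiv ℝ G y v) U :=
    (hG.continuousOn_fderiv_of_isOpen hU (by simp)).clm_apply continuousOn_const
  have hX' : Continuous fun y => fderiv ℝ X y v :=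
    (hX.continuous_fderiv (by simp)).clm_apply continuous_const
  have hsub : tsupport (fun y => fderiv ℝ X y v) ⊆ tsupport X :=
    (tsupport_fderiv_apply_subset ℝ v)
  refine integral_mul_fderiv_eq_neg_fderiv_mul_of_integrable ?_ ?_ ?_ ?_ ?_
  · exact integrable_mul_of_tsupport_subset μ hU hX' (hXc.fderiv_apply ℝ v)
      (hsub.trans hXU) hG.continuousOn
  · exact integrable_mul_of_tsupport_subset μ hU hX.continuous hXc hXU hG'
  · exact integrable_mul_of_tsupport_subset μ hU hX.continuous hXc hXU hG.continuousOn
  · exact fun y _ => hX.differentiable (by simp) y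
  · exact fun y hy => (hG.contDiffAt (hU.mem_nhds (hXU hy))).differentiableAt (by simp)

end CompactlySupported

/-! ### Divergence form of the Laplacian and Green's formula in a chart -/

section Green

variable {n : ℕ} {M : Type*} [TopologicalSpace M] [ChartedSpace (EuclideanSpace ℝ (Fin n)) M]
  [IsManifold (𝓡 n) ∞ M]

/-- The Laplace–Beltrami operator in the chart around `x`. -/
def localLaplacian (g : SmoothMetric n M) (x : M) (F : EuclideanSpace ℝ (Fin n) → ℂ)
    (y : EuclideanSpace ℝ (Fin n)) : ℂ :=
  ∑ i : Fin n, ∑ j : Fin n,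
    (((metricMatrix g x y)⁻¹ i j : ℝ) * fderiv ℝ (fun z => fderiv ℝ F z (stdVec j)) y (stdVec i)
      + (((metricDensity g x y)⁻¹ *
          fderiv ℝ (fun z => metricDensity g x z * (metricMatrix g x z)⁻¹ i j) y (stdVec i) : ℝ) : ℂ)
        * fderiv ℝ F y (stdVec j))

lemma laplaceBeltrami_eq (g : SmoothMetric n M) (f : M → ℂ) (p : M) :
    laplaceBeltrami g f p = localLaplacian g p (inChart p f) (chartR n p p) := rfl

/-- The coefficients `|g|^{1/2} g^{ij}`. -/
def fluxCoeff (g : SmoothMetric n M) (x : M) (i j : Fin n) (y : EuclideanSpace ℝ (Fin n)) : ℝ :=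
  metricDensity g x y * (metricMatrix g x y)⁻¹ i j

lemma contDiffOn_fluxCoeff (g : SmoothMetric n M) (x : M) (i j : Fin n) :
    ContDiffOn ℝ ∞ (fluxCoeff g x i j) (chartR n x).target :=
  (contDiffOn_metricDensity g x).mul (contDiffOn_metricMatrix_inv g x i j)

lemma contDiffOn_fderiv_apply {F : EuclideanSpace ℝ (Fin n) → ℂ}
    {U : Set (EuclideanSpace ℝ (Fin n))} (hU : IsOpen U) (hF : ContDiffOn ℝ ∞ F U)
    (v : EuclideanSpace ℝ (Fin n)) : ContDiffOn ℝ ∞ (fun z => fderiv ℝ F z v) U :=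
  (hF.fderiv_of_isOpen hU (by simp)).clm_apply contDiffOn_const

lemma contDiffOn_flux (g : SmoothMetric n M) (x : M) (i j : Fin n)
    {F : EuclideanSpace ℝ (Fin n) → ℂ} {U : Set (EuclideanSpace ℝ (Fin n))} (hU : IsOpen U)
    (hUx : U ⊆ (chartR n x).target) (hF : ContDiffOn ℝ ∞ F U) :
    ContDiffOn ℝ ∞ (fun z => (fluxCoeff g x i j z : ℂ) * fderiv ℝ F z (stdVec j)) U :=
  (Complex.ofRealCLM.contDiff.comp_contDiffOn ((contDiffOn_fluxCoeff g x i j).mono hUx)).mul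
    (contDiffOn_fderiv_apply hU hF _)

/-- The product rule turns the expanded expression of the Laplacian into divergence form
`∂_i(|g|^{1/2} g^{ij} ∂_j F)`, which can be integrated by parts. -/
lemma density_mul_localLaplacian (g : SmoothMetric n M) (x : M)
    {F : EuclideanSpace ℝ (Fin n) → ℂ} {U : Set (EuclideanSpace ℝ (Fin n))} (hU : IsOpen U)
    (hUx : U ⊆ (chartR n x).target) (hF : ContDiffOn ℝ ∞ F U) {y : EuclideanSpace ℝ (Fin n)}
    (hy : y ∈ U) : (metricDensity g x y : ℂ) * localLaplacian g x F y =
      ∑ i, ∑ j, fderiv ℝ (fun z => (fluxCoeff g x i j z : ℂ) * fderiv ℝ F z (stdVec j)) y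
        (stdVec i) := by
  simp only [localLaplacian, Finset.mul_sum]
  refine Finset.sum_congr rfl fun i _ => Finset.sum_congr rfl fun j _ => ?_
  have h1 : DifferentiableAt ℝ (fluxCoeff g x i j) y :=
    ((contDiffOn_fluxCoeff g x i j).contDiffAt
      ((chartR n x).open_target.mem_nhds (hUx hy))).differentiableAt (by simp)
  have h1' : HasFDerivAt (fun z => (fluxCoeff g x i j z : ℂ))
      (Complex.ofRealCLM.comp (fderiv ℝ (fluxCoeff g x i j) y)) y :=
    Complex.ofRealCLM.hasFDerivAt.comp y h1.hasFDerivAt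
  have h2 : DifferentiableAt ℝ (fun z => fderiv ℝ F z (stdVec j)) y :=
    ((contDiffOn_fderiv_apply hU hF _).contDiffAt (hU.mem_nhds hy)).differentiableAt (by simp)
  have hρ : (metricDensity g x y : ℂ) ≠ 0 := by
    exact_mod_cast (metricDensity_pos g (hUx hy)).ne'
  have h3 : HasFDerivAt (fun z => (fluxCoeff g x i j z : ℂ) * fderiv ℝ F z (stdVec j)) _ y :=
    h1'.mul h2.hasFDerivAt
  rw [h3.fderiv]
  have e : fderiv ℝ (fun z => metricDensity g x z * (metricMatrix g x z)⁻¹ i j) y =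
    fderiv ℝ (fluxCoeff g x i j) y := rfl
  rw [e]
  simp only [add_apply, smul_apply, ContinuousLinearMap.comp_apply, Complex.ofRealCLM_apply,
    smul_eq_mul, fluxCoeff, Complex.ofReal_mul, Complex.ofReal_inv]
  field_simp

lemma continuousOn_localLaplacian (g : SmoothMetric n M) (x : M)
    {F : EuclideanSpace ℝ (Fin n) → ℂ} {U : Set (EuclideanSpace ℝ (Fin n))} (hU : IsOpen U)
    (hUx : U ⊆ (chartR n x).target) (hF : ContDiffOn ℝ ∞ F U) :
    ContinuousOn (localLaplacian g x F) U := by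
  have h : ContinuousOn (fun y => ((metricDensity g x y : ℂ))⁻¹ * ∑ i, ∑ j,
      fderiv ℝ (fun z => (fluxCoeff g x i j z : ℂ) * fderiv ℝ F z (stdVec j)) y (stdVec i)) U := by
    refine ContinuousOn.mul (ContinuousOn.inv₀ ?_ fun y hy => ?_) ?_
    · exact Complex.continuous_ofReal.comp_continuousOn
        ((contDiffOn_metricDensity g x).continuousOn.mono hUx)
    · exact_mod_cast (metricDensity_pos g (hUx hy)).ne'
    · refine continuousOn_finsetSum _ fun i _ => continuousOn_finsetSum _ fun j _ => ?_
      exact (contDiffOn_fderiv_apply hU (contDiffOn_flux g x i j hU hUx hF) _).continuousOn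
  refine h.congr fun y hy => ?_
  have hρ : (metricDensity g x y : ℂ) ≠ 0 := by
    exact_mod_cast (metricDensity_pos g (hUx hy)).ne'
  dsimp only
  rw [← density_mul_localLaplacian g x hU hUx hF hy, inv_mul_cancel_left₀ hρ]

lemma continuousOn_gradForm (g : SmoothMetric n M) (x : M)
    {F X : EuclideanSpace ℝ (Fin n) → ℂ} {U : Set (EuclideanSpace ℝ (Fin n))} (hU : IsOpen U)
    (hUx : U ⊆ (chartR n x).target) (hF : ContDiffOn ℝ ∞ F U) (hX : ContDiffOn ℝ ∞ X U) :
    ContinuousOn (gradForm g x F X) U := by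
  refine continuousOn_finsetSum _ fun i _ => continuousOn_finsetSum _ fun j _ => ?_
  refine ContinuousOn.mul (ContinuousOn.mul ?_ (contDiffOn_fderiv_apply hU hF _).continuousOn)
    (contDiffOn_fderiv_apply hU hX _).continuousOn
  exact Complex.continuous_ofReal.comp_continuousOn
        ((contDiffOn_metricMatrix_inv g x i j).continuousOn.mono hUx)

lemma integral_density_localLaplacian_mul (g : SmoothMetric n M) (x : M)
    {F X : EuclideanSpace ℝ (Fin n) → ℂ} {U : Set (EuclideanSpace ℝ (Fin n))} (hU : IsOpen U)
    (hUx : U ⊆ (chartR n x).target) (hF : ContDiffOn ℝ ∞ F U) (hX : ContDiff ℝ ∞ X)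
    (hXc : HasCompactSupport X) (hXU : tsupport X ⊆ U) :
    ∫ y in U, (metricDensity g x y : ℂ) * (localLaplacian g x F y * X y) =
      -∫ y in U, (metricDensity g x y : ℂ) * gradForm g x F X y := by
  have hX0 : ∀ y ∉ U, X y = 0 := fun y hy => image_eq_zero_of_notMem_tsupport fun h => hy (hXU h)
  have hX0' : ∀ y ∉ U, fderiv ℝ X y = 0 := fun y hy =>
    image_eq_zero_of_notMem_tsupport fun h => hy (hXU (tsupport_fderiv_subset ℝ h))
  have hflux := fun i j => contDiffOn_flux g x i j hU hUx hF
  have e1 : ∫ y in U, (metricDensity g x y : ℂ) * (localLaplacian g x F y * X y) =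
      ∫ y, ∑ i, ∑ j, X y * fderiv ℝ
        (fun z => (fluxCoeff g x i j z : ℂ) * fderiv ℝ F z (stdVec j)) y (stdVec i) := by
    refine Eq.trans ?_ (setIntegral_eq_integral_of_forall_compl_eq_zero (s := U)
      (fun y hy => by simp [hX0 y hy]))
    refine setIntegral_congr_fun hU.measurableSet fun y hy => ?_
    rw [← mul_assoc, density_mul_localLaplacian g x hU hUx hF hy, mul_comm]
    simp only [Finset.mul_sum]
  have e2 : ∫ y in U, (metricDensity g x y : ℂ) * gradForm g x F X y =
      ∫ y, ∑ i, ∑ j, fderiv ℝ X y (stdVec i) *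
        ((fluxCoeff g x i j y : ℂ) * fderiv ℝ F y (stdVec j)) := by
    refine Eq.trans ?_ (setIntegral_eq_integral_of_forall_compl_eq_zero (s := U)
      (fun y hy => by simp [hX0' y hy]))
    refine setIntegral_congr_fun hU.measurableSet fun y hy => ?_
    simp only [gradForm, Finset.mul_sum]
    -- Integration by parts puts the index `i` on `X`, whereas in `gradForm` it is on `F`; symmetry
    -- of `g⁻¹` reconciles the two.
    rw [Finset.sum_comm]
    refine Finset.sum_congr rfl fun i _ => Finset.sum_congr rfl fun j _ => ?_
    have hsymm : (metricMatrix g x y)⁻¹ j i = (metricMatrix g x y)⁻¹ i j := by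
      have := (posDef_metricMatrix g (hUx hy)).isHermitian.inv.apply i j
      simpa using this
    rw [hsymm, fluxCoeff]
    push_cast
    ring
  have hI1 : ∀ i j, Integrable (fun y => X y * fderiv ℝ
      (fun z => (fluxCoeff g x i j z : ℂ) * fderiv ℝ F z (stdVec j)) y (stdVec i)) volume :=
    fun i j => integrable_mul_of_tsupport_subset volume hU hX.continuous hXc hXU
      (contDiffOn_fderiv_apply hU (hflux i j) _).continuousOn
  have hI2 : ∀ i j, Integrable (fun y => fderiv ℝ X y (stdVec i) *
      ((fluxCoeff g x i j y : ℂ) * fderiv ℝ F y (stdVec j))) volume :=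
    fun i j => integrable_mul_of_tsupport_subset volume hU
      ((hX.continuous_fderiv (by simp)).clm_apply continuous_const) (hXc.fderiv_apply ℝ _)
      ((tsupport_fderiv_apply_subset ℝ _).trans hXU) (hflux i j).continuousOn
  rw [e1, e2, integral_finsetSum _ fun i _ => integrable_finsetSum _ fun j _ => hI1 i j,
    integral_finsetSum _ fun i _ => integrable_finsetSum _ fun j _ => hI2 i j,
    ← Finset.sum_neg_distrib]
  refine Finset.sum_congr rfl fun i _ => ?_
  rw [integral_finsetSum _ fun j _ => hI1 i j, integral_finsetSum _ fun j _ => hI2 i j,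
    ← Finset.sum_neg_distrib]
  exact Finset.sum_congr rfl fun j _ =>
    integral_mul_fderiv_eq_neg_of_tsupport_subset volume hU hX hXc hXU (hflux i j) _

end Green

/-! ### Independence of the chart for the Laplacian and for the gradient product -/

section ChartInvariance

variable {n : ℕ} {M : Type*} [TopologicalSpace M] [ChartedSpace (EuclideanSpace ℝ (Fin n)) M]
  [IsManifold (𝓡 n) ∞ M]

lemma contDiffOn_inChart (x : M) {f : M → ℂ} (hf : IsSmoothFun n f) :
    ContDiffOn ℝ ∞ (inChart (n := n) x f) (chartR n x).target :=
  (hf.comp_contMDiffOn (contMDiffOn_chart_symm (I := 𝓡 n) (n := ∞) (x := x))).contDiffOn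

lemma overlap_subset_target (x x' : M) : overlap (n := n) x x' ⊆ (chartR n x).target :=
  Set.inter_subset_left

lemma setIntegral_overlap (g : SmoothMetric n M) (x x' : M) (f : EuclideanSpace ℝ (Fin n) → ℂ) :
    ∫ y in overlap x x', (metricDensity g x y : ℂ) * f (transition x x' y) =
      ∫ y in overlap x' x, (metricDensity g x' y : ℂ) * f y := by
  have hm : MeasurableSet (overlap (n := n) x x') := (isOpen_overlap x x').measurableSet
  rw [← image_transition_overlap x x', integral_image_eq_integral_abs_det_fderiv_smul volume hm
      (fun y hy => (differentiableAt_transition hy).hasFDerivAt.hasFDerivWithinAt)]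
  · refine setIntegral_congr_fun hm fun y hy => ?_
    simp only [metricDensity_eq_transition g hy, Complex.real_smul, Complex.ofReal_mul, mul_assoc]
  · intro y hy z hz h
    rw [← transition_transition hy, h, transition_transition hz]

/-- A weak argument avoids transforming second derivatives. Tested against functions supported in
the overlap, both sides become, by Green's formula, integrals of the gradient form, which is
invariant together with the volume. The fundamental lemma of the calculus of variations and
continuity then give pointwise equality. -/
lemma localLaplacian_transition (g : SmoothMetric n M) {x x' : M} {f : M → ℂ}
    (hf : IsSmoothFun n f) {y : EuclideanSpace ℝ (Fin n)} (hy : y ∈ overlap x x') :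
    localLaplacian g x (inChart x f) y =
      localLaplacian g x' (inChart x' f) (transition x x' y) := by
  set U := overlap (n := n) x x' with hUdef
  set U' := overlap (n := n) x' x with hUdef'
  set T := transition (n := n) x x' with hT
  set T' := transition (n := n) x' x with hT'
  have hU : IsOpen U := isOpen_overlap x x'
  have hU' : IsOpen U' := isOpen_overlap x' x
  have hF : ContDiffOn ℝ ∞ (inChart x f) U :=
    (contDiffOn_inChart x hf).mono (overlap_subset_target x x')
  have hF' : ContDiffOn ℝ ∞ (inChart x' f) U' :=
    (contDiffOn_inChart x' hf).mono (overlap_subset_target x' x)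
  have hTc : ContinuousOn T U := (contDiffOn_transition x x').continuousOn
  have hTm : Set.MapsTo T U U' := fun z hz => transition_mem_overlap hz
  have hL : ContinuousOn (localLaplacian g x (inChart x f)) U :=
    continuousOn_localLaplacian g x hU (overlap_subset_target x x') hF
  have hL' : ContinuousOn (fun z => localLaplacian g x' (inChart x' f) (T z)) U :=
    (continuousOn_localLaplacian g x' hU' (overlap_subset_target x' x) hF').comp hTc hTm
  have hρ : ContinuousOn (fun z => (metricDensity g x z : ℂ)) U :=
    Complex.continuous_ofReal.comp_continuousOn
      ((contDiffOn_metricDensity g x).continuousOn.mono (overlap_subset_target x x'))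
  set h : EuclideanSpace ℝ (Fin n) → ℂ := fun z => (metricDensity g x z : ℂ) *
    (localLaplacian g x (inChart x f) z - localLaplacian g x' (inChart x' f) (T z)) with hh
  have hhc : ContinuousOn h U := hρ.mul (hL.sub hL')
  have key : ∀ᵐ z ∂(volume : Measure (EuclideanSpace ℝ (Fin n))), z ∈ U → h z = 0 := by
    refine hU.ae_eq_zero_of_integral_contDiff_smul_eq_zero
      (hhc.locallyIntegrableOn hU.measurableSet) fun X hX hXc hXU => ?_
    set Y : EuclideanSpace ℝ (Fin n) → ℂ := fun z => (X z : ℂ) with hYdef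
    have hY : ContDiff ℝ ∞ Y := Complex.ofRealCLM.contDiff.comp hX
    have hYs : tsupport Y ⊆ tsupport X := closure_mono fun z hz hz0 => hz (by simp [hYdef, hz0])
    have hYc : HasCompactSupport Y := hXc.of_isClosed_subset (isClosed_tsupport _) hYs
    have hYU : tsupport Y ⊆ U := hYs.trans hXU
    have hK : IsCompact (T '' tsupport Y) := hYc.isCompact.image_of_continuousOn (hTc.mono hYU)
    have hKU : T '' tsupport Y ⊆ U' := by
      rintro _ ⟨z, hz, rfl⟩; exact hTm (hYU hz)
    -- `Z` is the test function transported to the other chart and extended by zero.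
    obtain ⟨hZ, hZs, hZc⟩ := contDiff_indicator_of_eq_zero hU' hK hKU (h := Y ∘ T')
      (hY.comp_contDiffOn (contDiffOn_transition x' x)) (fun z hz hzK => by
        by_contra h0
        exact hzK ⟨T' z, subset_tsupport _ h0, transition_transition hz⟩)
    set Z := U'.indicator (Y ∘ T') with hZdef
    have hZT : ∀ z ∈ U, Z (T z) = Y z := fun z hz => by
      rw [hZdef, Set.indicator_of_mem (hTm hz), Function.comp_apply, hT, hT',
        transition_transition hz]
    have e1 : ∫ z, X z • h z = ∫ z in U, ((metricDensity g x z : ℂ) *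
        (localLaplacian g x (inChart x f) z * Y z) - (metricDensity g x z : ℂ) *
          (localLaplacian g x' (inChart x' f) (T z) * Z (T z))) := by
      refine Eq.trans (setIntegral_eq_integral_of_forall_compl_eq_zero (s := U) fun z hz => ?_).symm
        (setIntegral_congr_fun hU.measurableSet fun z hz => ?_)
      · rw [image_eq_zero_of_notMem_tsupport fun h' => hz (hXU h'), zero_smul]
      · simp only [hZT z hz, hh, hYdef, Complex.real_smul]
        ring
    have hI : ∀ {P : EuclideanSpace ℝ (Fin n) → ℂ}, ContinuousOn P U →
        IntegrableOn (fun z => (metricDensity g x z : ℂ) * (P z * Y z)) U := fun hP =>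
      (integrable_mul_of_tsupport_subset volume hU hY.continuous hYc hYU
        (hρ.mul hP)).integrableOn.congr_fun (fun z _ => by simp only [Pi.mul_apply]; ring) hU.measurableSet
    have hI2 : IntegrableOn (fun z => (metricDensity g x z : ℂ) *
        (localLaplacian g x' (inChart x' f) (T z) * Z (T z))) U :=
      (hI hL').congr_fun (fun z hz => by simp only [hZT z hz]) hU.measurableSet
    rw [e1, integral_sub (hI hL) hI2,
      setIntegral_overlap g x x' fun z => localLaplacian g x' (inChart x' f) z * Z z,
      integral_density_localLaplacian_mul g x hU (overlap_subset_target x x') hF hY hYc hYU,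
      integral_density_localLaplacian_mul g x' hU' (overlap_subset_target x' x) hF' hZ hZc
        (hZs.trans hKU), ← setIntegral_overlap g x x' fun z => gradForm g x' (inChart x' f) Z z,
      sub_neg_eq_add, neg_add_eq_zero]
    refine setIntegral_congr_fun hU.measurableSet fun z hz => ?_
    have hz' := hTm hz
    rw [← gradForm_comp_transition g hz
      ((hF'.contDiffAt (hU'.mem_nhds hz')).differentiableAt (by simp))
      (hZ.differentiable (by simp) _)]
    congr 1
    refine gradForm_congr g x (inChart_eq_comp hz f) ?_
    filter_upwards [hU.mem_nhds hz] with w hw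
    exact (hZT w hw).symm
  -- Continuous functions agreeing almost everywhere on an open set agree everywhere on it.
  have h0 : Set.EqOn h 0 U := by
    refine Measure.eqOn_open_of_ae_eq (μ := volume) ?_ hU hhc continuousOn_const
    rw [Filter.EventuallyEq, ae_restrict_iff' hU.measurableSet]
    exact key
  have h1 := h0 hy
  have hρ0 : (metricDensity g x y : ℂ) ≠ 0 := by
    exact_mod_cast (metricDensity_pos g hy.1).ne'
  exact sub_eq_zero.1 ((mul_eq_zero.1 h1).resolve_left hρ0)

/-- The definition uses at each point the chart around that point. Invariance allows one fixed chart
on a whole neighbourhood, which continuity and integration require. -/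
lemma laplaceBeltrami_symm (g : SmoothMetric n M) (x : M) {f : M → ℂ} (hf : IsSmoothFun n f)
    {y : EuclideanSpace ℝ (Fin n)} (hy : y ∈ (chartR n x).target) :
    laplaceBeltrami g f ((chartR n x).symm y) = localLaplacian g x (inChart x f) y := by
  rw [laplaceBeltrami_eq]
  exact (localLaplacian_transition g hf ⟨hy, mem_chart_source _ _⟩).symm

lemma laplaceBeltrami_of_mem_source (g : SmoothMetric n M) (x : M) {f : M → ℂ}
    (hf : IsSmoothFun n f) {p : M} (hp : p ∈ (chartR n x).source) :
    laplaceBeltrami g f p = localLaplacian g x (inChart x f) (chartR n x p) := by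
  rw [← laplaceBeltrami_symm g x hf ((chartR n x).map_source hp), (chartR n x).left_inv hp]

lemma continuous_laplaceBeltrami (g : SmoothMetric n M) {f : M → ℂ} (hf : IsSmoothFun n f) :
    Continuous (laplaceBeltrami g f) := by
  refine continuous_iff_continuousAt.2 fun p => ?_
  have hs := (chartR n p).open_source.mem_nhds (mem_chart_source _ p)
  refine ContinuousAt.congr ?_ (eventually_of_mem hs fun q hq =>
    (laplaceBeltrami_of_mem_source g p hf hq).symm)
  exact (((continuousOn_localLaplacian g p (chartR n p).open_target subset_rfl
    (contDiffOn_inChart p hf)).comp (chartR n p).continuousOn (chartR n p).mapsTo).continuousAt hs)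

/-- The complex bilinear extension of the inner product of the gradients of two functions. -/
def gradProd (g : SmoothMetric n M) (f h : M → ℂ) (p : M) : ℂ :=
  gradForm g p (inChart p f) (inChart p h) (chartR n p p)

lemma gradProd_symm (g : SmoothMetric n M) (x : M) {f h : M → ℂ} (hf : IsSmoothFun n f)
    (hh : IsSmoothFun n h) {y : EuclideanSpace ℝ (Fin n)} (hy : y ∈ (chartR n x).target) :
    gradProd g f h ((chartR n x).symm y) = gradForm g x (inChart x f) (inChart x h) y := by
  set p := (chartR n x).symm y
  have hyo : y ∈ overlap x p := ⟨hy, mem_chart_source _ _⟩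
  have hd : ∀ {f : M → ℂ}, IsSmoothFun n f →
      DifferentiableAt ℝ (inChart (n := n) p f) (transition x p y) := fun hf =>
    ((contDiffOn_inChart p hf).contDiffAt ((chartR n p).open_target.mem_nhds
      (transition_mem_target hyo))).differentiableAt (by simp)
  rw [gradForm_congr g x (inChart_eq_comp hyo f) (inChart_eq_comp hyo h),
    gradForm_comp_transition g hyo (hd hf) (hd hh)]
  rfl

lemma gradProd_of_mem_source (g : SmoothMetric n M) (x : M) {f h : M → ℂ} (hf : IsSmoothFun n f)
    (hh : IsSmoothFun n h) {p : M} (hp : p ∈ (chartR n x).source) :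
    gradProd g f h p = gradForm g x (inChart x f) (inChart x h) (chartR n x p) := by
  rw [← gradProd_symm g x hf hh ((chartR n x).map_source hp), (chartR n x).left_inv hp]

lemma continuous_gradProd (g : SmoothMetric n M) {f h : M → ℂ} (hf : IsSmoothFun n f)
    (hh : IsSmoothFun n h) : Continuous (gradProd g f h) := by
  refine continuous_iff_continuousAt.2 fun p => ?_
  have hs := (chartR n p).open_source.mem_nhds (mem_chart_source _ p)
  refine ContinuousAt.congr ?_ (eventually_of_mem hs fun q hq =>
    (gradProd_of_mem_source g p hf hh hq).symm)
  exact (((continuousOn_gradForm g p (chartR n p).open_target subset_rfl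
    (contDiffOn_inChart p hf) (contDiffOn_inChart p hh)).comp
      (chartR n p).continuousOn (chartR n p).mapsTo).continuousAt hs)

lemma differentiableAt_inChart (p : M) {f : M → ℂ} (hf : IsSmoothFun n f) :
    DifferentiableAt ℝ (inChart (n := n) p f) (chartR n p p) :=
  (contDiffAt_inChart p hf).differentiableAt (by simp)

lemma gradProd_add_right (g : SmoothMetric n M) (f : M → ℂ) {h k : M → ℂ} (hh : IsSmoothFun n h)
    (hk : IsSmoothFun n k) (p : M) : gradProd g f (h + k) p = gradProd g f h p + gradProd g f k p := by
  have e : inChart (n := n) p (h + k) = inChart p h + inChart p k := rfl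
  simp only [gradProd, gradForm, e, fderiv_add (differentiableAt_inChart p hh)
    (differentiableAt_inChart p hk), add_apply, mul_add, Finset.sum_add_distrib]

lemma gradProd_zero_right (g : SmoothMetric n M) (f : M → ℂ) (p : M) : gradProd g f 0 p = 0 := by
  have e : inChart (n := n) p 0 = fun _ => 0 := rfl
  simp [gradProd, gradForm, e]

lemma isSmoothFun_sum {ι : Type*} (s : Finset ι) {h : ι → M → ℂ}
    (hh : ∀ i ∈ s, IsSmoothFun n (h i)) : IsSmoothFun n (∑ i ∈ s, h i) :=
  contMDiff_finsetSum' hh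

lemma gradProd_sum_right (g : SmoothMetric n M) (f : M → ℂ) {ι : Type*} (s : Finset ι)
    {h : ι → M → ℂ} (hh : ∀ i ∈ s, IsSmoothFun n (h i)) (p : M) :
    gradProd g f (∑ i ∈ s, h i) p = ∑ i ∈ s, gradProd g f (h i) p := by
  classical
  induction s using Finset.induction_on with
  | empty => exact gradProd_zero_right g f p
  | insert a s ha ih =>
    rw [Finset.sum_insert ha, Finset.sum_insert ha, gradProd_add_right g f
      (hh a (Finset.mem_insert_self a s)) (isSmoothFun_sum s fun i hi =>
        hh i (Finset.mem_insert_of_mem hi)), ih fun i hi => hh i (Finset.mem_insert_of_mem hi)]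

lemma gradProd_eq_zero_of_notMem_tsupport (g : SmoothMetric n M) (f : M → ℂ) {h : M → ℂ} {p : M}
    (hp : p ∉ tsupport h) : gradProd g f h p = 0 := by
  have hc : ContinuousAt (chartR n p).symm (chartR n p p) :=
    (chartR n p).continuousAt_symm (mem_chart_target _ p)
  have e : inChart (n := n) p h =ᶠ[𝓝 (chartR n p p)] fun _ => 0 := by
    have h1 : (tsupport h)ᶜ ∈ 𝓝 ((chartR n p).symm (chartR n p p)) := by
      rw [(chartR n p).left_inv (mem_chart_source _ p)]
      exact (isClosed_tsupport h).isOpen_compl.mem_nhds hp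
    filter_upwards [hc.preimage_mem_nhds h1] with z hz
    exact image_eq_zero_of_notMem_tsupport (f := h) hz
  simp [gradProd, gradForm, e.fderiv_eq]

end ChartInvariance

/-! ### Green's formula on the manifold by a partition of unity -/

section ManifoldGreen

variable {n : ℕ} {M : Type*} [TopologicalSpace M] [ChartedSpace (EuclideanSpace ℝ (Fin n)) M]

/-- The expression in the chart around `x` of a function supported in the domain of that chart,
extended by zero to the whole space. -/
def localRep (x : M) (h : M → ℂ) : EuclideanSpace ℝ (Fin n) → ℂ :=
  (chartR n x).target.indicator (inChart x h)

variable [IsManifold (𝓡 n) ∞ M] [CompactSpace M]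

lemma localRep_properties (x : M) {h : M → ℂ} (hh : IsSmoothFun n h)
    (hs : tsupport h ⊆ (chartR n x).source) : ContDiff ℝ ∞ (localRep (n := n) x h) ∧
      tsupport (localRep (n := n) x h) ⊆ chartR n x '' tsupport h ∧
      HasCompactSupport (localRep (n := n) x h) := by
  have hK : IsCompact (chartR n x '' tsupport h) :=
    (isClosed_tsupport h).isCompact.image_of_continuousOn ((chartR n x).continuousOn.mono hs)
  refine contDiff_indicator_of_eq_zero (chartR n x).open_target hK ?_ (contDiffOn_inChart x hh) ?_
  · rintro _ ⟨p, hp, rfl⟩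
    exact (chartR n x).map_source (hs hp)
  · intro y hy hyK
    by_contra h0
    exact hyK ⟨_, subset_tsupport _ h0, (chartR n x).right_inv hy⟩

lemma image_tsupport_subset_target (x : M) {h : M → ℂ} (hs : tsupport h ⊆ (chartR n x).source) :
    chartR n x '' tsupport h ⊆ (chartR n x).target := by
  rintro _ ⟨p, hp, rfl⟩
  exact (chartR n x).map_source (hs hp)

lemma localRep_eventuallyEq (x : M) (h : M → ℂ) {y : EuclideanSpace ℝ (Fin n)}
    (hy : y ∈ (chartR n x).target) : localRep (n := n) x h =ᶠ[𝓝 y] inChart x h := by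
  filter_upwards [(chartR n x).open_target.mem_nhds hy] with z hz
  exact Set.indicator_of_mem hz _

variable [MeasurableSpace M] [BorelSpace M]

lemma integral_laplaceBeltrami_mul_of_tsupport_subset (g : SmoothMetric n M) (x : M) {f h : M → ℂ}
    (hf : IsSmoothFun n f) (hh : IsSmoothFun n h) (hs : tsupport h ⊆ (chartR n x).source) :
    ∫ p, laplaceBeltrami g f p * h p ∂riemannianVolume g =
      -∫ p, gradProd g f h p ∂riemannianVolume g := by
  obtain ⟨hX, hXs, hXc⟩ := localRep_properties x hh hs
  have h0 : ∀ p ∉ (chartR n x).source, h p = 0 := fun p hp =>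
    image_eq_zero_of_notMem_tsupport fun h' => hp (hs h')
  have ht := (chartR n x).open_target.measurableSet
  rw [← setIntegral_eq_integral_of_forall_compl_eq_zero (s := (chartR n x).source)
      (f := fun p => laplaceBeltrami g f p * h p) (fun p hp => by simp [h0 p hp]),
    ← setIntegral_eq_integral_of_forall_compl_eq_zero (s := (chartR n x).source)
      (f := gradProd g f h)
      (fun p hp => gradProd_eq_zero_of_notMem_tsupport g f fun h' => hp (hs h')),
    setIntegral_source g x (f := fun p => laplaceBeltrami g f p * h p)
      ((continuous_laplaceBeltrami g hf).mul hh.continuous).measurable,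
    setIntegral_source g x (continuous_gradProd g hf hh).measurable]
  have hG := integral_density_localLaplacian_mul g x (chartR n x).open_target subset_rfl
    (contDiffOn_inChart x hf) hX hXc (hXs.trans (image_tsupport_subset_target x hs))
  refine Eq.trans ?_ (hG.trans (congrArg Neg.neg ?_))
  · refine setIntegral_congr_fun ht fun y hy => ?_
    rw [laplaceBeltrami_symm g x hf hy, (localRep_eventuallyEq x h hy).self_of_nhds]
    rfl
  · refine setIntegral_congr_fun ht fun y hy => ?_
    rw [gradProd_symm g x hf hh hy,
      gradForm_congr g x (EventuallyEq.refl _ _) (localRep_eventuallyEq x h hy)]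

variable [T2Space M]

/-- On a compact manifold a locally finite partition of unity has only finitely many nonzero
members. -/
lemma exists_smooth_partition (n : ℕ) (M : Type*) [TopologicalSpace M] [CompactSpace M] [T2Space M]
    [ChartedSpace (EuclideanSpace ℝ (Fin n)) M] [IsManifold (𝓡 n) ∞ M] :
    ∃ (t : Finset M) (χ : M → M → ℝ),
      (∀ x, ContMDiff (𝓡 n) 𝓘(ℝ, ℝ) ∞ (χ x)) ∧ (∀ x, tsupport (χ x) ⊆ (chartR n x).source) ∧
      ∀ p, ∑ x ∈ t, χ x p = 1 := by
  obtain ⟨f, hf⟩ := SmoothPartitionOfUnity.exists_isSubordinate_chartAt_source (𝓡 n) M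
  have hfin := f.locallyFinite.finite_nonempty_of_compact
  refine ⟨hfin.toFinset, fun x => f x, fun x => (f x).contMDiff, hf, fun p => ?_⟩
  rw [← f.sum_eq_one (Set.mem_univ p), finsum_eq_sum_of_support_subset]
  intro x hx
  simp only [Set.Finite.coe_toFinset, Set.mem_ofPred_eq]
  exact ⟨p, hx⟩

lemma isSmoothFun_ofReal {χ : M → ℝ} (hχ : ContMDiff (𝓡 n) 𝓘(ℝ, ℝ) ∞ χ) :
    IsSmoothFun n fun p => (χ p : ℂ) :=
  Complex.ofRealCLM.contDiff.contMDiff.comp hχ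

lemma isSmoothFun_mul {f h : M → ℂ} (hf : IsSmoothFun n f) (hh : IsSmoothFun n h) :
    IsSmoothFun n fun p => f p * h p := by
  intro p
  exact (contDiff_mul (𝕜 := ℝ) (𝔸 := ℂ)).contMDiff.contMDiffAt.comp p
    ((hf p).prodMk_space (hh p))

lemma tsupport_ofReal_mul_subset (χ : M → ℝ) (h : M → ℂ) :
    tsupport (fun p => (χ p : ℂ) * h p) ⊆ tsupport χ :=
  closure_mono fun p hp h0 => hp (by simp [h0])

lemma Continuous.integrable_riemannianVolume (g : SmoothMetric n M) {f : M → ℂ}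
    (hf : Continuous f) : Integrable f (riemannianVolume g) :=
  hf.integrable_of_hasCompactSupport (HasCompactSupport.of_compactSpace f)

/-- Green's formula. -/
theorem integral_laplaceBeltrami_mul (g : SmoothMetric n M) {f h : M → ℂ}
    (hf : IsSmoothFun n f) (hh : IsSmoothFun n h) :
    ∫ p, laplaceBeltrami g f p * h p ∂riemannianVolume g =
      -∫ p, gradProd g f h p ∂riemannianVolume g := by
  obtain ⟨t, χ, hχ, hχs, hχ1⟩ := exists_smooth_partition n M
  have hk : ∀ x, IsSmoothFun n fun p => (χ x p : ℂ) * h p := fun x =>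
    isSmoothFun_mul (isSmoothFun_ofReal (hχ x)) hh
  -- Only `h` is cut up; both sides are additive in `h`, so no derivatives of the cutoffs have to be
  -- tracked.
  have e : h = ∑ x ∈ t, fun p => (χ x p : ℂ) * h p := by
    ext p
    rw [Finset.sum_apply, ← Finset.sum_mul, ← Complex.ofReal_sum, hχ1 p]
    simp
  have e1 : (fun p => laplaceBeltrami g f p * h p) =
      fun p => ∑ x ∈ t, laplaceBeltrami g f p * ((χ x p : ℂ) * h p) := by
    ext p
    conv_lhs => rw [e]
    rw [Finset.sum_apply, Finset.mul_sum]
  have e2 : gradProd g f h = fun p => ∑ x ∈ t, gradProd g f (fun p => (χ x p : ℂ) * h p) p := by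
    ext p
    conv_lhs => rw [e]
    rw [gradProd_sum_right g f t fun x _ => hk x]
  rw [e1, e2, integral_finsetSum, integral_finsetSum, ← Finset.sum_neg_distrib]
  · exact Finset.sum_congr rfl fun x _ => integral_laplaceBeltrami_mul_of_tsupport_subset g x hf
      (hk x) ((tsupport_ofReal_mul_subset _ _).trans (hχs x))
  · exact fun x _ => Continuous.integrable_riemannianVolume g (continuous_gradProd g hf (hk x))
  · exact fun x _ => Continuous.integrable_riemannianVolume g
      ((continuous_laplaceBeltrami g hf).mul (hk x).continuous)

end ManifoldGreen

/-! ### Complex conjugation, positivity of the gradient form, and comparison with Euclidean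
gradients -/

section Conjugation

variable {n : ℕ} {M : Type*} [TopologicalSpace M] [ChartedSpace (EuclideanSpace ℝ (Fin n)) M]

/-- The complex conjugate of a function. -/
def conjFun {α : Type*} (f : α → ℂ) : α → ℂ := fun p => conj (f p)

lemma isSmoothFun_conjFun {f : M → ℂ} (hf : IsSmoothFun n f) : IsSmoothFun n (conjFun f) :=
  Complex.conjCLE.contDiff.contMDiff.comp hf

lemma conjFun_conjFun {α : Type*} (f : α → ℂ) : conjFun (conjFun f) = f := by
  ext p; simp [conjFun]

lemma inChart_conjFun (x : M) (f : M → ℂ) :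
    inChart (n := n) x (conjFun f) = conjFun (inChart x f) := rfl

lemma fderiv_conjFun {E : Type*} [NormedAddCommGroup E] [NormedSpace ℝ E] (F : E → ℂ) (y v : E) :
    fderiv ℝ (conjFun F) y v = conj (fderiv ℝ F y v) := by
  have e : conjFun F = Complex.conjCLE ∘ F := rfl
  rw [e, ContinuousLinearEquiv.comp_fderiv]
  rfl

variable [IsManifold (𝓡 n) ∞ M]

lemma laplaceBeltrami_conjFun (g : SmoothMetric n M) (f : M → ℂ) (p : M) :
    laplaceBeltrami g (conjFun f) p = conj (laplaceBeltrami g f p) := by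
  have e : ∀ (j : Fin n) (y v : EuclideanSpace ℝ (Fin n)),
      fderiv ℝ (fun z => conj (fderiv ℝ (inChart (n := n) p f) z (stdVec j))) y v =
        conj (fderiv ℝ (fun z => fderiv ℝ (inChart p f) z (stdVec j)) y v) :=
    fun j y v => fderiv_conjFun _ y v
  simp only [laplaceBeltrami, inChart_conjFun, e, fderiv_conjFun, map_sum, map_add, map_mul,
    Complex.conj_ofReal]

lemma metricMatrix_inv_symm (g : SmoothMetric n M) {x : M} {y : EuclideanSpace ℝ (Fin n)}
    (hy : y ∈ (chartR n x).target) (i j : Fin n) :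
    (metricMatrix g x y)⁻¹ j i = (metricMatrix g x y)⁻¹ i j := by
  have := (posDef_metricMatrix g hy).isHermitian.inv.apply i j
  simpa using this

lemma gradForm_comm (g : SmoothMetric n M) {x : M} (F X : EuclideanSpace ℝ (Fin n) → ℂ)
    {y : EuclideanSpace ℝ (Fin n)} (hy : y ∈ (chartR n x).target) :
    gradForm g x F X y = gradForm g x X F y := by
  rw [gradForm, gradForm, Finset.sum_comm]
  refine Finset.sum_congr rfl fun i _ => Finset.sum_congr rfl fun j _ => ?_
  rw [metricMatrix_inv_symm g hy]
  ring

lemma gradProd_comm (g : SmoothMetric n M) (f h : M → ℂ) (p : M) :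
    gradProd g f h p = gradProd g h f p :=
  gradForm_comm g _ _ (mem_chart_target _ p)

/-- The real quadratic form of the inverse of the metric in the chart around `x`. -/
def cometric (g : SmoothMetric n M) (x : M) (y v : EuclideanSpace ℝ (Fin n)) : ℝ :=
  ∑ i, ∑ j, (metricMatrix g x y)⁻¹ i j * v i * v j

lemma cometric_pos (g : SmoothMetric n M) {x : M} {y v : EuclideanSpace ℝ (Fin n)}
    (hy : y ∈ (chartR n x).target) (hv : v ≠ 0) : 0 < cometric g x y v := by
  have h := (posDef_metricMatrix g hy).inv.dotProduct_mulVec_pos (x := v.ofLp)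
    (fun h => hv (by ext i; exact congrFun h i))
  refine h.trans_eq ?_
  simp only [cometric, dotProduct, Matrix.mulVec, Finset.mul_sum, star_trivial]
  refine Finset.sum_congr rfl fun i _ => Finset.sum_congr rfl fun j _ => ?_
  ring

lemma cometric_nonneg (g : SmoothMetric n M) {x : M} {y : EuclideanSpace ℝ (Fin n)}
    (hy : y ∈ (chartR n x).target) (v : EuclideanSpace ℝ (Fin n)) : 0 ≤ cometric g x y v := by
  by_cases hv : v = 0
  · simp [hv, cometric]
  · exact (cometric_pos g hy hv).le

lemma cometric_smul (g : SmoothMetric n M) (x : M) (y v : EuclideanSpace ℝ (Fin n)) (t : ℝ) :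
    cometric g x y (t • v) = t ^ 2 * cometric g x y v := by
  simp only [cometric, Finset.mul_sum, PiLp.smul_apply, smul_eq_mul]
  refine Finset.sum_congr rfl fun i _ => Finset.sum_congr rfl fun j _ => ?_
  ring

/-- A positive minimum exists on the compact set of points of `K` and unit vectors; homogeneity
extends the bound to all vectors. -/
lemma exists_le_cometric (g : SmoothMetric n M) (x : M) {K : Set (EuclideanSpace ℝ (Fin n))}
    (hK : IsCompact K) (hKx : K ⊆ (chartR n x).target) :
    ∃ c : ℝ, 0 < c ∧ ∀ y ∈ K, ∀ v, c * ‖v‖ ^ 2 ≤ cometric g x y v := by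
  have hc : ContinuousOn (fun q : EuclideanSpace ℝ (Fin n) × EuclideanSpace ℝ (Fin n) =>
      cometric g x q.1 q.2) (K ×ˢ Metric.sphere 0 1) := by
    refine continuousOn_finsetSum _ fun i _ => continuousOn_finsetSum _ fun j _ => ?_
    refine ContinuousOn.mul (ContinuousOn.mul ?_ ?_) ?_
    · exact ((contDiffOn_metricMatrix_inv g x i j).continuousOn.mono hKx).comp continuousOn_fst
        fun q hq => hq.1
    · exact (by fun_prop : Continuous fun q : EuclideanSpace ℝ (Fin n) ×
        EuclideanSpace ℝ (Fin n) => q.2 i).continuousOn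
    · exact (by fun_prop : Continuous fun q : EuclideanSpace ℝ (Fin n) ×
        EuclideanSpace ℝ (Fin n) => q.2 j).continuousOn
  obtain ⟨c, hc0, hcl⟩ := (hK.prod (isCompact_sphere 0 1)).exists_forall_le' hc (a := 0)
    fun q hq => cometric_pos g (hKx hq.1) fun h0 => by
      have := hq.2
      simp [h0] at this
  refine ⟨c, hc0, fun y hy v => ?_⟩
  by_cases hv : v = 0
  · simp [hv, cometric]
  have hn : ‖v‖ ≠ 0 := norm_ne_zero_iff.2 hv
  have h1 := hcl (y, ‖v‖⁻¹ • v) ⟨hy, by simp [norm_smul, hn]⟩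
  have h2 : v = ‖v‖ • (‖v‖⁻¹ • v) := by rw [smul_smul, mul_inv_cancel₀ hn, one_smul]
  conv_rhs => rw [h2]
  rw [cometric_smul, mul_comm]
  exact mul_le_mul_of_nonneg_left h1 (sq_nonneg _)

/-- Splitting the differential into real and imaginary parts, the mixed terms cancel by symmetry of
the inverse metric. -/
lemma gradForm_conjFun_self (g : SmoothMetric n M) {x : M} (F : EuclideanSpace ℝ (Fin n) → ℂ)
    {y : EuclideanSpace ℝ (Fin n)} (hy : y ∈ (chartR n x).target) :
    gradForm g x (conjFun F) F y =
      (cometric g x y (WithLp.toLp 2 fun i => (fderiv ℝ F y (stdVec i)).re) +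
        cometric g x y (WithLp.toLp 2 fun i => (fderiv ℝ F y (stdVec i)).im) : ℝ) := by
  have key : ∀ a b : Fin n → ℝ,
      ∑ i, ∑ j, ((metricMatrix g x y)⁻¹ i j : ℂ) * (a i - b i * Complex.I) *
        (a j + b j * Complex.I) =
      ((∑ i, ∑ j, (metricMatrix g x y)⁻¹ i j * a i * a j +
        ∑ i, ∑ j, (metricMatrix g x y)⁻¹ i j * b i * b j : ℝ) : ℂ) := by
    intro a b
    have h0 : ∑ i, ∑ j, ((metricMatrix g x y)⁻¹ i j : ℂ) * (a i * b j) =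
        ∑ i, ∑ j, ((metricMatrix g x y)⁻¹ i j : ℂ) * (b i * a j) := by
      rw [Finset.sum_comm]
      refine Finset.sum_congr rfl fun i _ => Finset.sum_congr rfl fun j _ => ?_
      rw [metricMatrix_inv_symm g hy]; ring
    have h1 : ∀ i j, ((metricMatrix g x y)⁻¹ i j : ℂ) * (a i - b i * Complex.I) *
        (a j + b j * Complex.I) = (metricMatrix g x y)⁻¹ i j * a i * a j +
          (metricMatrix g x y)⁻¹ i j * b i * b j +
          Complex.I * ((metricMatrix g x y)⁻¹ i j * (a i * b j)) -
          Complex.I * ((metricMatrix g x y)⁻¹ i j * (b i * a j)) := fun i j => by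
      linear_combination (-((metricMatrix g x y)⁻¹ i j : ℂ) * b i * b j) * Complex.I_sq
    simp only [h1, Finset.sum_add_distrib, Finset.sum_sub_distrib, ← Finset.mul_sum, h0]
    push_cast
    ring
  have hz : ∀ z : ℂ, conj z = z.re - z.im * Complex.I := fun z => by
    apply Complex.ext <;> simp
  have := key (fun i => (fderiv ℝ F y (stdVec i)).re) fun i => (fderiv ℝ F y (stdVec i)).im
  simp only [Complex.re_add_im, ← hz] at this
  simpa only [gradForm, fderiv_conjFun, cometric] using this

/-- The operator norm is at most the Hilbert–Schmidt norm. -/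
lemma norm_fderiv_sq_le (F : EuclideanSpace ℝ (Fin n) → ℂ) (y : EuclideanSpace ℝ (Fin n)) :
    ‖fderiv ℝ F y‖ ^ 2 ≤ ‖(WithLp.toLp 2 fun i => (fderiv ℝ F y (stdVec i)).re :
        EuclideanSpace ℝ (Fin n))‖ ^ 2 +
      ‖(WithLp.toLp 2 fun i => (fderiv ℝ F y (stdVec i)).im : EuclideanSpace ℝ (Fin n))‖ ^ 2 := by
  set L := fderiv ℝ F y
  have e : ‖(WithLp.toLp 2 fun i => (L (stdVec i)).re : EuclideanSpace ℝ (Fin n))‖ ^ 2 +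
      ‖(WithLp.toLp 2 fun i => (L (stdVec i)).im : EuclideanSpace ℝ (Fin n))‖ ^ 2 =
      ∑ i, ‖L (stdVec i)‖ ^ 2 := by
    simp only [EuclideanSpace.norm_sq_eq, ← Finset.sum_add_distrib, Real.norm_eq_abs, sq_abs]
    refine Finset.sum_congr rfl fun i _ => ?_
    rw [← Complex.normSq_eq_norm_sq, Complex.normSq_apply]
    ring
  rw [e]
  have hle : ‖L‖ ≤ √(∑ i, ‖L (stdVec i)‖ ^ 2) := by
    refine L.opNorm_le_bound (Real.sqrt_nonneg _) fun v => ?_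
    refine Real.le_sqrt_of_sq_le ?_ |>.trans_eq (Real.sqrt_mul
      (Finset.sum_nonneg fun i _ => sq_nonneg _) (‖v‖ ^ 2)) |>.trans_eq (by
        rw [Real.sqrt_sq (norm_nonneg v)])
    conv_lhs => rw [eq_sum_stdVec v]
    rw [map_sum]
    have h1 : ‖∑ i, L (v i • stdVec i)‖ ≤ ∑ i, ‖L (stdVec i)‖ * ‖v i‖ :=
      (norm_sum_le _ _).trans_eq (Finset.sum_congr rfl fun i _ => by
        rw [map_smul, norm_smul, mul_comm])
    refine (pow_le_pow_left₀ (norm_nonneg _) h1 2).trans ?_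
    rw [EuclideanSpace.norm_sq_eq v]
    exact Finset.sum_mul_sq_le_sq_mul_sq _ _ _
  calc ‖L‖ ^ 2 ≤ √(∑ i, ‖L (stdVec i)‖ ^ 2) ^ 2 := pow_le_pow_left₀ (norm_nonneg _) hle 2
    _ = _ := Real.sq_sqrt (Finset.sum_nonneg fun i _ => sq_nonneg _)

/-- The squared length of the gradient. -/
def gradSq (g : SmoothMetric n M) (f : M → ℂ) (p : M) : ℝ := (gradProd g (conjFun f) f p).re

lemma gradSq_nonneg (g : SmoothMetric n M) (f : M → ℂ) (p : M) : 0 ≤ gradSq g f p := by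
  rw [gradSq, gradProd, inChart_conjFun, gradForm_conjFun_self g _ (mem_chart_target _ p),
    Complex.ofReal_re]
  exact add_nonneg (cometric_nonneg g (mem_chart_target _ p) _)
    (cometric_nonneg g (mem_chart_target _ p) _)

lemma gradProd_conjFun_self (g : SmoothMetric n M) (f : M → ℂ) (p : M) :
    gradProd g (conjFun f) f p = gradSq g f p := by
  rw [gradSq, gradProd, inChart_conjFun, gradForm_conjFun_self g _ (mem_chart_target _ p),
    Complex.ofReal_re]

lemma continuous_gradSq (g : SmoothMetric n M) {f : M → ℂ} (hf : IsSmoothFun n f) :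
    Continuous (gradSq g f) :=
  Complex.continuous_re.comp (continuous_gradProd g (isSmoothFun_conjFun hf) hf)

lemma exists_norm_fderiv_sq_le (g : SmoothMetric n M) (x : M)
    {K : Set (EuclideanSpace ℝ (Fin n))} (hK : IsCompact K) (hKx : K ⊆ (chartR n x).target) :
    ∃ C : ℝ, 0 < C ∧ ∀ f : M → ℂ, IsSmoothFun n f → ∀ y ∈ K,
      ‖fderiv ℝ (inChart (n := n) x f) y‖ ^ 2 ≤ C * gradSq g f ((chartR n x).symm y) := by
  obtain ⟨c, hc, hcl⟩ := exists_le_cometric g x hK hKx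
  refine ⟨c⁻¹, inv_pos.2 hc, fun f hf y hy => ?_⟩
  rw [gradSq, gradProd_symm g x (isSmoothFun_conjFun hf) hf (hKx hy), inChart_conjFun,
    gradForm_conjFun_self g _ (hKx hy), Complex.ofReal_re, le_inv_mul_iff₀ hc]
  refine (mul_le_mul_of_nonneg_left (norm_fderiv_sq_le _ y) hc.le).trans ?_
  rw [mul_add]
  exact add_le_add (hcl y hy _) (hcl y hy _)

end Conjugation

/-! ### The Laplacian on smooth functions as a densely defined nonnegative symmetric operator -/

section SmoothLaplacian

variable {n : ℕ} {M : Type*} [TopologicalSpace M] [ChartedSpace (EuclideanSpace ℝ (Fin n)) M]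
  [IsManifold (𝓡 n) ∞ M] [CompactSpace M] [MeasurableSpace M] [BorelSpace M]

lemma Continuous.memLp_riemannianVolume {F : Type*} [NormedAddCommGroup F] [SecondCountableTopology F]
    (g : SmoothMetric n M) {f : M → F} (hf : Continuous f)
    (p : ℝ≥0∞) : MemLp f p (riemannianVolume g) := by
  obtain ⟨C, hC⟩ := (isCompact_range hf).isBounded.exists_norm_le
  have hm : AEStronglyMeasurable f (riemannianVolume g) :=
    hf.aestronglyMeasurable
  exact MemLp.of_bound hm C (Eventually.of_forall fun p => hC _ ⟨p, rfl⟩)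

lemma eq_of_ae_eq_of_isSmoothFun (g : SmoothMetric n M) {φ ψ : M → ℂ} (hφ : IsSmoothFun n φ)
    (hψ : IsSmoothFun n ψ) (h : φ =ᵐ[riemannianVolume g] ψ) : φ = ψ :=
  (hφ.continuous.ae_eq_iff_eq _ hψ.continuous).1 h

/-- Well-definedness: a smooth representative of the zero class vanishes identically, hence so does
its Laplacian. -/
lemma smoothLaplacian_graph (g : SmoothMetric n M) :
    (smoothLaplacian g).graph = smoothLaplacianGraph g := by
  refine Submodule.toLinearPMap_graph_eq _ ?_
  rintro ⟨u, f⟩ ⟨φ, hφ, hu, hf⟩ (rfl : u = 0)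
  have h0 : φ = 0 := eq_of_ae_eq_of_isSmoothFun g hφ contMDiff_const
    (hu.symm.trans (Lp.coeFn_zero _ _ _))
  have h1 : ∀ p, laplaceBeltrami g φ p = 0 := fun p => by
    have h := laplaceBeltrami_smul g 0 hφ p
    rwa [zero_smul, zero_mul, ← h0] at h
  refine Lp.ext (hf.trans (EventuallyEq.trans ?_ (Lp.coeFn_zero _ _ _).symm))
  exact Eventually.of_forall fun p => by simp [h1]

lemma mem_graph_smoothLaplacian (g : SmoothMetric n M) (u f : L2 g) :
    (u, f) ∈ (smoothLaplacian g).graph ↔ ∃ φ : M → ℂ, IsSmoothFun n φ ∧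
      u =ᵐ[riemannianVolume g] φ ∧ f =ᵐ[riemannianVolume g] fun p => -laplaceBeltrami g φ p := by
  rw [smoothLaplacian_graph]; rfl

lemma exists_rep_of_mem_domain (g : SmoothMetric n M) (u : (smoothLaplacian g).domain) :
    ∃ φ : M → ℂ, IsSmoothFun n φ ∧ (u : L2 g) =ᵐ[riemannianVolume g] φ ∧
      smoothLaplacian g u =ᵐ[riemannianVolume g] fun p => -laplaceBeltrami g φ p :=
  (mem_graph_smoothLaplacian g _ _).1 ((smoothLaplacian g).mem_graph u)

lemma exists_mem_domain (g : SmoothMetric n M) {φ : M → ℂ} (hφ : IsSmoothFun n φ) :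
    ∃ u : (smoothLaplacian g).domain, (u : L2 g) =ᵐ[riemannianVolume g] φ ∧
      smoothLaplacian g u =ᵐ[riemannianVolume g] fun p => -laplaceBeltrami g φ p := by
  have h1 := hφ.continuous.memLp_riemannianVolume g 2
  have h2 := (continuous_laplaceBeltrami g hφ).neg.memLp_riemannianVolume g 2
  have hm : (h1.toLp φ, h2.toLp _) ∈ (smoothLaplacian g).graph :=
    (mem_graph_smoothLaplacian g _ _).2 ⟨φ, hφ, h1.coeFn_toLp, h2.coeFn_toLp⟩
  obtain ⟨u, hu1, hu2⟩ := (LinearPMap.mem_graph_iff _).1 hm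
  simp only at hu1 hu2
  exact ⟨u, hu1 ▸ h1.coeFn_toLp, hu2 ▸ h2.coeFn_toLp⟩

lemma smoothLaplacian_domain (g : SmoothMetric n M) : (smoothLaplacian g).domain = smoothL2 g := by
  ext u
  constructor
  · intro hu
    obtain ⟨φ, hφ, h, -⟩ := exists_rep_of_mem_domain g ⟨u, hu⟩
    exact ⟨φ, hφ, h⟩
  · rintro ⟨φ, hφ, h⟩
    obtain ⟨v, hv, -⟩ := exists_mem_domain g hφ
    have : u = v := Lp.ext (h.trans hv.symm)
    exact this ▸ v.2

variable [T2Space M]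

lemma inner_smoothLaplacian (g : SmoothMetric n M) {v f : L2 g} {φ ψ : M → ℂ}
    (hφ : IsSmoothFun n φ) (hψ : IsSmoothFun n ψ) (hv : v =ᵐ[riemannianVolume g] ψ)
    (hf : f =ᵐ[riemannianVolume g] fun p => -laplaceBeltrami g φ p) :
    ⟪v, f⟫_ℂ = ∫ p, gradProd g (conjFun ψ) φ p ∂riemannianVolume g := by
  rw [L2.inner_def]
  have e : ∫ p, ⟪v p, f p⟫_ℂ ∂riemannianVolume g =
      ∫ p, -(laplaceBeltrami g φ p * conjFun ψ p) ∂riemannianVolume g := by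
    refine integral_congr_ae ?_
    filter_upwards [hv, hf] with p h1 h2
    rw [h1, h2, RCLike.inner_apply, conjFun]
    ring
  rw [e, integral_neg, integral_laplaceBeltrami_mul g hφ (isSmoothFun_conjFun hψ), neg_neg]
  exact integral_congr_ae (Eventually.of_forall fun p => gradProd_comm g _ _ p)

lemma conj_gradProd (g : SmoothMetric n M) (f h : M → ℂ) (p : M) :
    conj (gradProd g f h p) = gradProd g (conjFun f) (conjFun h) p := by
  simp only [gradProd, gradForm, inChart_conjFun, fderiv_conjFun, map_sum, map_mul,
    Complex.conj_ofReal]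

lemma isNonnegSymm_smoothLaplacian (g : SmoothMetric n M) : IsNonnegSymm (smoothLaplacian g) := by
  constructor
  · intro u v
    obtain ⟨φ, hφ, hu, hTu⟩ := exists_rep_of_mem_domain g u
    obtain ⟨ψ, hψ, hv, hTv⟩ := exists_rep_of_mem_domain g v
    rw [← inner_conj_symm, inner_smoothLaplacian g hφ hψ hv hTu,
      inner_smoothLaplacian g hψ hφ hu hTv, ← integral_conj]
    refine integral_congr_ae (Eventually.of_forall fun p => ?_)
    simp only
    rw [conj_gradProd, conjFun_conjFun, gradProd_comm]
  · intro u
    obtain ⟨φ, hφ, hu, hTu⟩ := exists_rep_of_mem_domain g u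
    rw [inner_smoothLaplacian g hφ hφ hu hTu]
    simp only [gradProd_conjFun_self]
    rw [integral_complex_ofReal, Complex.ofReal_re]
    exact integral_nonneg fun p => gradSq_nonneg g φ p

lemma inner_smoothLaplacian_self (g : SmoothMetric n M) {u f : L2 g} {φ : M → ℂ}
    (hφ : IsSmoothFun n φ) (hu : u =ᵐ[riemannianVolume g] φ)
    (hf : f =ᵐ[riemannianVolume g] fun p => -laplaceBeltrami g φ p) :
    (⟪u, f⟫_ℂ).re = ∫ p, gradSq g φ p ∂riemannianVolume g := by
  rw [inner_smoothLaplacian g hφ hφ hu hf]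
  simp only [gradProd_conjFun_self]
  rw [integral_complex_ofReal, Complex.ofReal_re]

/-- A vector orthogonal to all smooth functions integrates to zero against smooth real functions, so
it vanishes by the fundamental lemma. -/
lemma dense_smoothL2 (g : SmoothMetric n M) : Dense (smoothL2 g : Set (L2 g)) := by
  rw [Submodule.dense_iff_topologicalClosure_eq_top, Submodule.topologicalClosure_eq_top_iff,
    Submodule.eq_bot_iff]
  intro u hu
  have hint : Integrable u (riemannianVolume g) := (Lp.memLp u).integrable (by norm_num)
  refine Lp.ext (EventuallyEq.trans ?_ (Lp.coeFn_zero _ _ _).symm)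
  refine ae_eq_zero_of_integral_contMDiff_smul_eq_zero (𝓡 n) hint.locallyIntegrable
    fun χ hχ _ => ?_
  have hφ : IsSmoothFun n fun p => (χ p : ℂ) := isSmoothFun_ofReal hχ
  have h1 := hφ.continuous.memLp_riemannianVolume g 2
  have h2 := (Submodule.mem_orthogonal _ _).1 hu (h1.toLp _) ⟨_, hφ, h1.coeFn_toLp⟩
  rw [L2.inner_def] at h2
  rw [← h2]
  refine integral_congr_ae ?_
  filter_upwards [h1.coeFn_toLp] with p hp
  rw [hp, RCLike.inner_apply, Complex.conj_ofReal, Complex.real_smul, mul_comm]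

end SmoothLaplacian

/-! ### The Sobolev inequality for smooth functions, localized in charts -/

section LocalEnergy

variable {n : ℕ} {M : Type*} [TopologicalSpace M] [ChartedSpace (EuclideanSpace ℝ (Fin n)) M]
  [IsManifold (𝓡 n) ∞ M] [CompactSpace M] [T2Space M] [MeasurableSpace M]
  [BorelSpace M]

/-- The squared norm of a smooth function in the form domain of the Laplacian. -/
def sobolevEnergy (g : SmoothMetric n M) (φ : M → ℂ) : ℝ≥0∞ :=
  ∫⁻ p, ENNReal.ofReal (gradSq g φ p + ‖φ p‖ ^ 2) ∂riemannianVolume g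

lemma setLIntegral_target_le (g : SmoothMetric n M) (x : M) {f : M → ℝ≥0∞} (hf : Measurable f) :
    ∫⁻ y in (chartR n x).target, ENNReal.ofReal (metricDensity g x y) * f ((chartR n x).symm y) ≤
      ∫⁻ p, f p ∂riemannianVolume g := by
  rw [← setLIntegral_source g x hf]
  exact setLIntegral_le_lintegral _ _

lemma enorm_sq_eq_ofReal {F : Type*} [NormedAddCommGroup F] (a : F) :
    ‖a‖ₑ ^ 2 = ENNReal.ofReal (‖a‖ ^ 2) := by
  rw [ENNReal.ofReal_pow (norm_nonneg _), ofReal_norm]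

variable {x : M} {χ : M → ℝ}

lemma isCompact_image_tsupport (hs : tsupport χ ⊆ (chartR n x).source) :
    IsCompact (chartR n x '' tsupport χ) :=
  (isClosed_tsupport χ).isCompact.image_of_continuousOn ((chartR n x).continuousOn.mono hs)

lemma image_tsupport_subset (hs : tsupport χ ⊆ (chartR n x).source) :
    chartR n x '' tsupport χ ⊆ (chartR n x).target := by
  rintro _ ⟨p, hp, rfl⟩
  exact (chartR n x).map_source (hs hp)

lemma localRep_cutoff_properties (hχ : ContMDiff (𝓡 n) 𝓘(ℝ, ℝ) ∞ χ)
    (hs : tsupport χ ⊆ (chartR n x).source) {φ : M → ℂ} (hφ : IsSmoothFun n φ) :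
    ContDiff ℝ ∞ (localRep (n := n) x fun p => (χ p : ℂ) * φ p) ∧
      tsupport (localRep (n := n) x fun p => (χ p : ℂ) * φ p) ⊆ chartR n x '' tsupport χ ∧
      HasCompactSupport (localRep (n := n) x fun p => (χ p : ℂ) * φ p) := by
  have h := tsupport_ofReal_mul_subset χ φ
  obtain ⟨h1, h2, h3⟩ := localRep_properties (n := n) x
    (isSmoothFun_mul (isSmoothFun_ofReal hχ) hφ) (h.trans hs)
  exact ⟨h1, h2.trans (Set.image_mono h), h3⟩

lemma exists_pos_le_metricDensity (g : SmoothMetric n M) (x : M)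
    {K : Set (EuclideanSpace ℝ (Fin n))} (hK : IsCompact K) (hKx : K ⊆ (chartR n x).target) :
    ∃ c : ℝ, 0 < c ∧ ∀ y ∈ K, c ≤ metricDensity g x y :=
  hK.exists_forall_le' ((contDiffOn_metricDensity g x).continuousOn.mono hKx)
    fun _ hy => metricDensity_pos g (hKx hy)

/-- The product rule, with every coefficient bounded on the compact image of the support of the
cutoff: the cutoff and its gradient from above, the cometric and the density from below. -/
lemma exists_local_energy_le (g : SmoothMetric n M) (hχ : ContMDiff (𝓡 n) 𝓘(ℝ, ℝ) ∞ χ)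
    (hs : tsupport χ ⊆ (chartR n x).source) : ∃ C : NNReal, ∀ φ : M → ℂ, IsSmoothFun n φ →
      (∫⁻ y, ‖fderiv ℝ (localRep (n := n) x fun p => (χ p : ℂ) * φ p) y‖ₑ ^ 2) +
        ∫⁻ y, ‖localRep (n := n) x (fun p => (χ p : ℂ) * φ p) y‖ₑ ^ 2 ≤ C * sobolevEnergy g φ := by
  have hK := isCompact_image_tsupport hs
  have hKt := image_tsupport_subset hs
  set K := chartR n x '' tsupport χ with hKdef
  obtain ⟨C₁, hC₁, hgrad⟩ := exists_norm_fderiv_sq_le g x hK hKt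
  obtain ⟨c, hc, hρ⟩ := exists_pos_le_metricDensity g x hK hKt
  have hχC := isSmoothFun_ofReal hχ
  obtain ⟨hX, -, hXc⟩ := localRep_properties (n := n) x hχC
    ((closure_mono fun p hp h0 => hp (by simp [h0]) :
      tsupport (fun p => (χ p : ℂ)) ⊆ tsupport χ).trans hs)
  set X := localRep (n := n) x fun p => (χ p : ℂ) with hXdef
  obtain ⟨A, hA⟩ := hX.continuous.bounded_above_of_compact_support hXc
  obtain ⟨B, hB⟩ := (hX.continuous_fderiv (by simp)).bounded_above_of_compact_support (hXc.fderiv ℝ)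
  have hA0 : 0 ≤ A := (norm_nonneg _).trans (hA 0)
  have hB0 : 0 ≤ B := (norm_nonneg _).trans (hB 0)
  -- With `|χ| ≤ A`, `|∇χ| ≤ B` and `|∇φ|² ≤ C₁ gradSq`: the first summand comes from `χ∇φ`, and
  -- `2B² + A²` from `φ∇χ` and `χφ`. Dividing by the lower bound `c` of the density passes to the
  -- Riemannian volume.
  set C₂ : ℝ := 2 * A ^ 2 * C₁ + (2 * B ^ 2 + A ^ 2) with hC₂
  have hC₂0 : 0 ≤ C₂ := by positivity
  refine ⟨(C₂ / c).toNNReal, fun φ hφ => ?_⟩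
  obtain ⟨hw, hwK, hwc⟩ := localRep_cutoff_properties hχ hs hφ
  set w := localRep (n := n) x fun p => (χ p : ℂ) * φ p with hwdef
  have hm : Measurable fun y => ‖fderiv ℝ w y‖ₑ ^ 2 :=
    (hw.continuous_fderiv (by simp)).enorm.measurable.pow_const _
  rw [← lintegral_add_left hm]
  have hme : Measurable fun p => ENNReal.ofReal (gradSq g φ p + ‖φ p‖ ^ 2) :=
    ((continuous_gradSq g hφ).add (hφ.continuous.norm.pow 2)).measurable.ennreal_ofReal
  refine le_trans ?_ (mul_le_mul_right (setLIntegral_target_le g x hme) _)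
  rw [← lintegral_const_mul' _ _ ENNReal.coe_ne_top,
    ← lintegral_indicator (chartR n x).open_target.measurableSet]
  refine lintegral_mono fun y => ?_
  by_cases hy : y ∈ K
  · rw [Set.indicator_of_mem (hKt hy), enorm_sq_eq_ofReal, enorm_sq_eq_ofReal,
      ← ENNReal.ofReal_add (sq_nonneg _) (sq_nonneg _),
      ← ENNReal.ofReal_mul (metricDensity_pos g (hKt hy)).le, ← ENNReal.ofReal_coe_nnreal,
      Real.coe_toNNReal _ (div_nonneg hC₂0 hc.le), ← ENNReal.ofReal_mul (div_nonneg hC₂0 hc.le)]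
    refine ENNReal.ofReal_le_ofReal ?_
    have hΦ : DifferentiableAt ℝ (inChart (n := n) x φ) y :=
      ((contDiffOn_inChart x hφ).contDiffAt ((chartR n x).open_target.mem_nhds
        (hKt hy))).differentiableAt (by simp)
    have he : w =ᶠ[𝓝 y] fun z => X z * inChart x φ z := by
      filter_upwards [(chartR n x).open_target.mem_nhds (hKt hy)] with z hz
      rw [hwdef, hXdef, localRep, localRep, Set.indicator_of_mem hz, Set.indicator_of_mem hz]
      rfl
    have hd : fderiv ℝ w y = X y • fderiv ℝ (inChart x φ) y + inChart x φ y • fderiv ℝ X y := by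
      rw [he.fderiv_eq]
      exact ((hX.differentiable (by simp) y).hasFDerivAt.mul hΦ.hasFDerivAt).fderiv
    have h1 : ‖fderiv ℝ w y‖ ≤ A * ‖fderiv ℝ (inChart x φ) y‖ + B * ‖inChart x φ y‖ := by
      rw [hd]
      refine (norm_add_le _ _).trans ?_
      rw [norm_smul, norm_smul, mul_comm B]
      exact add_le_add (mul_le_mul_of_nonneg_right (hA y) (norm_nonneg _))
        (mul_le_mul_of_nonneg_left (hB y) (norm_nonneg _))
    have h2 : ‖w y‖ ≤ A * ‖inChart x φ y‖ := by
      rw [he.self_of_nhds, norm_mul]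
      exact mul_le_mul_of_nonneg_right (hA y) (norm_nonneg _)
    have h3 : ‖inChart x φ y‖ = ‖φ ((chartR n x).symm y)‖ := rfl
    have h4 := hgrad φ hφ y hy
    have h5 := gradSq_nonneg g φ ((chartR n x).symm y)
    rw [h3] at h1 h2
    set G := gradSq g φ ((chartR n x).symm y)
    set N := ‖φ ((chartR n x).symm y)‖
    set D := ‖fderiv ℝ (inChart x φ) y‖
    have h6 : ‖fderiv ℝ w y‖ ^ 2 ≤ 2 * A ^ 2 * D ^ 2 + 2 * B ^ 2 * N ^ 2 := by
      refine (pow_le_pow_left₀ (norm_nonneg _) h1 2).trans ?_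
      nlinarith [sq_nonneg (A * D - B * N)]
    have h7 : ‖w y‖ ^ 2 ≤ A ^ 2 * N ^ 2 := by
      rw [← mul_pow]; exact pow_le_pow_left₀ (norm_nonneg _) h2 2
    have h8 : ‖fderiv ℝ w y‖ ^ 2 + ‖w y‖ ^ 2 ≤ C₂ * (G + N ^ 2) := by
      have h9 : 2 * A ^ 2 * D ^ 2 ≤ 2 * A ^ 2 * (C₁ * G) :=
        mul_le_mul_of_nonneg_left h4 (by positivity)
      have h10 : 0 ≤ (2 * B ^ 2 + A ^ 2) * G := by positivity
      have h11 : 0 ≤ 2 * A ^ 2 * C₁ * N ^ 2 := by positivity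
      rw [hC₂]
      linarith
    refine h8.trans ?_
    have h12 : 1 ≤ c⁻¹ * metricDensity g x y := by
      rw [inv_mul_eq_div, one_le_div hc]; exact hρ y hy
    have h13 : 0 ≤ C₂ * (G + N ^ 2) := mul_nonneg hC₂0 (by positivity)
    calc C₂ * (G + N ^ 2) ≤ (C₂ * (G + N ^ 2)) * (c⁻¹ * metricDensity g x y) :=
          le_mul_of_one_le_right h13 h12
      _ = C₂ / c * (metricDensity g x y * (G + N ^ 2)) := by ring
  · have h0 : y ∉ tsupport w := fun h => hy (hwK h)
    have h1 : fderiv ℝ w y = 0 :=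
      image_eq_zero_of_notMem_tsupport fun h => h0 (tsupport_fderiv_subset ℝ h)
    have h2 : ‖fderiv ℝ w y‖ₑ ^ 2 = 0 := by rw [enorm_sq_eq_ofReal, h1, norm_zero]; simp
    simp [h2, image_eq_zero_of_notMem_tsupport h0]

/-- The density is bounded above on the support of the cutoff. The exponent is left free because
both `2` (compactness) and `2n/(n-2)` (Sobolev) are used. -/
lemma exists_lintegral_cutoff_le (g : SmoothMetric n M) (hχ : ContMDiff (𝓡 n) 𝓘(ℝ, ℝ) ∞ χ)
    (hs : tsupport χ ⊆ (chartR n x).source) : ∃ D : NNReal, ∀ φ : M → ℂ, IsSmoothFun n φ →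
      ∀ r : ℝ, 0 < r → ∫⁻ p, ‖(χ p : ℂ) * φ p‖ₑ ^ r ∂riemannianVolume g ≤
        D * ∫⁻ y, ‖localRep (n := n) x (fun p => (χ p : ℂ) * φ p) y‖ₑ ^ r := by
  have hK := isCompact_image_tsupport hs
  have hKt := image_tsupport_subset hs
  set K := chartR n x '' tsupport χ with hKdef
  obtain ⟨D, hD⟩ := hK.exists_bound_of_continuousOn
    ((contDiffOn_metricDensity g x).continuousOn.mono hKt)
  refine ⟨D.toNNReal, fun φ hφ r hr => ?_⟩
  have hψ := isSmoothFun_mul (isSmoothFun_ofReal hχ) hφ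
  have h0 : Function.support (fun p => ‖(χ p : ℂ) * φ p‖ₑ ^ r) ⊆ (chartR n x).source := by
    intro p hp
    by_contra hps
    refine hp ?_
    have : χ p = 0 := image_eq_zero_of_notMem_tsupport fun h => hps (hs h)
    simp [this, hr]
  rw [← setLIntegral_eq_of_support_subset h0,
    setLIntegral_source g x (f := fun p => ‖(χ p : ℂ) * φ p‖ₑ ^ r)
      (hψ.continuous.enorm.measurable.pow_const _), ← lintegral_const_mul' _ _ ENNReal.coe_ne_top,
    ← lintegral_indicator (chartR n x).open_target.measurableSet]
  refine lintegral_mono fun y => ?_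
  by_cases hy : y ∈ (chartR n x).target
  · rw [Set.indicator_of_mem hy, localRep, Set.indicator_of_mem hy]
    by_cases hyK : y ∈ K
    · refine mul_le_mul_left ?_ _
      exact ENNReal.ofReal_le_ofReal ((le_abs_self _).trans (hD y hyK))
    · have : χ ((chartR n x).symm y) = 0 := image_eq_zero_of_notMem_tsupport fun h =>
        hyK ⟨_, h, (chartR n x).right_inv hy⟩
      simp [this, hr]
  · rw [Set.indicator_of_notMem hy]
    exact zero_le

/-- The Gagliardo–Nirenberg–Sobolev inequality in the chart, with exponents related by `1/q = 1/2 -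
1/n`, between the two comparisons of local and global norms. -/
lemma exists_eLpNorm_cutoff_le (hn : 3 ≤ n) (g : SmoothMetric n M)
    (hχ : ContMDiff (𝓡 n) 𝓘(ℝ, ℝ) ∞ χ) (hs : tsupport χ ⊆ (chartR n x).source) :
    ∃ C : NNReal, ∀ φ : M → ℂ, IsSmoothFun n φ →
      eLpNorm (fun p => (χ p : ℂ) * φ p) (ENNReal.ofReal (2 * n / (n - 2))) (riemannianVolume g) ≤
        C * sobolevEnergy g φ ^ (1 / 2 : ℝ) := by
  obtain ⟨C, hC⟩ := exists_local_energy_le g hχ hs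
  obtain ⟨D, hD⟩ := exists_lintegral_cutoff_le g hχ hs
  have hn' : (3 : ℝ) ≤ n := by exact_mod_cast hn
  set q : NNReal := (2 * n / (n - 2) : ℝ).toNNReal with hq
  have hq0 : (0 : ℝ) < 2 * n / (n - 2) := div_pos (by linarith) (by linarith)
  have hqr : (q : ℝ) = 2 * n / (n - 2) := Real.coe_toNNReal _ hq0.le
  have hqq : ENNReal.ofReal (2 * n / (n - 2)) = (q : ℝ≥0∞) := rfl
  have hqpos : 0 < (q : ℝ) := hqr ▸ hq0
  have hqne : (q : ℝ≥0∞) ≠ 0 := by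
    exact_mod_cast (NNReal.coe_pos.1 hqpos).ne'
  set S := SNormLESNormFDerivOfEqConst ℂ (volume : Measure (EuclideanSpace ℝ (Fin n))) ((2 : NNReal) : ℝ)
  refine ⟨D ^ (1 / q : ℝ) * S * C ^ (1 / 2 : ℝ), fun φ hφ => ?_⟩
  obtain ⟨hw, -, hwc⟩ := localRep_cutoff_properties hχ hs hφ
  set w := localRep (n := n) x fun p => (χ p : ℂ) * φ p with hwdef
  have h1 : eLpNorm w q volume ≤ S * eLpNorm (fderiv ℝ w) (2 : NNReal) volume := by
    refine eLpNorm_le_eLpNorm_fderiv_of_eq volume (hw.of_le (by simp)) hwc (by norm_num)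
      (by rw [finrank_euclideanSpace_fin]; omega) ?_
    rw [finrank_euclideanSpace_fin, hqr]
    have : (n : ℝ) - 2 ≠ 0 := by linarith
    push_cast
    field_simp
  have h2 : eLpNorm (fderiv ℝ w) (2 : NNReal) volume ≤ (C * sobolevEnergy g φ) ^ (1 / 2 : ℝ) := by
    rw [eLpNorm_eq_lintegral_rpow_enorm_toReal (by simp) (by simp)]
    simp only [ENNReal.coe_ofNat, ENNReal.toReal_ofNat, ENNReal.rpow_ofNat]
    exact ENNReal.rpow_le_rpow (le_self_add.trans (hC φ hφ)) (by norm_num)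
  have hD' := hD φ hφ q hqpos
  rw [hqq, eLpNorm_eq_lintegral_rpow_enorm_toReal hqne ENNReal.coe_ne_top, ENNReal.coe_toReal]
  calc _ ≤ (D * ∫⁻ y, ‖w y‖ₑ ^ (q : ℝ)) ^ (1 / (q : ℝ)) :=
        ENNReal.rpow_le_rpow hD' (by positivity)
    _ = (D : ℝ≥0∞) ^ (1 / (q : ℝ)) * eLpNorm w q volume := by
        rw [ENNReal.mul_rpow_of_nonneg _ _ (by positivity),
          eLpNorm_eq_lintegral_rpow_enorm_toReal hqne ENNReal.coe_ne_top, ENNReal.coe_toReal]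
    _ ≤ (D : ℝ≥0∞) ^ (1 / (q : ℝ)) * (S * (C * sobolevEnergy g φ) ^ (1 / 2 : ℝ)) := by
        gcongr
        exact h1.trans (by gcongr)
    _ = _ := by
        rw [ENNReal.mul_rpow_of_nonneg _ _ (by norm_num), ENNReal.coe_mul, ENNReal.coe_mul,
          ENNReal.coe_rpow_of_nonneg _ (by positivity), ENNReal.coe_rpow_of_nonneg _ (by norm_num)]
        ring

theorem exists_eLpNorm_le_sobolevEnergy (hn : 3 ≤ n) (g : SmoothMetric n M) :
    ∃ C : NNReal, ∀ φ : M → ℂ, IsSmoothFun n φ →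
      eLpNorm φ (ENNReal.ofReal (2 * n / (n - 2))) (riemannianVolume g) ≤
        C * sobolevEnergy g φ ^ (1 / 2 : ℝ) := by
  obtain ⟨t, χ, hχ, hχs, hχ1⟩ := exists_smooth_partition n M
  choose C hC using fun x => exists_eLpNorm_cutoff_le hn g (hχ x) (hχs x)
  refine ⟨∑ x ∈ t, C x, fun φ hφ => ?_⟩
  have hn' : (3 : ℝ) ≤ n := by exact_mod_cast hn
  have e : φ = ∑ x ∈ t, fun p => (χ x p : ℂ) * φ p := by
    ext p
    rw [Finset.sum_apply, ← Finset.sum_mul, ← Complex.ofReal_sum, hχ1 p]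
    simp
  have h1 : 1 ≤ ENNReal.ofReal (2 * n / (n - 2)) := by
    rw [ENNReal.one_le_ofReal, one_le_div (by linarith)]
    linarith
  conv_lhs => rw [e]
  refine (eLpNorm_sum_le (fun x _ => ?_) h1).trans ?_
  · exact (isSmoothFun_mul (isSmoothFun_ofReal (hχ x)) hφ).continuous.aestronglyMeasurable
  · rw [ENNReal.ofNNReal_finsetSum, Finset.sum_mul]
    exact Finset.sum_le_sum fun x _ => hC x φ hφ

end LocalEnergy

/-! ### The form domain of the Laplacian: Sobolev embedding and Rellich compactness -/

section FormDomain

variable {n : ℕ} {M : Type*} [TopologicalSpace M] [ChartedSpace (EuclideanSpace ℝ (Fin n)) M]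
  [IsManifold (𝓡 n) ∞ M] [CompactSpace M] [T2Space M] [MeasurableSpace M] [BorelSpace M]

/-- The form domain of the Laplacian. -/
abbrev SobolevSpace (g : SmoothMetric n M) : Type _ :=
  FormSpace (smoothLaplacian g) (isNonnegSymm_smoothLaplacian g)

/-- The inclusion of the form domain of the Laplacian into `L²(M)`. -/
abbrev sobolevIncl (g : SmoothMetric n M) : SobolevSpace g →L[ℂ] L2 g :=
  formIncl (smoothLaplacian g) (isNonnegSymm_smoothLaplacian g)

/-- The smooth functions, as elements of the form domain. -/
abbrev toSobolev (g : SmoothMetric n M) (u : (smoothLaplacian g).domain) : SobolevSpace g :=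
  toFormSpace (smoothLaplacian g) (isNonnegSymm_smoothLaplacian g) u

lemma dense_domain_smoothLaplacian (g : SmoothMetric n M) :
    Dense ((smoothLaplacian g).domain : Set (L2 g)) := by
  rw [smoothLaplacian_domain]; exact dense_smoothL2 g

lemma norm_sq_of_ae_eq (g : SmoothMetric n M) {u : L2 g} {φ : M → ℂ}
    (hu : u =ᵐ[riemannianVolume g] φ) : ‖u‖ ^ 2 = ∫ p, ‖φ p‖ ^ 2 ∂riemannianVolume g := by
  have h1 : (⟪u, u⟫_ℂ) = ((∫ p, ‖φ p‖ ^ 2 ∂riemannianVolume g : ℝ) : ℂ) := by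
    rw [L2.inner_def, ← integral_complex_ofReal]
    refine integral_congr_ae ?_
    filter_upwards [hu] with p hp
    rw [hp, inner_self_eq_norm_sq_to_K]
    simp
  rw [inner_self_eq_norm_sq_to_K] at h1
  apply Complex.ofReal_injective
  rw [← h1]
  simp

lemma enorm_sq_of_ae_eq (g : SmoothMetric n M) {u : L2 g} {φ : M → ℂ}
    (hu : u =ᵐ[riemannianVolume g] φ) : ‖u‖ₑ ^ 2 = ∫⁻ p, ‖φ p‖ₑ ^ 2 ∂riemannianVolume g := by
  rw [Lp.enorm_def, eLpNorm_congr_ae hu, eLpNorm_eq_lintegral_rpow_enorm_toReal (by simp) (by simp)]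
  simp only [ENNReal.toReal_ofNat, ENNReal.rpow_ofNat]
  rw [← ENNReal.rpow_natCast, ← ENNReal.rpow_mul]
  norm_num

lemma norm_sq_toSobolev (g : SmoothMetric n M) {u : (smoothLaplacian g).domain} {φ : M → ℂ}
    (hφ : IsSmoothFun n φ) (hu : (u : L2 g) =ᵐ[riemannianVolume g] φ)
    (hTu : smoothLaplacian g u =ᵐ[riemannianVolume g] fun p => -laplaceBeltrami g φ p) :
    ENNReal.ofReal (‖toSobolev g u‖ ^ 2) = sobolevEnergy g φ := by
  have hc1 := continuous_gradSq g hφ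
  have hc2 : Continuous fun p => ‖φ p‖ ^ 2 := hφ.continuous.norm.pow 2
  have hi : ∀ {f : M → ℝ}, Continuous f → Integrable f (riemannianVolume g) := fun hf =>
    hf.integrable_of_hasCompactSupport (HasCompactSupport.of_compactSpace _)
  rw [norm_sq_toFormSpace, inner_smoothLaplacian_self g hφ hu hTu, norm_sq_of_ae_eq g hu,
    ← integral_add (hi hc1) (hi hc2), ofReal_integral_eq_lintegral_ofReal
      (f := fun p => gradSq g φ p + ‖φ p‖ ^ 2) ((hi hc1).add (hi hc2)) (Eventually.of_forall fun p =>
        add_nonneg (gradSq_nonneg g φ p) (sq_nonneg _))]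
  rfl

/-- For smooth functions the energy is the squared form norm. The general case follows by density
and lower semicontinuity of the `L^p` norm. -/
theorem exists_eLpNorm_le_norm (hn : 3 ≤ n) (g : SmoothMetric n M) : ∃ C : NNReal,
    ∀ x : SobolevSpace g, eLpNorm (sobolevIncl g x) (ENNReal.ofReal (2 * n / (n - 2)))
      (riemannianVolume g) ≤ C * ‖x‖ₑ := by
  obtain ⟨C, hC⟩ := exists_eLpNorm_le_sobolevEnergy hn g
  refine ⟨C, fun x => ?_⟩
  have hsm : ∀ u : (smoothLaplacian g).domain, eLpNorm (sobolevIncl g (toSobolev g u))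
      (ENNReal.ofReal (2 * n / (n - 2))) (riemannianVolume g) ≤ C * ‖toSobolev g u‖ₑ := by
    intro u
    obtain ⟨φ, hφ, hu, hTu⟩ := exists_rep_of_mem_domain g u
    rw [formIncl_toFormSpace, eLpNorm_congr_ae hu]
    refine (hC φ hφ).trans_eq ?_
    rw [← norm_sq_toSobolev g hφ hu hTu, ← enorm_sq_eq_ofReal, ← ENNReal.rpow_natCast,
      ← ENNReal.rpow_mul]
    norm_num
  obtain ⟨s, hs, hsx⟩ := mem_closure_iff_seq_limit.1
    ((denseRange_toFormSpace (T := smoothLaplacian g) (hT := isNonnegSymm_smoothLaplacian g)) x)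
  have hL : Tendsto (fun k => sobolevIncl g (s k)) atTop (𝓝 (sobolevIncl g x)) :=
    ((sobolevIncl g).continuous.tendsto x).comp hsx
  obtain ⟨k, hk, hae⟩ := (tendstoInMeasure_of_tendsto_Lp hL).exists_seq_tendsto_ae
  have hlim : Tendsto (fun i => (C : ℝ≥0∞) * ‖s (k i)‖ₑ) atTop (𝓝 (C * ‖x‖ₑ)) :=
    ENNReal.Tendsto.const_mul ((continuous_enorm.tendsto x).comp (hsx.comp hk.tendsto_atTop))
      (Or.inr ENNReal.coe_ne_top)
  -- Fatou's lemma along a subsequence that converges almost everywhere.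
  refine (Lp.eLpNorm_lim_le_liminf_eLpNorm (fun i => Lp.aestronglyMeasurable _) _ hae).trans ?_
  rw [← hlim.liminf_eq]
  refine liminf_le_liminf (Eventually.of_forall fun i => ?_)
  obtain ⟨u, hu⟩ := hs (k i)
  rw [← hu]
  exact hsm u

/-- The local compactness estimate in a chart, with its functionals rewritten as inner products in
`L²(M)`, so that they make sense for every vector of the form domain. -/
lemma exists_functionals_cutoff (g : SmoothMetric n M) {x : M} {χ : M → ℝ}
    (hχ : ContMDiff (𝓡 n) 𝓘(ℝ, ℝ) ∞ χ) (hs : tsupport χ ⊆ (chartR n x).source) {ε : ℝ}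
    (hε : 0 < ε) : ∃ (s : Finset (EuclideanSpace ℝ (Fin n))) (k : EuclideanSpace ℝ (Fin n) → L2 g),
      ∀ (φ : M → ℂ) (u : L2 g), IsSmoothFun n φ → u =ᵐ[riemannianVolume g] φ →
        (∫⁻ p, ‖(χ p : ℂ) * φ p‖ₑ ^ 2 ∂riemannianVolume g) ≤
          ENNReal.ofReal ε * sobolevEnergy g φ + ∑ a ∈ s, ‖⟪k a, u⟫_ℂ‖ₑ ^ 2 := by
  obtain ⟨C, hC⟩ := exists_local_energy_le g hχ hs
  obtain ⟨D, hD⟩ := exists_lintegral_cutoff_le g hχ hs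
  have hK := isCompact_image_tsupport hs
  have hKt := image_tsupport_subset hs
  -- Chosen so that `D δ C ≤ ε`, with `D` and `C` from the comparisons of norms.
  set δ : ℝ := ε / (D * C + 1) with hδ
  have hδ0 : 0 < δ := by positivity
  obtain ⟨s, m, hm, hsm⟩ := exists_finite_functionals_of_support_subset volume hK hδ0
  -- Dividing by the density converts Lebesgue measure to Riemannian volume, `χ` carries the cutoff,
  -- and `√D` absorbs the factor `D`.
  set κ : EuclideanSpace ℝ (Fin n) → M → ℂ := fun a p =>
    (χ p : ℂ) * ((√D : ℝ) * m a (chartR n x p) / metricDensity g x (chartR n x p) : ℂ) with hκ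
  have hχC := isSmoothFun_ofReal hχ
  have hsC : tsupport (fun p => (χ p : ℂ)) ⊆ (chartR n x).source :=
    (closure_mono fun p hp h0 => hp (by simp [h0]) :
      tsupport (fun p => (χ p : ℂ)) ⊆ tsupport χ).trans hs
  have hκc : ∀ a, Continuous (κ a) := by
    intro a
    refine continuous_mul_of_tsupport_subset (chartR n x).open_source hχC.continuous hsC ?_
    refine ContinuousOn.div ?_ ?_ fun p hp => ?_
    · exact continuousOn_const.mul (Complex.continuous_ofReal.comp_continuousOn
        ((hm a).comp_continuousOn (chartR n x).continuousOn))
    · exact Complex.continuous_ofReal.comp_continuousOn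
        ((contDiffOn_metricDensity g x).continuousOn.comp (chartR n x).continuousOn
          (chartR n x).mapsTo)
    · exact_mod_cast (metricDensity_pos g ((chartR n x).map_source hp)).ne'
  have hκL : ∀ a, MemLp (κ a) 2 (riemannianVolume g) := fun a =>
    (hκc a).memLp_riemannianVolume g 2
  refine ⟨s, fun a => (hκL a).toLp, fun φ u hφ hu => ?_⟩
  obtain ⟨hw, hwK, hwc⟩ := localRep_cutoff_properties hχ hs hφ
  set w := localRep (n := n) x fun p => (χ p : ℂ) * φ p with hwdef
  have hinner : ∀ a, ⟪(hκL a).toLp, u⟫_ℂ = (√D : ℝ) * ∫ y, m a y • w y := by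
    intro a
    have e1 : ⟪(hκL a).toLp, u⟫_ℂ = ∫ p, κ a p * φ p ∂riemannianVolume g := by
      rw [L2.inner_def]
      refine integral_congr_ae ?_
      filter_upwards [hu, (hκL a).coeFn_toLp] with p h1 h2
      have h3 : conj (κ a p) = κ a p := by
        simp only [hκ, map_mul, map_div₀, Complex.conj_ofReal]
      rw [h1, h2, RCLike.inner_apply, h3, mul_comm]
    have e2 : ∫ p, κ a p * φ p ∂riemannianVolume g =
        ∫ p in (chartR n x).source, κ a p * φ p ∂riemannianVolume g := by
      refine (setIntegral_eq_integral_of_forall_compl_eq_zero fun p hp => ?_).symm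
      have : χ p = 0 := image_eq_zero_of_notMem_tsupport fun h => hp (hs h)
      simp [hκ, this]
    have e3 : ∫ y, m a y • w y = ∫ y in (chartR n x).target, m a y • w y := by
      refine (setIntegral_eq_integral_of_forall_compl_eq_zero fun y hy => ?_).symm
      rw [hwdef, localRep, Set.indicator_of_notMem hy, smul_zero]
    rw [e1, e2, setIntegral_source g x (f := fun p => κ a p * φ p)
      ((hκc a).mul hφ.continuous).measurable, e3, ← integral_const_mul]
    refine setIntegral_congr_fun (chartR n x).open_target.measurableSet fun y hy => ?_
    have hρ : (metricDensity g x y : ℂ) ≠ 0 := by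
      exact_mod_cast (metricDensity_pos g hy).ne'
    simp only [hκ, hwdef, localRep, Set.indicator_of_mem hy, inChart, (chartR n x).right_inv hy,
      Complex.real_smul]
    field_simp
  have hDD : ∀ a, ‖⟪(hκL a).toLp, u⟫_ℂ‖ₑ ^ 2 = D * ‖∫ y, m a y • w y‖ₑ ^ 2 := by
    intro a
    rw [hinner a, enorm_mul, mul_pow, enorm_sq_eq_ofReal, Complex.norm_real, Real.norm_eq_abs,
      sq_abs, Real.sq_sqrt D.coe_nonneg, ENNReal.ofReal_coe_nnreal]
  have h1 := hD φ hφ 2 two_pos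
  simp only [ENNReal.rpow_ofNat] at h1
  have h2 := hsm w (hw.of_le (by simp)) ((subset_tsupport _).trans hwK)
  have h3 := hC φ hφ
  refine h1.trans ((mul_le_mul_right (h2.trans (add_le_add_left (mul_le_mul_right h3 _) _)) _).trans ?_)
  rw [mul_add, Finset.mul_sum]
  refine add_le_add ?_ (Finset.sum_le_sum fun a _ => (hDD a).ge)
  rw [← mul_assoc, ← mul_assoc]
  refine mul_le_mul_left ?_ _
  rw [← ENNReal.ofReal_coe_nnreal (p := D), ← ENNReal.ofReal_coe_nnreal (p := C),
    ← ENNReal.ofReal_mul D.coe_nonneg, ← ENNReal.ofReal_mul (by positivity)]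
  refine ENNReal.ofReal_le_ofReal ?_
  have hDC : (0 : ℝ) ≤ D * C := by positivity
  rw [hδ]
  calc (D : ℝ) * (ε / (D * C + 1)) * C = ε * ((D * C) / (D * C + 1)) := by ring
    _ ≤ ε * 1 := by
        gcongr
        rw [div_le_one (by linarith)]
        linarith
    _ = ε := mul_one ε

/-- Rellich's theorem: summing the local estimates over the partition of unity gives the criterion
`isCompactOperator_of_finite_functionals` on smooth functions, and both sides are continuous on the
form domain. -/
theorem isCompactOperator_sobolevIncl (g : SmoothMetric n M) :
    IsCompactOperator (sobolevIncl g) := by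
  obtain ⟨t, χ, hχ, hχs, hχ1⟩ := exists_smooth_partition n M
  refine isCompactOperator_of_finite_functionals fun ε hε => ?_
  set N : ℝ := (t.card : ℝ) with hN
  -- One factor `N` comes from `‖∑ a‖² ≤ N ∑ ‖a‖²`, another from adding the `N` local errors.
  have hδ : 0 < ε / (N ^ 2 + 1) := by positivity
  choose s k hsk using fun x => exists_functionals_cutoff g (hχ x) (hχs x) hδ
  -- The factor `√N` absorbs the `N` in front of the squared functionals.
  refine ⟨(x : t) × s x.1, inferInstance, fun j => ((√N : ℝ) : ℂ) • k j.1.1 j.2.1, fun z => ?_⟩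
  refine (denseRange_toFormSpace (T := smoothLaplacian g) (hT := isNonnegSymm_smoothLaplacian g)).induction_on
    (p := fun z => ‖sobolevIncl g z‖ ^ 2 ≤ ε * ‖z‖ ^ 2 +
      ∑ j : (x : t) × s x.1, ‖⟪((√N : ℝ) : ℂ) • k j.1.1 j.2.1, sobolevIncl g z⟫_ℂ‖ ^ 2) z ?_ ?_
  · exact isClosed_le (by fun_prop) (by fun_prop)
  · intro u
    obtain ⟨φ, hφ, hu, hTu⟩ := exists_rep_of_mem_domain g u
    rw [formIncl_toFormSpace]
    have hE := norm_sq_toSobolev g hφ hu hTu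
    have h1 : ‖(u : L2 g)‖ₑ ^ 2 ≤ t.card * ∑ x ∈ t,
        ∫⁻ p, ‖(χ x p : ℂ) * φ p‖ₑ ^ 2 ∂riemannianVolume g := by
      rw [enorm_sq_of_ae_eq g hu, ← lintegral_finsetSum _ fun x _ =>
        (isSmoothFun_mul (isSmoothFun_ofReal (hχ x)) hφ).continuous.enorm.measurable.pow_const _,
        ← lintegral_const_mul' _ _ (by simp)]
      refine lintegral_mono fun p => ?_
      have e : φ p = ∑ x ∈ t, (χ x p : ℂ) * φ p := by
        rw [← Finset.sum_mul, ← Complex.ofReal_sum, hχ1 p]; simp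
      have h2 : ‖φ p‖ ^ 2 ≤ t.card * ∑ x ∈ t, ‖(χ x p : ℂ) * φ p‖ ^ 2 := by
        conv_lhs => rw [e]
        exact (pow_le_pow_left₀ (norm_nonneg _) (norm_sum_le _ _) 2).trans sq_sum_le_card_mul_sum_sq
      simp only [enorm_sq_eq_ofReal]
      rw [← ENNReal.ofReal_sum_of_nonneg fun _ _ => sq_nonneg _, ← ENNReal.ofReal_natCast,
        ← ENNReal.ofReal_mul (Nat.cast_nonneg _)]
      exact ENNReal.ofReal_le_ofReal h2
    have h2 : ‖(u : L2 g)‖ₑ ^ 2 ≤ t.card * ∑ x ∈ t, (ENNReal.ofReal (ε / (N ^ 2 + 1)) *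
        ENNReal.ofReal (‖toSobolev g u‖ ^ 2) + ∑ a ∈ s x, ‖⟪k x a, (u : L2 g)⟫_ℂ‖ₑ ^ 2) := by
      refine h1.trans (mul_le_mul_right (Finset.sum_le_sum fun x _ => ?_) _)
      rw [hE]
      exact hsk x φ u hφ hu
    have h3 : ‖(u : L2 g)‖ ^ 2 ≤ N * ∑ x ∈ t, (ε / (N ^ 2 + 1) * ‖toSobolev g u‖ ^ 2 +
        ∑ a ∈ s x, ‖⟪k x a, (u : L2 g)⟫_ℂ‖ ^ 2) := by
      have hpos : ∀ x, 0 ≤ ∑ a ∈ s x, ‖⟪k x a, (u : L2 g)⟫_ℂ‖ ^ 2 := fun x =>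
        Finset.sum_nonneg fun _ _ => sq_nonneg _
      have hpos' : 0 ≤ ε / (N ^ 2 + 1) * ‖toSobolev g u‖ ^ 2 := by positivity
      simp only [enorm_sq_eq_ofReal] at h2
      rw [← ENNReal.ofReal_le_ofReal_iff
        (mul_nonneg (Nat.cast_nonneg _) (Finset.sum_nonneg fun x _ => add_nonneg hpos' (hpos x)))]
      refine h2.trans_eq ?_
      rw [ENNReal.ofReal_mul (Nat.cast_nonneg _), hN, ENNReal.ofReal_natCast,
        ENNReal.ofReal_sum_of_nonneg fun x _ => add_nonneg hpos' (hpos x)]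
      congr 1
      refine Finset.sum_congr rfl fun x _ => ?_
      rw [ENNReal.ofReal_add hpos' (hpos x), ENNReal.ofReal_mul hδ.le,
        ENNReal.ofReal_sum_of_nonneg fun _ _ => sq_nonneg _]
    refine h3.trans ?_
    rw [Finset.sum_add_distrib, mul_add, Finset.sum_const, nsmul_eq_mul, ← hN]
    refine add_le_add ?_ (le_of_eq ?_)
    · have h4 : N * (N * (ε / (N ^ 2 + 1))) ≤ ε := by
        rw [← mul_assoc, ← pow_two, ← mul_div_assoc, div_le_iff₀ (by positivity)]
        nlinarith
      calc N * (N * (ε / (N ^ 2 + 1) * ‖toSobolev g u‖ ^ 2)) =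
          N * (N * (ε / (N ^ 2 + 1))) * ‖toSobolev g u‖ ^ 2 := by ring
        _ ≤ _ := mul_le_mul_of_nonneg_right h4 (sq_nonneg _)
    · rw [Fintype.sum_sigma, Finset.mul_sum, ← Finset.sum_coe_sort t]
      refine Finset.sum_congr rfl fun x _ => ?_
      rw [Finset.mul_sum, ← Finset.sum_coe_sort (s x.1)]
      refine Finset.sum_congr rfl fun a _ => ?_
      rw [inner_smul_left, norm_mul, mul_pow, RCLike.norm_conj, Complex.norm_real,
        Real.norm_eq_abs, sq_abs, Real.sq_sqrt (Nat.cast_nonneg _)]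

end FormDomain

/-! ### Potentials in `L^{n/2}` as bounded forms with infinitesimal relative bound -/

section Potential

variable {α : Type*} [MeasurableSpace α] {μ : Measure α}

/-- Hölder's inequality with the conjugate exponents `n/2` and `n/(n-2)`; the latter, applied to
`|u|²`, gives the exponent `2n/(n-2)` for `u`. -/
lemma lintegral_mul_sq_le_of_sobolev_exponent {n : ℕ} (hn : 3 ≤ n) {V : α → ℝ} {u : α → ℂ}
    (hV : AEStronglyMeasurable V μ) (hu : AEStronglyMeasurable u μ) :
    ∫⁻ p, ‖V p‖ₑ * ‖u p‖ₑ ^ 2 ∂μ ≤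
      eLpNorm V (ENNReal.ofReal (n / 2)) μ * eLpNorm u (ENNReal.ofReal (2 * n / (n - 2))) μ ^ 2 := by
  have hn' : (3 : ℝ) ≤ n := by exact_mod_cast hn
  have h2 : (n : ℝ) - 2 ≠ 0 := by linarith
  have h0 : (n : ℝ) ≠ 0 := by linarith
  have hq : (0 : ℝ) < 2 * n / (n - 2) := div_pos (by linarith) (by linarith)
  have hr : (0 : ℝ) < n / (n - 2) := div_pos (by linarith) (by linarith)
  have hpq : ((n : ℝ) / 2).HolderConjugate (n / (n - 2)) := by
    rw [Real.holderConjugate_iff]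
    refine ⟨by linarith, ?_⟩
    field_simp
    ring
  have e : 2 * ((n : ℝ) / (n - 2)) = 2 * n / (n - 2) := by ring
  refine (ENNReal.lintegral_mul_le_Lp_mul_Lq μ hpq hV.enorm (hu.enorm.pow_const 2)).trans_eq ?_
  rw [eLpNorm_eq_lintegral_rpow_enorm_toReal (ENNReal.ofReal_pos.2 (by linarith)).ne'
    ENNReal.ofReal_ne_top, eLpNorm_eq_lintegral_rpow_enorm_toReal (ENNReal.ofReal_pos.2 hq).ne'
    ENNReal.ofReal_ne_top, ENNReal.toReal_ofReal (by linarith), ENNReal.toReal_ofReal hq.le]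
  congr 1
  rw [← ENNReal.rpow_natCast, ← ENNReal.rpow_mul]
  congr 1
  · refine lintegral_congr fun p => ?_
    rw [← ENNReal.rpow_natCast, ← ENNReal.rpow_mul, ← e]
    norm_num
  · push_cast
    field_simp

variable {Q : Type*} [NormedAddCommGroup Q] [InnerProductSpace ℂ Q] [CompleteSpace Q]
  (ι : Q →L[ℂ] Lp ℂ 2 μ)

lemma enorm_sq_eq_lintegral (u : Lp ℂ 2 μ) : ‖u‖ₑ ^ 2 = ∫⁻ p, ‖u p‖ₑ ^ 2 ∂μ := by
  rw [Lp.enorm_def, eLpNorm_eq_lintegral_rpow_enorm_toReal (by simp) (by simp)]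
  simp only [ENNReal.toReal_ofNat, ENNReal.rpow_ofNat]
  rw [← ENNReal.rpow_natCast, ← ENNReal.rpow_mul]
  norm_num

/-- The potential `V` is form bounded with arbitrarily small bound. -/
def IsInfinitesimallyFormBounded (V : α → ℝ) : Prop :=
  ∀ ε : ℝ, 0 < ε → ∃ K : NNReal, ∀ x,
    ∫⁻ p, ‖V p‖ₑ * ‖ι x p‖ₑ ^ 2 ∂μ ≤ ENNReal.ofReal ε * ‖x‖ₑ ^ 2 + K * ‖ι x‖ₑ ^ 2

variable {ι}

/-- A bounded simple function `s` approximates `V` in `L^{n/2}`. The small difference is absorbed by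
the Sobolev norm, and `s` costs only a multiple of the `L²` norm. -/
lemma isInfinitesimallyFormBounded_of_memLp {n : ℕ} (hn : 3 ≤ n) {C : NNReal}
    (hC : ∀ x, eLpNorm (ι x) (ENNReal.ofReal (2 * n / (n - 2))) μ ≤ C * ‖x‖ₑ) {V : α → ℝ}
    (hV : MemLp V (ENNReal.ofReal (n / 2)) μ) : IsInfinitesimallyFormBounded ι V := by
  intro ε hε
  -- The Sobolev constant enters squared, and `C² / (C² + 1) ≤ 1`.
  have hδ : 0 < ε / (C ^ 2 + 1) := by positivity
  obtain ⟨s, hs, -⟩ := hV.exists_simpleFunc_eLpNorm_sub_lt ENNReal.ofReal_ne_top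
    (ENNReal.ofReal_pos.2 hδ).ne'
  obtain ⟨K, hK⟩ := s.exists_forall_norm_le
  refine ⟨K.toNNReal, fun x => ?_⟩
  have hsm : AEStronglyMeasurable s μ := s.aestronglyMeasurable
  have hu : AEStronglyMeasurable (ι x) μ := Lp.aestronglyMeasurable _
  have h1 : ∀ p, ‖V p‖ₑ * ‖ι x p‖ₑ ^ 2 ≤
      ‖V p - s p‖ₑ * ‖ι x p‖ₑ ^ 2 + K.toNNReal * ‖ι x p‖ₑ ^ 2 := by
    intro p
    rw [← add_mul]
    refine mul_le_mul_left ?_ _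
    have h2 : ‖V p‖ₑ ≤ ‖V p - s p‖ₑ + ‖s p‖ₑ := by
      simpa using enorm_add_le (V p - s p) (s p)
    refine h2.trans (add_le_add_right ?_ _)
    rw [← ofReal_norm]
    exact ENNReal.ofReal_le_ofReal (hK p)
  have hm : AEMeasurable (fun p => ‖V p - s p‖ₑ * ‖ι x p‖ₑ ^ 2) μ :=
    (hV.1.sub hsm).enorm.mul (hu.enorm.pow_const 2)
  refine (lintegral_mono h1).trans ?_
  rw [lintegral_add_left' hm, lintegral_const_mul' _ _ ENNReal.coe_ne_top, enorm_sq_eq_lintegral]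
  refine add_le_add_left ?_ _
  refine (lintegral_mul_sq_le_of_sobolev_exponent hn (hV.1.sub hsm) hu).trans ?_
  calc _ ≤ ENNReal.ofReal (ε / (C ^ 2 + 1)) * (C * ‖x‖ₑ) ^ 2 := by
        gcongr
        exact hC x
    _ = ENNReal.ofReal (ε / (C ^ 2 + 1) * C ^ 2) * ‖x‖ₑ ^ 2 := by
        rw [mul_pow, ← mul_assoc, ENNReal.ofReal_mul hδ.le, ENNReal.ofReal_pow C.coe_nonneg,
          ENNReal.ofReal_coe_nnreal]
    _ ≤ _ := by
        refine mul_le_mul_left (ENNReal.ofReal_le_ofReal ?_) _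
        rw [div_mul_eq_mul_div, div_le_iff₀ (by positivity)]
        nlinarith

/-- Cauchy–Schwarz after splitting `|V| = |V|^{1/2} |V|^{1/2}` reduces to the diagonal case. -/
lemma exists_lintegral_potential_le {V : α → ℝ} (hVm : AEStronglyMeasurable V μ)
    (hV : IsInfinitesimallyFormBounded ι V) : ∃ K : NNReal, ∀ x y,
      ∫⁻ p, ‖V p‖ₑ * ‖ι x p‖ₑ * ‖ι y p‖ₑ ∂μ ≤ K * ‖x‖ₑ * ‖y‖ₑ := by
  obtain ⟨K, hK⟩ := hV 1 one_pos
  set K₀ : NNReal := 1 + K * ‖ι‖₊ ^ 2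
  have h1 : ∀ x, ∫⁻ p, ‖V p‖ₑ * ‖ι x p‖ₑ ^ 2 ∂μ ≤ K₀ * ‖x‖ₑ ^ 2 := by
    intro x
    refine (hK x).trans ?_
    have h2 : ‖ι x‖ₑ ≤ ‖ι‖₊ * ‖x‖ₑ := by
      rw [enorm_eq_nnnorm, enorm_eq_nnnorm]
      exact_mod_cast ι.le_opNNNorm x
    calc _ ≤ ENNReal.ofReal 1 * ‖x‖ₑ ^ 2 + K * (‖ι‖₊ * ‖x‖ₑ) ^ 2 := by gcongr
      _ = _ := by
        simp only [ENNReal.ofReal_one, K₀]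
        push_cast
        ring
  refine ⟨K₀, fun x y => ?_⟩
  set f : Q → α → ℝ≥0∞ := fun x p => ‖V p‖ₑ ^ (1 / 2 : ℝ) * ‖ι x p‖ₑ
  have hf : ∀ x, AEMeasurable (f x) μ := fun x =>
    (hVm.enorm.pow_const _).mul (Lp.aestronglyMeasurable (ι x)).enorm
  have hf2 : ∀ x p, f x p ^ 2 = ‖V p‖ₑ * ‖ι x p‖ₑ ^ 2 := fun x p => by
    rw [mul_pow, ← ENNReal.rpow_natCast, ← ENNReal.rpow_mul]
    norm_num
  have h3 := sq_lintegral_mul_le μ (hf x) (hf y)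
  simp only [hf2] at h3
  have h4 : ∀ p, f x p * f y p = ‖V p‖ₑ * ‖ι x p‖ₑ * ‖ι y p‖ₑ := fun p => by
    have : ‖V p‖ₑ ^ (1 / 2 : ℝ) * ‖V p‖ₑ ^ (1 / 2 : ℝ) = ‖V p‖ₑ := by
      rw [← ENNReal.rpow_add_of_nonneg _ _ (by norm_num) (by norm_num)]
      norm_num
    calc _ = (‖V p‖ₑ ^ (1 / 2 : ℝ) * ‖V p‖ₑ ^ (1 / 2 : ℝ)) * ‖ι x p‖ₑ * ‖ι y p‖ₑ := by
          simp only [f]; ring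
      _ = _ := by rw [this]
  simp only [h4] at h3
  refine (ENNReal.pow_le_pow_left_iff two_ne_zero).1 (h3.trans ((mul_le_mul' (h1 x) (h1 y)).trans_eq ?_))
  ring

lemma integrable_potential {V : α → ℝ} (hVm : AEStronglyMeasurable V μ)
    (hV : IsInfinitesimallyFormBounded ι V) (x y : Q) :
    Integrable (fun p => (V p : ℂ) * ι x p * conj (ι y p)) μ := by
  obtain ⟨K, hK⟩ := exists_lintegral_potential_le hVm hV
  refine ⟨((Complex.continuous_ofReal.comp_aestronglyMeasurable hVm).mul
    (Lp.aestronglyMeasurable _)).mul (Complex.continuous_conj.comp_aestronglyMeasurable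
      (Lp.aestronglyMeasurable _)), ?_⟩
  rw [HasFiniteIntegral]
  refine lt_of_le_of_lt ?_ (lt_of_le_of_lt (hK x y) (by
    exact ENNReal.mul_lt_top (ENNReal.mul_lt_top ENNReal.coe_lt_top enorm_lt_top) enorm_lt_top))
  refine lintegral_mono fun p => le_of_eq ?_
  rw [enorm_mul, enorm_mul, RCLike.enorm_conj, ← ofReal_norm (V p : ℂ), Complex.norm_real, ofReal_norm]

lemma enorm_integral_potential_le {V : α → ℝ} (x y : Q) :
    ‖∫ p, (V p : ℂ) * ι x p * conj (ι y p) ∂μ‖ₑ ≤ ∫⁻ p, ‖V p‖ₑ * ‖ι x p‖ₑ * ‖ι y p‖ₑ ∂μ := by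
  refine (enorm_integral_le_lintegral_enorm _).trans_eq (lintegral_congr fun p => ?_)
  rw [enorm_mul, enorm_mul, RCLike.enorm_conj, ← ofReal_norm (V p : ℂ), Complex.norm_real, ofReal_norm]

/-- The form of `V` is a bounded sesquilinear form on `Q`, so the Riesz representation gives `W`; it
is self-adjoint because `V` is real. -/
theorem exists_potentialOp {V : α → ℝ} (hVm : AEStronglyMeasurable V μ)
    (hV : IsInfinitesimallyFormBounded ι V) : ∃ W : Q →L[ℂ] Q, IsSelfAdjoint W ∧
      ∀ x y, ⟪y, W x⟫_ℂ = ∫ p, (V p : ℂ) * ι x p * conj (ι y p) ∂μ := by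
  obtain ⟨K, hK⟩ := exists_lintegral_potential_le hVm hV
  have hI := integrable_potential hVm hV
  let b : Q →ₗ⋆[ℂ] Q →ₗ[ℂ] ℂ := LinearMap.mk₂'ₛₗ (starRingEnd ℂ) (RingHom.id ℂ)
    (fun y x => ∫ p, (V p : ℂ) * ι x p * conj (ι y p) ∂μ)
    (fun y₁ y₂ x => by
      rw [← integral_add (hI x y₁) (hI x y₂)]
      refine integral_congr_ae ?_
      filter_upwards [Lp.coeFn_add (ι y₁) (ι y₂)] with p hp
      rw [map_add, hp, Pi.add_apply, map_add]
      ring)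
    (fun c y x => by
      rw [smul_eq_mul, ← integral_const_mul]
      refine integral_congr_ae ?_
      filter_upwards [Lp.coeFn_smul c (ι y)] with p hp
      rw [map_smul, hp, Pi.smul_apply, smul_eq_mul, map_mul]
      ring)
    (fun y x₁ x₂ => by
      rw [← integral_add (hI x₁ y) (hI x₂ y)]
      refine integral_congr_ae ?_
      filter_upwards [Lp.coeFn_add (ι x₁) (ι x₂)] with p hp
      rw [map_add, hp, Pi.add_apply]
      ring)
    (fun c y x => by
      rw [RingHom.id_apply, smul_eq_mul, ← integral_const_mul]
      refine integral_congr_ae ?_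
      filter_upwards [Lp.coeFn_smul c (ι x)] with p hp
      rw [map_smul, hp, Pi.smul_apply, smul_eq_mul]
      ring)
  have hb : ∀ y x, b y x = ∫ p, (V p : ℂ) * ι x p * conj (ι y p) ∂μ := fun y x => rfl
  have hbound : ∀ y x, ‖b y x‖ ≤ K * ‖y‖ * ‖x‖ := by
    intro y x
    have h := (enorm_integral_potential_le (V := V) x y).trans (hK x y)
    simp only [enorm_eq_nnnorm] at h
    rw [hb, mul_right_comm]
    exact_mod_cast h
  have hconj : ∀ x y, conj (b x y) = b y x := by
    intro x y
    rw [hb, hb, ← integral_conj]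
    refine integral_congr_ae (Eventually.of_forall fun p => ?_)
    simp only [map_mul, Complex.conj_ofReal, Complex.conj_conj]
    ring
  set W := InnerProductSpace.continuousLinearMapOfBilin (𝕜 := ℂ) (b.mkContinuous₂ K hbound)
  have hW : ∀ v w, ⟪W v, w⟫_ℂ = b v w := fun v w => by
    rw [InnerProductSpace.continuousLinearMapOfBilin_apply, LinearMap.mkContinuous₂_apply]
  have hW' : ∀ v w, ⟪w, W v⟫_ℂ = b w v := fun v w => by
    rw [← inner_conj_symm, hW, hconj]
  refine ⟨W, ?_, fun x y => hW' x y⟩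
  rw [ContinuousLinearMap.isSelfAdjoint_iff_isSymmetric]
  intro x y
  exact (hW x y).trans (hW' y x).symm

lemma re_inner_potentialOp_ge {V : α → ℝ} (hV : IsInfinitesimallyFormBounded ι V) {W : Q →L[ℂ] Q}
    (hW : ∀ x y, ⟪y, W x⟫_ℂ = ∫ p, (V p : ℂ) * ι x p * conj (ι y p) ∂μ) {ε : ℝ} (hε : 0 < ε) :
    ∃ K : ℝ, ∀ x, -(ε * ‖x‖ ^ 2 + K * ‖ι x‖ ^ 2) ≤ (⟪x, W x⟫_ℂ).re := by
  obtain ⟨K, hK⟩ := hV ε hε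
  refine ⟨K, fun x => ?_⟩
  have h1 : ‖⟪x, W x⟫_ℂ‖ₑ ≤ ENNReal.ofReal (ε * ‖x‖ ^ 2 + K * ‖ι x‖ ^ 2) := by
    rw [hW, ENNReal.ofReal_add (by positivity) (by positivity), ENNReal.ofReal_mul hε.le,
      ENNReal.ofReal_mul K.coe_nonneg, ENNReal.ofReal_coe_nnreal, ← enorm_sq_eq_ofReal,
      ← enorm_sq_eq_ofReal]
    refine (enorm_integral_potential_le x x).trans ((lintegral_congr fun p => ?_).trans_le (hK x))
    ring
  rw [← ofReal_norm, ENNReal.ofReal_le_ofReal_iff (by positivity)] at h1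
  exact neg_le_of_abs_le ((Complex.abs_re_le_norm _).trans h1)

end Potential

/-! ### The Schrödinger form and operator -/

section Schrodinger

variable {n : ℕ} {M : Type*} [TopologicalSpace M] [ChartedSpace (EuclideanSpace ℝ (Fin n)) M]
  [IsManifold (𝓡 n) ∞ M] [CompactSpace M] [T2Space M] [MeasurableSpace M] [BorelSpace M]
  (g : SmoothMetric n M)

lemma injective_sobolevIncl : Function.Injective (sobolevIncl g) := injective_formIncl

lemma denseRange_sobolevIncl : DenseRange (sobolevIncl g) :=
  denseRange_formIncl (dense_domain_smoothLaplacian g)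

lemma shiftOp_laplacian : shiftOp (laplacian g) 1 = formOp (sobolevIncl g) 1 :=
  shiftOp_friedrichs (dense_domain_smoothLaplacian g) _

lemma isCoerciveOp_one {Q : Type*} [NormedAddCommGroup Q] [InnerProductSpace ℂ Q] :
    IsCoerciveOp 1 (1 : Q →L[ℂ] Q) := by
  refine ⟨one_pos, fun x => ?_⟩
  rw [one_mul, one_apply_eq_self]
  exact (norm_sq_eq_re_inner (𝕜 := ℂ) x).le

lemma isPosSqrt_sqrtLaplacian : IsPosSqrt (sqrtLaplacian g) (shiftOp (laplacian g) 1) := by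
  refine isPosSqrt_opSqrt ?_
  rw [shiftOp_laplacian]
  exact exists_isPosSqrt_formOp (injective_sobolevIncl g) (denseRange_sobolevIncl g)
    isCoerciveOp_one (IsSelfAdjoint.one _)

/-- Although `opSqrt` merely chooses a square root, its domain and the products of its values are
determined by the form space. -/
lemma sqrtLaplacian_domain_and_inner :
    (∀ u, u ∈ (sqrtLaplacian g).domain ↔ ∃ x, sobolevIncl g x = u) ∧
    ∀ x y u v, (sobolevIncl g x, u) ∈ (sqrtLaplacian g).graph →
      (sobolevIncl g y, v) ∈ (sqrtLaplacian g).graph → ⟪v, u⟫_ℂ = ⟪y, x⟫_ℂ :=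
  IsPosSqrt.domain_and_inner (injective_sobolevIncl g) (denseRange_sobolevIncl g)
    isCoerciveOp_one (IsSelfAdjoint.one _) (shiftOp_laplacian g ▸ isPosSqrt_sqrtLaplacian g)

variable {g} {V : M → ℝ} {W : SobolevSpace g →L[ℂ] SobolevSpace g}

/-- The form of `-Δ_g + V` on the form domain of the Laplacian, given the form `W` of `V`. -/
def schrodingerOp (W : SobolevSpace g →L[ℂ] SobolevSpace g) :
    SobolevSpace g →L[ℂ] SobolevSpace g :=
  1 - (sobolevIncl g).adjoint ∘L sobolevIncl g + W

lemma inner_schrodingerOp (x y : SobolevSpace g) : ⟪y, schrodingerOp W x⟫_ℂ =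
    ⟪y, x⟫_ℂ - ⟪sobolevIncl g y, sobolevIncl g x⟫_ℂ + ⟪y, W x⟫_ℂ := by
  simp only [schrodingerOp, add_apply, sub_apply, one_apply_eq_self,
    ContinuousLinearMap.comp_apply, inner_add_right, inner_sub_right,
    ContinuousLinearMap.adjoint_inner_right]

lemma isSelfAdjoint_adjoint_comp {H Q : Type*} [NormedAddCommGroup H] [InnerProductSpace ℂ H]
    [CompleteSpace H] [NormedAddCommGroup Q] [InnerProductSpace ℂ Q] [CompleteSpace Q]
    (ι : Q →L[ℂ] H) : IsSelfAdjoint (ι.adjoint ∘L ι) := by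
  rw [ContinuousLinearMap.isSelfAdjoint_iff_isSymmetric]
  intro x y
  simp [ContinuousLinearMap.adjoint_inner_left, ContinuousLinearMap.adjoint_inner_right]

lemma isSelfAdjoint_schrodingerOp (hW : IsSelfAdjoint W) : IsSelfAdjoint (schrodingerOp W) :=
  ((IsSelfAdjoint.one _).sub (isSelfAdjoint_adjoint_comp _)).add hW

lemma isSelfAdjoint_schrodingerOp_add (hW : IsSelfAdjoint W) (N : ℝ) :
    IsSelfAdjoint (schrodingerOp W + (N : ℂ) • ((sobolevIncl g).adjoint ∘L sobolevIncl g)) :=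
  (isSelfAdjoint_schrodingerOp hW).add
    (IsSelfAdjoint.smul (Complex.conj_ofReal N) (isSelfAdjoint_adjoint_comp _))

/-- Relative bound `1/2` leaves `‖x‖²/2` of the kinetic part. The negative multiple of `‖ι x‖²` is
`-(1 + K)`, where the `1` is the subtracted `L²` norm, so `N ≥ K + 1` compensates it. -/
lemma isCoerciveOp_schrodingerOp {K : ℝ}
    (hK : ∀ x, -(1 / 2 * ‖x‖ ^ 2 + K * ‖sobolevIncl g x‖ ^ 2) ≤ (⟪x, W x⟫_ℂ).re) {N : ℝ}
    (hN : K + 1 ≤ N) : IsCoerciveOp (1 / 2)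
      (schrodingerOp W + (N : ℂ) • ((sobolevIncl g).adjoint ∘L sobolevIncl g)) := by
  refine ⟨by norm_num, fun x => ?_⟩
  rw [add_apply, inner_add_right, inner_schrodingerOp, smul_apply, inner_smul_right,
    ContinuousLinearMap.comp_apply, ContinuousLinearMap.adjoint_inner_right]
  simp only [Complex.add_re, Complex.sub_re, Complex.re_ofReal_mul]
  have h1 : (⟪x, x⟫_ℂ).re = ‖x‖ ^ 2 := (norm_sq_eq_re_inner (𝕜 := ℂ) x).symm
  have h2 : (⟪sobolevIncl g x, sobolevIncl g x⟫_ℂ).re = ‖sobolevIncl g x‖ ^ 2 :=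
    (norm_sq_eq_re_inner (𝕜 := ℂ) _).symm
  rw [h1, h2]
  nlinarith [hK x, mul_nonneg (sub_nonneg.2 hN) (sq_nonneg ‖sobolevIncl g x‖)]

lemma isModelOf_schrodingerForm (hWs : IsSelfAdjoint W)
    (hW : ∀ x y, ⟪y, W x⟫_ℂ = ∫ p, (V p : ℂ) * sobolevIncl g x p * conj (sobolevIncl g y p)
      ∂riemannianVolume g) :
    IsModelOf (sobolevIncl g) (schrodingerOp W) (schrodingerForm g V) := by
  refine ⟨injective_sobolevIncl g, denseRange_sobolevIncl g, (sqrtLaplacian_domain_and_inner g).1,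
    isSelfAdjoint_schrodingerOp hWs, fun u v x y hx hy => ?_⟩
  have h := (sqrtLaplacian_domain_and_inner g).2 x y (sqrtLaplacian g u) (sqrtLaplacian g v)
    (hx ▸ (sqrtLaplacian g).mem_graph u) (hy ▸ (sqrtLaplacian g).mem_graph v)
  rw [inner_schrodingerOp, hW, hx, hy, ← h, schrodingerForm]

lemma integral_mul_smooth_eq_inner {u : L2 g} {w : L2 g} {φ : M → ℂ}
    (hw : w =ᵐ[riemannianVolume g] conjFun φ) :
    ∫ p, u p * φ p ∂riemannianVolume g = ⟪w, u⟫_ℂ := by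
  rw [L2.inner_def]
  refine integral_congr_ae ?_
  filter_upwards [hw] with p hp
  rw [hp, RCLike.inner_apply, conjFun, Complex.conj_conj]

/-- Against a smooth vector the kinetic form moves the Laplacian onto the test function. The vector
tested with is the conjugate of `φ`, since the form is antilinear in it while the distributional
pairing is bilinear. -/
lemma inner_toSobolev_schrodingerOp
    (hW : ∀ x y, ⟪y, W x⟫_ℂ = ∫ p, (V p : ℂ) * sobolevIncl g x p * conj (sobolevIncl g y p)
      ∂riemannianVolume g) {φ : M → ℂ} {w : (smoothLaplacian g).domain}
    (hw : (w : L2 g) =ᵐ[riemannianVolume g] conjFun φ)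
    (hTw : smoothLaplacian g w =ᵐ[riemannianVolume g] fun p => -laplaceBeltrami g (conjFun φ) p)
    (x : SobolevSpace g) : ⟪toSobolev g w, schrodingerOp W x⟫_ℂ =
      ∫ p, sobolevIncl g x p * -laplaceBeltrami g φ p ∂riemannianVolume g +
        ∫ p, (V p : ℂ) * sobolevIncl g x p * φ p ∂riemannianVolume g := by
  have h1 : ⟪toSobolev g w, x⟫_ℂ = ⟪smoothLaplacian g w + (w : L2 g), sobolevIncl g x⟫_ℂ := by
    rw [← inner_conj_symm, inner_toFormSpace_right, inner_conj_symm]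
  rw [inner_schrodingerOp, h1, hW, formIncl_toFormSpace, inner_add_left, add_sub_cancel_right]
  congr 1
  · refine (integral_mul_smooth_eq_inner (φ := fun p => -laplaceBeltrami g φ p)
      (hTw.trans (Eventually.of_forall fun p => ?_))).symm
    simp only
    rw [laplaceBeltrami_conjFun, conjFun, map_neg]
  · refine integral_congr_ae ?_
    filter_upwards [hw] with p hp
    rw [hp, conjFun, Complex.conj_conj]

/-- The operator associated with the form of `-Δ_g + V` acts as the distribution `-Δ_g u + V u`. -/
lemma mem_graph_schrodinger_iff
    (hW : ∀ x y, ⟪y, W x⟫_ℂ = ∫ p, (V p : ℂ) * sobolevIncl g x p * conj (sobolevIncl g y p)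
      ∂riemannianVolume g) (u f : L2 g) :
    (u, f) ∈ (formOp (sobolevIncl g) (schrodingerOp W)).graph ↔ u ∈ (sqrtLaplacian g).domain ∧
      ∀ φ : M → ℂ, IsSmoothFun n φ →
        ∫ p, u p * -laplaceBeltrami g φ p ∂riemannianVolume g
          + ∫ p, (V p : ℂ) * u p * φ p ∂riemannianVolume g
        = ∫ p, f p * φ p ∂riemannianVolume g := by
  have hi := injective_sobolevIncl g
  have hd := denseRange_sobolevIncl g
  have hdom := (sqrtLaplacian_domain_and_inner g).1
  constructor
  · intro h
    obtain ⟨x, rfl, -⟩ := (mem_graph_formOp hi hd _ _ _).1 h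
    refine ⟨(hdom _).2 ⟨x, rfl⟩, fun φ hφ => ?_⟩
    obtain ⟨w, hw, hTw⟩ := exists_mem_domain g (isSmoothFun_conjFun hφ)
    rw [← inner_toSobolev_schrodingerOp hW hw hTw, (mem_graph_formOp_iff_inner hi hd _ x f).1 h,
      formIncl_toFormSpace, integral_mul_smooth_eq_inner hw]
  · rintro ⟨hu, h⟩
    obtain ⟨x, rfl⟩ := (hdom u).1 hu
    rw [mem_graph_formOp_iff_inner hi hd]
    intro y
    -- The distributional equation is the weak equation on smooth functions; both sides are
    -- continuous in the form norm, so density gives all of the form domain.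
    refine denseRange_toFormSpace.induction_on
      (p := fun y => ⟪y, schrodingerOp W x⟫_ℂ = ⟪sobolevIncl g y, f⟫_ℂ) y ?_ fun w => ?_
    · exact isClosed_eq (by fun_prop) (by fun_prop)
    · obtain ⟨ψ, hψ, hw, hTw⟩ := exists_rep_of_mem_domain g w
      rw [← conjFun_conjFun ψ] at hw hTw
      rw [formIncl_toFormSpace, inner_toSobolev_schrodingerOp hW hw hTw,
        h _ (isSmoothFun_conjFun hψ), integral_mul_smooth_eq_inner hw]

lemma isFormCore_smoothL2 {S : SobolevSpace g →L[ℂ] SobolevSpace g}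
    {q : (sqrtLaplacian g).domain → (sqrtLaplacian g).domain → ℂ}
    (h : IsModelOf (sobolevIncl g) S q) : IsFormCore q (smoothL2 g) := by
  refine h.isFormCore (fun u hu => ?_) ?_
  · rw [← smoothLaplacian_domain] at hu
    exact (h.mem_iff u).2 ⟨toSobolev g ⟨u, hu⟩, formIncl_toFormSpace _⟩
  · refine Dense.mono ?_ (denseRange_toFormSpace (T := smoothLaplacian g)
      (hT := isNonnegSymm_smoothLaplacian g))
    rintro _ ⟨u, rfl⟩
    rw [Set.mem_ofPred_eq, formIncl_toFormSpace, ← smoothLaplacian_domain]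
    exact u.2

/-- Since `‖B ι x‖² = ⟪x, S x⟫`, coercivity bounds the form norm by the square root; combined with
the Sobolev embedding this yields the final estimate. -/
lemma norm_sq_le_of_isCoerciveOp {H Q : Type*} [NormedAddCommGroup H] [InnerProductSpace ℂ H]
    [CompleteSpace H] [NormedAddCommGroup Q] [InnerProductSpace ℂ Q] [CompleteSpace Q]
    {ι : Q →L[ℂ] H} (hi : Function.Injective ι) (hd : DenseRange ι) {S : Q →L[ℂ] Q} {c : ℝ}
    (hc : IsCoerciveOp c S) (hS : IsSelfAdjoint S) {B : H →ₗ.[ℂ] H} (hB : IsPosSqrt B (formOp ι S))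
    (x : Q) : ∃ hx : ι x ∈ B.domain, c * ‖x‖ ^ 2 ≤ ‖B ⟨ι x, hx⟩‖ ^ 2 := by
  obtain ⟨h1, h2⟩ := hB.domain_and_inner hi hd hc hS
  have hx := (h1 (ι x)).2 ⟨x, rfl⟩
  refine ⟨hx, ?_⟩
  have h3 := h2 x x _ _ (B.mem_graph ⟨ι x, hx⟩) (B.mem_graph ⟨ι x, hx⟩)
  rw [norm_sq_eq_re_inner (𝕜 := ℂ) (B ⟨ι x, hx⟩), h3]
  exact hc.2 x

end Schrodinger

theorem proposition6p1 {n : ℕ} (hn : 3 ≤ n) {M : Type*} [TopologicalSpace M] [T2Space M]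
    [CompactSpace M] [ChartedSpace (EuclideanSpace ℝ (Fin n)) M] [IsManifold (𝓡 n) ∞ M]
    [MeasurableSpace M] [BorelSpace M] (g : SmoothMetric n M)
    (V : M → ℝ) (hV : MemLp V (ENNReal.ofReal (n / 2)) (riemannianVolume g)) :
    -- the operator `√(-Δ_g + 1)` and the form `q_V` on its domain are well defined
    IsPosSqrt (sqrtLaplacian g) (shiftOp (laplacian g) 1) ∧
    (∀ u v : (sqrtLaplacian g).domain,
      Integrable (fun p => (V p : ℂ) * (u : L2 g) p * conj ((v : L2 g) p))
        (riemannianVolume g)) ∧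
    -- `q_V` is symmetric, bounded from below and closed, and `C^∞(M)` is a form core of it
    (∀ u v, schrodingerForm g V v u = conj (schrodingerForm g V u v)) ∧
    FormBoundedBelow (schrodingerForm g V) ∧
    FormClosed (schrodingerForm g V) ∧
    IsFormCore (schrodingerForm g V) (smoothL2 g) ∧
    -- `q_V` defines a unique self-adjoint operator `H`, and `H` is semibounded
    ∃ H : L2 g →ₗ.[ℂ] L2 g,
      IsSelfAdjoint H ∧ OpBoundedBelow H ∧ FormRepresents (schrodingerForm g V) H ∧
      (∀ H' : L2 g →ₗ.[ℂ] L2 g, IsSelfAdjoint H' → FormRepresents (schrodingerForm g V) H' →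
        H' = H) ∧
      -- `Dom H` consists of all `u` in the form domain for which the distribution `-Δ_g u + V u`
      -- belongs to `L²(M)`, and `H u = -Δ_g u + V u`
      (∀ u f : L2 g, (u, f) ∈ H.graph ↔ u ∈ (sqrtLaplacian g).domain ∧
        ∀ φ : M → ℂ, IsSmoothFun n φ →
          ∫ p, u p * -laplaceBeltrami g φ p ∂riemannianVolume g
            + ∫ p, (V p : ℂ) * u p * φ p ∂riemannianVolume g
          = ∫ p, f p * φ p ∂riemannianVolume g) ∧
      -- the spectrum of `H` is discrete
      HasDiscreteSpectrum H ∧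
      -- the Sobolev estimate on `Dom H`, for all large `N`
      ∃ N₀ C : ℝ, ∀ N : ℝ, N₀ ≤ N →
        IsPosSqrt (opSqrt (shiftOp H N)) (shiftOp H N) ∧
        ∀ u ∈ H.domain, ∃ hu : u ∈ (opSqrt (shiftOp H N)).domain,
          eLpNorm u (ENNReal.ofReal (2 * n / (n - 2))) (riemannianVolume g) ≤
            ENNReal.ofReal (C * ‖opSqrt (shiftOp H N) ⟨u, hu⟩‖) := by
  have hi := injective_sobolevIncl g
  have hd := denseRange_sobolevIncl g
  obtain ⟨C, hC⟩ := exists_eLpNorm_le_norm hn g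
  have hVb := isInfinitesimallyFormBounded_of_memLp hn hC hV
  obtain ⟨W, hWs, hW⟩ := exists_potentialOp hV.1 hVb
  -- Any relative bound below `1` would do; `1/2` is the choice that `isCoerciveOp_schrodingerOp`
  -- expects.
  obtain ⟨K, hK⟩ := re_inner_potentialOp_ge hVb hW one_half_pos
  have hmodel := isModelOf_schrodingerForm hWs hW
  have hcoer := fun {N : ℝ} (hN : K + 1 ≤ N) => isCoerciveOp_schrodingerOp hK hN
  have hself := isSelfAdjoint_schrodingerOp_add hWs
  have hc := hcoer le_rfl
  -- The form itself need not be coercive, so self-adjointness is proved for the shift by `K + 1`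
  -- and transferred back.
  have hH : IsSelfAdjoint (formOp (sobolevIncl g) (schrodingerOp W)) := by
    refine isSelfAdjoint_of_shiftOp (N := K + 1) ?_
    rw [shiftOp_formOp hi hd]
    exact isSelfAdjoint_formOp_of_coercive hi hd hc (hself _)
  refine ⟨isPosSqrt_sqrtLaplacian g, fun u v => ?_, hmodel.form_symm, hmodel.formBoundedBelow hc,
    hmodel.formClosed hc, isFormCore_smoothL2 hmodel, formOp (sobolevIncl g) (schrodingerOp W), hH,
    opBoundedBelow_formOp hi hd hc, hmodel.formRepresents, fun H' h1 h2 => hmodel.eq_formOp hH h1 h2,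
    mem_graph_schrodinger_iff hW, hasDiscreteSpectrum_formOp hi hd
      (isCompactOperator_sobolevIncl g) hc (hself _), K + 1, C * √2, fun N hN => ?_⟩
  · obtain ⟨x, hx⟩ := (hmodel.mem_iff u).1 u.2
    obtain ⟨y, hy⟩ := (hmodel.mem_iff v).1 v.2
    rw [← hx, ← hy]
    exact integrable_potential hV.1 hVb x y
  · have hsq : IsPosSqrt (opSqrt (shiftOp (formOp (sobolevIncl g) (schrodingerOp W)) N))
        (shiftOp (formOp (sobolevIncl g) (schrodingerOp W)) N) := by
      refine isPosSqrt_opSqrt ?_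
      rw [shiftOp_formOp hi hd]
      exact exists_isPosSqrt_formOp hi hd (hcoer hN) (hself N)
    refine ⟨hsq, fun u hu => ?_⟩
    obtain ⟨f, hf⟩ := (mem_domain_iff_exists_graph _ _).1 hu
    obtain ⟨x, rfl, -⟩ := (mem_graph_formOp hi hd _ _ _).1 hf
    obtain ⟨hx, hle⟩ := norm_sq_le_of_isCoerciveOp hi hd (hcoer hN) (hself N)
      (B := opSqrt (shiftOp (formOp (sobolevIncl g) (schrodingerOp W)) N))
      (by rw [← shiftOp_formOp hi hd]; exact hsq) x
    refine ⟨hx, (hC x).trans ?_⟩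
    rw [← ofReal_norm, ← ENNReal.ofReal_coe_nnreal, ← ENNReal.ofReal_mul C.coe_nonneg, mul_assoc]
    refine ENNReal.ofReal_le_ofReal (mul_le_mul_of_nonneg_left ?_ C.coe_nonneg)
    -- Coercivity with constant `1/2` gives `‖x‖² ≤ 2‖B ι x‖²` for `B = √(H + N)`, hence the factor
    -- `√2`, uniformly in `N`.
    refine le_of_sq_le_sq ?_ (by positivity)
    rw [mul_pow, Real.sq_sqrt zero_le_two]
    linarith

end
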